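/- Let $X$ be a compact (connected) Riemann surface of genus $g\ge 2$ and let $q$ be a holomorphic quadratic differential on $X$, not identically zero, all of whose zeros are simple. Let $\rho:\hat X\to X$ be its canonical double cover: $\hat X$ is a compact connected Riemann surface, $\rho$ is a holomorphic double cover ramified exactly over the zeros of $q$, $\tau:\hat X\to\hat X$ is the holomorphic involution exchanging the sheets, and $\omega$ is an Abelian differential on $\hat X$ with $\rho^*q=\omega^2$ and $\tau^*\omega=-\omega$. A saddle connection of $\omega$ is a geodesic segment of the flat metric $|\omega|$ that joins two (possibly equal) zeros of $\omega$ and passes through no zero in its interior. Let $2r$ be the length of the shortest saddle connection of $\omega$. Let $H^{1,0}_{-1}(\hat X)$ be the space of holomorphic one-forms $\beta$ on $\hat X$ with $\tau^*\beta=-\beta$, and put $$\|\beta\|_{\mathrm{Hodge}}=\Big(\int_{\hat X}|\beta|^2\Big)^{1/2},$$ where $|\beta|^2=|f|^2\,dx\,dy$ in a local coordinate $z=x+iy$ with $\beta=f\,dz$. Then for every $\beta\in H^{1,0}_{-1}(\hat X)$ and every saddle connection $\gamma$ of $\omega$, $\beta$ is integrable along $\gamma$ and $$\frac{\left|\int_\gamma\beta\right|}{\left|\int_\gamma\omega\right|}\le\frac{\|\beta\|_{\mathrm{Hodge}}}{r}.$$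 Consequently $$\|\beta\|_{\mathrm{AGY}}:=\sup_\gamma\frac{\left|\int_\gamma\beta\right|}{\left|\int_\gamma\omega\right|}\le\frac{\|\beta\|_{\mathrm{Hodge}}}{r},$$ where the supremum is over all saddle connections $\gamma$ of $\omega$. -/

import Mathlib

open scoped Manifold ENNReal
open MeasureTheory

noncomputable section

namespace QuadDiff

/-! Throughout, a compact Riemann surface is a compact connected Hausdorff space `X` with an atlas
of charts in `ℂ` whose transition maps are holomorphic: `IsManifold 𝓘(ℂ) ⊤ X`. Here `⊤` is the
analytic order of smoothness, which over `ℂ` is holomorphy. -/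

section Differentials

/-- `(1,0)`-forms: a complex-linear functional on each complex tangent line. No regularity yet. -/
abbrev OneForm (X : Type*) [TopologicalSpace X] [ChartedSpace ℂ X] : Type _ :=
  ∀ x : X, TangentSpace 𝓘(ℂ) x →L[ℂ] ℂ

/-- Tensors of type `q(z) dz²`: a complex quadratic form on each complex tangent line.
No regularity yet. -/
abbrev QuadTensor (X : Type*) [TopologicalSpace X] [ChartedSpace ℂ X] : Type _ :=
  ∀ x : X, QuadraticForm ℂ (TangentSpace 𝓘(ℂ) x)

variable {X : Type*} [TopologicalSpace X] [ChartedSpace ℂ X]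

/-- The coordinate vector field `∂/∂z` of the chart `e`, at the point with coordinate `z`. -/
def coordVector (e : OpenPartialHomeomorph X ℂ) (z : ℂ) : TangentSpace 𝓘(ℂ) (e.symm z) :=
  mfderiv 𝓘(ℂ) 𝓘(ℂ) e.symm z (1 : ℂ)

/-- The coefficient `f` in the local expression `α = f(z) dz` in the chart `e`. -/
def OneForm.coeff (α : OneForm X) (e : OpenPartialHomeomorph X ℂ) (z : ℂ) : ℂ :=
  α (e.symm z) (coordVector e z)

/-- The coefficient `f` in the local expression `q = f(z) dz²` in the chart `e`. -/
def QuadTensor.coeff (q : QuadTensor X) (e : OpenPartialHomeomorph X ℂ) (z : ℂ) : ℂ :=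
  q (e.symm z) (coordVector e z)

variable (X) in
/-- The complex vector space `H^{1,0}(X)` of holomorphic one-forms (Abelian differentials):
the local coefficient is holomorphic in every holomorphic chart. -/
def holomorphicOneForms : Submodule ℂ (OneForm X) where
  carrier := {α | ∀ e ∈ IsManifold.maximalAtlas 𝓘(ℂ) ⊤ X,
    DifferentiableOn ℂ (OneForm.coeff α e) e.target}
  add_mem' hα hβ e he := (hα e he).add (hβ e he)
  zero_mem' _ _ := differentiableOn_const 0
  smul_mem' c _ hα e he := (hα e he).const_smul c

variable (X) in
/-- The genus of a compact Riemann surface: the dimension of its space of Abelian differentials. -/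
def genus : ℕ := Module.finrank ℂ (holomorphicOneForms X)

/-- Holomorphic quadratic differentials. -/
def QuadTensor.IsHolomorphic (q : QuadTensor X) : Prop :=
  ∀ e ∈ IsManifold.maximalAtlas 𝓘(ℂ) ⊤ X, DifferentiableOn ℂ (QuadTensor.coeff q e) e.target

/-- The order of vanishing of a quadratic differential at a point
(`0` if it does not vanish there, `⊤` if it vanishes near the point). -/
def QuadTensor.order (q : QuadTensor X) (p : X) : ℕ∞ :=
  analyticOrderAt (QuadTensor.coeff q (chartAt ℂ p)) (chartAt ℂ p p)

/-- `q` is a holomorphic quadratic differential, all of whose zeros are simple.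
(In particular `q` is not identically zero.) -/
structure QuadTensor.IsPrincipal (q : QuadTensor X) : Prop where
  isHolomorphic : QuadTensor.IsHolomorphic q
  simple : ∀ p, q p = 0 → QuadTensor.order q p = 1

/-- The pullback `φ^*α` of a one-form under a holomorphic map. -/
def OneForm.pullback {Y : Type*} [TopologicalSpace Y] [ChartedSpace ℂ Y]
    (φ : X → Y) (α : OneForm Y) : OneForm X :=
  fun x => (α (φ x)).comp (mfderiv 𝓘(ℂ) 𝓘(ℂ) φ x)

/-- The space `H^{1,0}_{-1}(X)` of holomorphic one-forms `β` with `τ^*β = -β`. -/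
def antiInvariantForms (τ : X → X) : Submodule ℂ (OneForm X) where
  carrier := {β | β ∈ holomorphicOneForms X ∧ OneForm.pullback τ β = -β}
  add_mem' {α β} hα hβ := ⟨add_mem hα.1 hβ.1, by
    rw [neg_add, ← hα.2, ← hβ.2]; rfl⟩
  zero_mem' := ⟨zero_mem _, by rw [neg_zero]; rfl⟩
  smul_mem' c α hα := ⟨Submodule.smul_mem _ c hα.1, by
    rw [← smul_neg, ← hα.2]; rfl⟩

/-- `ρ : Z → X`, with sheet-exchanging involution `τ` and Abelian differential `ω` on `Z`, is
the canonical double cover of `(X, q)`: a holomorphic double cover ramified exactly over the zeros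
of odd order of `q`, with `ρ^*q = ω²` and `τ^*ω = -ω`. -/
structure IsCanonicalDoubleCover {Z : Type*} [TopologicalSpace Z] [ChartedSpace ℂ Z]
    (q : QuadTensor X) (ρ : Z → X) (τ : Z → Z) (ω : OneForm Z) : Prop where
  holomorphic_proj : MDifferentiable 𝓘(ℂ) 𝓘(ℂ) ρ
  surjective_proj : Function.Surjective ρ
  holomorphic_invol : MDifferentiable 𝓘(ℂ) 𝓘(ℂ) τ
  involutive : Function.Involutive τ
  fiber : ∀ x y, ρ y = ρ x ↔ y = x ∨ y = τ x
  ramified : ∀ x, τ x = x ↔ ∃ k : ℕ, QuadTensor.order q (ρ x) = 2 * k + 1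
  abelian : ω ∈ holomorphicOneForms Z
  square : ∀ x (v : TangentSpace 𝓘(ℂ) x), q (ρ x) (mfderiv 𝓘(ℂ) 𝓘(ℂ) ρ x v) = ω x v ^ 2
  anti : OneForm.pullback τ ω = -ω

end Differentials

section Curves

variable {X : Type*} [TopologicalSpace X] [ChartedSpace ℂ X]

/-- The velocity of a curve `γ : ℝ → X`. -/
def velocity (γ : ℝ → X) (t : ℝ) : TangentSpace 𝓘(ℂ) (γ t) :=
  mfderiv 𝓘(ℝ, ℝ) 𝓘(ℝ, ℂ) γ t (1 : ℝ)

/-- The integral of a one-form along the curve `γ` on `[0, 1]`. -/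
def OneForm.integral (α : OneForm X) (γ : ℝ → X) : ℂ :=
  ∫ t in (0 : ℝ)..1, α (γ t) (velocity γ t)

/-- The length of the curve `γ` on `[0, 1]` for the flat metric `|ω|`. -/
def flatLength (ω : OneForm X) (γ : ℝ → X) : ℝ :=
  ∫ t in (0 : ℝ)..1, ‖ω (γ t) (velocity γ t)‖

/-- `γ`, on `[0, 1]`, is a saddle connection of `ω`: a geodesic segment of the flat metric `|ω|`,
parametrized proportionally to arc length, that joins two zeros of `ω` and passes through no zero
in its interior. In a local coordinate `z` with `ω = f dz` the metric is `|f|²|dz|²`, and its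
geodesic equation `γ'' + (f'/f)(γ) γ'² = 0` says `(f(γ) γ')' = 0`, that is, that `ω(γ')` is
constant; in a flat coordinate (`f = 1`), `γ` is a straight line. -/
structure IsSaddleConnection (ω : OneForm X) (γ : ℝ → X) : Prop where
  continuousOn : ContinuousOn γ (Set.Icc 0 1)
  start_zero : ω (γ 0) = 0
  end_zero : ω (γ 1) = 0
  interior_ne_zero : ∀ t ∈ Set.Ioo (0 : ℝ) 1, ω (γ t) ≠ 0
  differentiable : ∀ t ∈ Set.Ioo (0 : ℝ) 1, MDifferentiableAt 𝓘(ℝ, ℝ) 𝓘(ℝ, ℂ) γ t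
  geodesic : ∃ c : ℂ, c ≠ 0 ∧ ∀ t ∈ Set.Ioo (0 : ℝ) 1, ω (γ t) (velocity γ t) = c

/-- The set of lengths of all saddle connections of `ω`. -/
def saddleLengths (ω : OneForm X) : Set ℝ :=
  {L | ∃ γ : ℝ → X, IsSaddleConnection ω γ ∧ flatLength ω γ = L}

/-- The Avila–Gouëzel–Yoccoz norm at `ω` of the class of `η`: the supremum, a priori in `[0, ∞]`,
of `|∫_γ η| / |∫_γ ω|` over all saddle connections `γ` of `ω`. -/
def agyNorm (ω η : OneForm X) : ℝ≥0∞ :=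
  ⨆ (γ : ℝ → X) (_ : IsSaddleConnection ω γ),
    ENNReal.ofReal (‖OneForm.integral η γ‖ / ‖OneForm.integral ω γ‖)

end Curves

section Hodge

variable {X : Type*} [TopologicalSpace X] [ChartedSpace ℂ X] [MeasurableSpace X]

/-- The measure `|β|²` on the surface, given in each holomorphic chart `z`, where `β = f(z) dz`,
by `|f|²` times the Lebesgue measure of the `z`-plane. The measures given by the single charts agree
on overlaps, and the global measure is their supremum. -/
def OneForm.areaMeasure (β : OneForm X) : Measure X :=
  ⨆ e ∈ IsManifold.maximalAtlas 𝓘(ℂ) ⊤ X,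
    ((volume.restrict e.target).withDensity fun z => ‖OneForm.coeff β e z‖ₑ ^ 2).map e.symm

/-- The Hodge norm `(∫_X |β|²)^{1/2}`. -/
def hodgeNorm (β : OneForm X) : ℝ :=
  Real.sqrt (OneForm.areaMeasure β Set.univ).toReal

end Hodge

end QuadDiff

end

open QuadDiff

/-!
The comparison is local on the double cover: a saddle connection runs through discs that are
embedded for the flat metric, and on such a disc `β` is controlled by its `L²` norm.

The zeros of `ω` are double and fixed by the involution
(`QuadDiff.IsCanonicalDoubleCover.order_eq_two`), so that near a zero there is a coordinate `ζ` with
`ω = d(ζ ^ 3)`. In it the involution is `ζ ↦ -ζ`, and an anti-invariant form `β = g dζ` has an even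
coefficient `g` (`QuadDiff.IsCanonicalDoubleCover.pullbackCoeff_even`). The inverse of this
coordinate can be continued along a radius until the radius runs into a zero
(`QuadDiff.IsDeveloping.exists_extension`); such a radius would be a saddle connection, of length at
least `2 r`. Hence `ζ` parametrizes a disc of flat radius `2 r` (`QuadDiff.exists_isZeroDisc`).
Within flat distance `r` of the zeros these parametrizations are injective, and those of different
zeros are disjoint, because straight segments lift uniquely (`QuadDiff.IsZeroDisc.eq_of_eq`,
`QuadDiff.IsZeroDisc.eq_of_eq_self`). A point at flat distance at least `d` from the zeros, where
`3 d < 2 r`, is the centre of an embedded flat disc of radius `d` (`QuadDiff.exists_flat_disc`): a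
symmetry of the disc would, after lifting to the disc around a closest zero, produce another zero in
the latter.

Parametrize a saddle connection `γ` so that `ω(γ') = c`. Where `γ` is away from the zeros, the
pointwise bound for functions in the Bergman space of a disc (`QuadDiff.norm_le_of_lintegral_le`)
gives `|β(γ')| ≤ |c| ‖β‖ / r`, both in the flat discs and in the coordinates `ζ` with
`0.3 ≤ |ζ| ^ 2 / r ^ (2 / 3) ≤ 0.7`. Closer to a zero `β(γ')` is unbounded in general, and the same
bound holds on average only, over the whole chord of the disc `|ζ| ^ 2 < 0.7 r ^ (2 / 3)` on which
`γ` passes by (`QuadDiff.IsZeroDisc.exists_chord`). This is where evenness of `g` is needed: the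
primitive of `g` has only odd terms, and so is small (`QuadDiff.exists_primitive_norm_le`).
Different chords of `γ` are disjoint, and the bounds add up
(`QuadDiff.IsSaddleConnection.norm_integral_le`).
-/

namespace QuadDiff

open scoped Topology
open Filter Set Metric

/-! ### Coefficients of one-forms along parametrizations -/

section Basics

variable {X Y : Type*} [TopologicalSpace X] [ChartedSpace ℂ X]
  [TopologicalSpace Y] [ChartedSpace ℂ Y]

/-- The coefficient `f` in the expression `E^*α = f(z) dz` of the pullback of the one-form `α`
along a map `E` from (an open subset of) the plane. For the inverse of a chart this is
`OneForm.coeff`. -/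
noncomputable def pullbackCoeff (α : OneForm X) (E : ℂ → X) (z : ℂ) : ℂ :=
  α (E z) (mfderiv 𝓘(ℂ) 𝓘(ℂ) E z (1 : ℂ))

theorem mdifferentiableAt_real {f : X → Y} {x : X} (hf : MDifferentiableAt 𝓘(ℂ) 𝓘(ℂ) f x) :
    MDifferentiableAt 𝓘(ℝ, ℂ) 𝓘(ℝ, ℂ) f x := by
  rw [mdifferentiableAt_iff] at hf ⊢
  exact ⟨hf.1, hf.2.restrictScalars ℝ⟩

theorem mfderiv_real {f : X → Y} {x : X} (hf : MDifferentiableAt 𝓘(ℂ) 𝓘(ℂ) f x) (v : ℂ) :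
    (mfderiv 𝓘(ℝ, ℂ) 𝓘(ℝ, ℂ) f x : ℂ → ℂ) v = (mfderiv 𝓘(ℂ) 𝓘(ℂ) f x : ℂ → ℂ) v := by
  have h : HasMFDerivAt 𝓘(ℝ, ℂ) 𝓘(ℝ, ℂ) f x
      ((show ℂ →L[ℂ] ℂ from mfderiv 𝓘(ℂ) 𝓘(ℂ) f x).restrictScalars ℝ) := by
    have h1 := hf.hasMFDerivAt
    exact ⟨h1.1, h1.2.restrictScalars ℝ⟩
  rw [h.mfderiv]; rfl

theorem pullbackCoeff_congr (α : OneForm X) {E F : ℂ → X} {z : ℂ} (h : E =ᶠ[𝓝 z] F) :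
    pullbackCoeff α E z = pullbackCoeff α F z := by
  unfold pullbackCoeff
  have h1 := h.mfderiv_eq (I := 𝓘(ℂ)) (I' := 𝓘(ℂ))
  have h2 := h.eq_of_nhds
  clear h
  revert h1
  generalize mfderiv 𝓘(ℂ) 𝓘(ℂ) E z = A
  generalize mfderiv 𝓘(ℂ) 𝓘(ℂ) F z = B
  revert A B
  rw [h2]
  intro A B h; rw [h]

theorem pullbackCoeff_comp (α : OneForm X) {E : ℂ → X} {h : ℂ → ℂ} {z : ℂ}
    (hE : MDifferentiableAt 𝓘(ℂ) 𝓘(ℂ) E (h z)) (hh : DifferentiableAt ℂ h z) :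
    pullbackCoeff α (E ∘ h) z = pullbackCoeff α E (h z) * deriv h z := by
  unfold pullbackCoeff
  rw [mfderiv_comp z hE hh.mdifferentiableAt, mfderiv_eq_fderiv]
  change α (E (h z)) (mfderiv 𝓘(ℂ) 𝓘(ℂ) E (h z) ((fderiv ℂ h z : ℂ →L[ℂ] ℂ) 1)) = _
  have : (fderiv ℂ h z : ℂ →L[ℂ] ℂ) 1 = deriv h z • (1 : ℂ) := by simp
  rw [this]
  erw [map_smul, map_smul]
  rw [smul_eq_mul, mul_comm]

theorem velocity_comp {E : ℂ → X} {u : ℝ → ℂ} {u' : ℂ} {t : ℝ}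
    (hE : MDifferentiableAt 𝓘(ℂ) 𝓘(ℂ) E (u t)) (hu : HasDerivAt u u' t) :
    MDifferentiableAt 𝓘(ℝ, ℝ) 𝓘(ℝ, ℂ) (E ∘ u) t ∧ ∀ α : OneForm X,
      α (E (u t)) (velocity (E ∘ u) t) = pullbackCoeff α E (u t) * u' := by
  have hE' := mdifferentiableAt_real hE
  have hu' : MDifferentiableAt 𝓘(ℝ, ℝ) 𝓘(ℝ, ℂ) u t := hu.differentiableAt.mdifferentiableAt
  refine ⟨hE'.comp t hu', fun α => ?_⟩
  unfold velocity pullbackCoeff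
  rw [mfderiv_comp t hE' hu', mfderiv_eq_fderiv]
  change α (E (u t)) ((mfderiv 𝓘(ℝ, ℂ) 𝓘(ℝ, ℂ) E (u t) : ℂ → ℂ) ((fderiv ℝ u t : ℝ →L[ℝ] ℂ) 1)) = _
  rw [mfderiv_real hE]
  have : (fderiv ℝ u t : ℝ →L[ℝ] ℂ) 1 = u' • (1 : ℂ) := by
    rw [fderiv_apply_one_eq_deriv, hu.deriv]; simp
  rw [this]
  change α (E (u t)) (mfderiv 𝓘(ℂ) 𝓘(ℂ) E (u t) (u' • (1 : ℂ))) = _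
  erw [map_smul, map_smul]
  rw [smul_eq_mul, mul_comm]

theorem velocity_congr {γ η : ℝ → X} {t : ℝ} (α : OneForm X) (h : γ =ᶠ[𝓝 t] η) :
    α (γ t) (velocity γ t) = α (η t) (velocity η t) := by
  unfold velocity
  have h1 := h.mfderiv_eq (I := 𝓘(ℝ, ℝ)) (I' := 𝓘(ℝ, ℂ))
  have h2 := h.eq_of_nhds
  clear h
  revert h1
  generalize mfderiv 𝓘(ℝ, ℝ) 𝓘(ℝ, ℂ) γ t = A
  generalize mfderiv 𝓘(ℝ, ℝ) 𝓘(ℝ, ℂ) η t = B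
  revert A B
  rw [h2]
  intro A B h; rw [h]

theorem mdifferentiableAt_chart [IsManifold 𝓘(ℂ) ⊤ X] {e : OpenPartialHomeomorph X ℂ}
    (he : e ∈ IsManifold.maximalAtlas 𝓘(ℂ) ⊤ X) {x : X} (hx : x ∈ e.source) :
    MDifferentiableAt 𝓘(ℂ) 𝓘(ℂ) e x :=
  (contMDiffAt_of_mem_maximalAtlas he hx).mdifferentiableAt (by simp)

theorem mdifferentiableAt_chart_symm [IsManifold 𝓘(ℂ) ⊤ X] {e : OpenPartialHomeomorph X ℂ}
    (he : e ∈ IsManifold.maximalAtlas 𝓘(ℂ) ⊤ X) {z : ℂ} (hz : z ∈ e.target) :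
    MDifferentiableAt 𝓘(ℂ) 𝓘(ℂ) e.symm z :=
  (contMDiffAt_symm_of_mem_maximalAtlas he hz).mdifferentiableAt (by simp)

variable [IsManifold 𝓘(ℂ) ⊤ X]

theorem differentiableAt_chart_comp {E : ℂ → X} {z : ℂ} (hE : MDifferentiableAt 𝓘(ℂ) 𝓘(ℂ) E z)
    {e : OpenPartialHomeomorph X ℂ} (he : e ∈ IsManifold.maximalAtlas 𝓘(ℂ) ⊤ X)
    (hz : E z ∈ e.source) : DifferentiableAt ℂ (e ∘ E) z :=
  ((mdifferentiableAt_chart he hz).comp z hE).differentiableAt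

/-- Change of coordinates: the pullback along `E` in terms of the coefficient in a chart. -/
theorem pullbackCoeff_eq (α : OneForm X) {E : ℂ → X} {z : ℂ}
    (hE : MDifferentiableAt 𝓘(ℂ) 𝓘(ℂ) E z)
    {e : OpenPartialHomeomorph X ℂ} (he : e ∈ IsManifold.maximalAtlas 𝓘(ℂ) ⊤ X)
    (hz : E z ∈ e.source) :
    pullbackCoeff α E z = OneForm.coeff α e (e (E z)) * deriv (e ∘ E) z := by
  have h1 : E =ᶠ[𝓝 z] e.symm ∘ (e ∘ E) := by
    filter_upwards [hE.continuousAt.preimage_mem_nhds (e.open_source.mem_nhds hz)] with w hw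
    exact (e.left_inv hw).symm
  rw [pullbackCoeff_congr α h1, pullbackCoeff_comp α
    (mdifferentiableAt_chart_symm he (e.map_source hz)) (differentiableAt_chart_comp hE he hz)]
  rfl

theorem differentiableOn_pullbackCoeff {α : OneForm X} (hα : α ∈ holomorphicOneForms X)
    {E : ℂ → X} {U : Set ℂ} (hU : IsOpen U)
    (hE : ∀ z ∈ U, MDifferentiableAt 𝓘(ℂ) 𝓘(ℂ) E z) :
    DifferentiableOn ℂ (pullbackCoeff α E) U := by
  intro z hz
  set e := chartAt ℂ (E z)
  have he : e ∈ IsManifold.maximalAtlas 𝓘(ℂ) ⊤ X := IsManifold.chart_mem_maximalAtlas _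
  have hzs : E z ∈ e.source := mem_chart_source ℂ (E z)
  have hV : ∀ᶠ w in 𝓝 z, w ∈ U ∧ E w ∈ e.source :=
    (hU.eventually_mem hz).and
      ((hE z hz).continuousAt.preimage_mem_nhds (e.open_source.mem_nhds hzs))
  have h1 : pullbackCoeff α E =ᶠ[𝓝 z] fun w => OneForm.coeff α e (e (E w)) * deriv (e ∘ E) w := by
    filter_upwards [hV] with w hw
    exact pullbackCoeff_eq α (hE w hw.1) he hw.2
  have h2 : ∀ᶠ w in 𝓝 z, DifferentiableAt ℂ (e ∘ E) w := by
    filter_upwards [hV] with w hw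
    exact differentiableAt_chart_comp (hE w hw.1) he hw.2
  have h3 : AnalyticAt ℂ (e ∘ E) z := Complex.analyticAt_iff_eventually_differentiableAt.2 h2
  have h4 : DifferentiableAt ℂ (OneForm.coeff α e) ((e ∘ E) z) :=
    (hα e he).differentiableAt (e.open_target.mem_nhds (e.map_source hzs))
  exact (h1.differentiableAt_iff.2
    ((h4.comp z h3.differentiableAt).mul h3.deriv.differentiableAt)).differentiableWithinAt

/-- A curve read in a chart. -/
theorem hasDerivAt_chart_comp {γ : ℝ → X} {t : ℝ}
    (hγ : MDifferentiableAt 𝓘(ℝ, ℝ) 𝓘(ℝ, ℂ) γ t)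
    {e : OpenPartialHomeomorph X ℂ} (he : e ∈ IsManifold.maximalAtlas 𝓘(ℂ) ⊤ X)
    (ht : γ t ∈ e.source) (α : OneForm X) :
    ∃ w' : ℂ, HasDerivAt (e ∘ γ) w' t ∧
      α (γ t) (velocity γ t) = OneForm.coeff α e (e (γ t)) * w' := by
  have h1 : DifferentiableAt ℝ (e ∘ γ) t :=
    ((mdifferentiableAt_real (mdifferentiableAt_chart he ht)).comp t hγ).differentiableAt
  refine ⟨_, h1.hasDerivAt, ?_⟩
  have h2 : γ =ᶠ[𝓝 t] e.symm ∘ (e ∘ γ) := by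
    filter_upwards [hγ.continuousAt.preimage_mem_nhds (e.open_source.mem_nhds ht)] with w hw
    exact (e.left_inv hw).symm
  rw [velocity_congr α h2]
  exact (velocity_comp (mdifferentiableAt_chart_symm he (e.map_source ht)) h1.hasDerivAt).2 α

theorem eq_zero_of_chart_coeff {α : OneForm X} {e : OpenPartialHomeomorph X ℂ}
    (he : e ∈ IsManifold.maximalAtlas 𝓘(ℂ) ⊤ X) {x : X} (hx : x ∈ e.source) :
    α x = 0 ↔ OneForm.coeff α e (e x) = 0 := by
  have key : ∀ y, y = x → (α y = 0 ↔ α x = 0) := by rintro y rfl; rfl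
  have h0 := e.left_inv hx
  rw [← key _ h0]
  constructor
  · intro h; simp [OneForm.coeff, h]
  · intro h
    -- the identity of the tangent line at `x` factors through the chart
    have hd := mdifferentiableAt_chart he hx
    have hd' := mdifferentiableAt_chart_symm he (e.map_source hx)
    have hid : e.symm ∘ e =ᶠ[𝓝 x] id := by
      filter_upwards [e.open_source.mem_nhds hx] with w hw using e.left_inv hw
    have h2 := hid.mfderiv_eq (I := 𝓘(ℂ)) (I' := 𝓘(ℂ))
    rw [mfderiv_comp x hd' hd, mfderiv_id] at h2
    refine ContinuousLinearMap.ext fun v => ?_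
    have h3 : (mfderiv 𝓘(ℂ) 𝓘(ℂ) e.symm (e x) : ℂ → ℂ) ((mfderiv 𝓘(ℂ) 𝓘(ℂ) e x : ℂ → ℂ) v) = v :=
      congrArg (fun A : ℂ →L[ℂ] ℂ => A v) h2
    rw [← h3]
    have hl : ∀ (L : ℂ →L[ℂ] ℂ) (c : ℂ), L 1 = 0 → L c = 0 := fun L c hL => by
      have : L c = L (c • 1) := by simp
      rw [this, map_smul, hL, smul_zero]
    exact hl ((α (e.symm (e x))).comp (mfderiv 𝓘(ℂ) 𝓘(ℂ) e.symm (e x))) _ h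

end Basics

/-! ### Charts from injective parametrizations, and normal forms -/

section Charts

variable {X : Type*} [TopologicalSpace X] [ChartedSpace ℂ X] [IsManifold 𝓘(ℂ) ⊤ X]

theorem mdifferentiableAt_chart_symm_comp {e : OpenPartialHomeomorph X ℂ}
    (he : e ∈ IsManifold.maximalAtlas 𝓘(ℂ) ⊤ X) {h : ℂ → ℂ} {z : ℂ} (hz : h z ∈ e.target)
    (hh : DifferentiableAt ℂ h z) : MDifferentiableAt 𝓘(ℂ) 𝓘(ℂ) (e.symm ∘ h) z :=
  (mdifferentiableAt_chart_symm he hz).comp z hh.mdifferentiableAt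

theorem deriv_transition_ne_zero {e e' : OpenPartialHomeomorph X ℂ}
    (he : e ∈ IsManifold.maximalAtlas 𝓘(ℂ) ⊤ X) (he' : e' ∈ IsManifold.maximalAtlas 𝓘(ℂ) ⊤ X)
    {z : ℂ} (hz : z ∈ e.target) (hz' : e.symm z ∈ e'.source) : deriv (e' ∘ e.symm) z ≠ 0 := by
  have h1 : DifferentiableAt ℂ (e' ∘ e.symm) z :=
    differentiableAt_chart_comp (mdifferentiableAt_chart_symm he hz) he' hz'
  have h2 : DifferentiableAt ℂ (e ∘ e'.symm) ((e' ∘ e.symm) z) := by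
    refine differentiableAt_chart_comp (mdifferentiableAt_chart_symm he' (e'.map_source hz')) he ?_
    simp only [e'.left_inv hz']
    exact e.map_target hz
  have h3 : (e ∘ e'.symm) ∘ (e' ∘ e.symm) =ᶠ[𝓝 z] id := by
    filter_upwards [e.open_target.mem_nhds hz,
      (e.continuousAt_symm hz).preimage_mem_nhds (e'.open_source.mem_nhds hz')] with w hw hw'
    simp only [Function.comp, id]
    rw [e'.left_inv hw', e.right_inv hw]
  have h4 := (h2.hasDerivAt.comp z h1.hasDerivAt).congr_of_eventuallyEq h3.symm
  have h5 := h4.unique (hasDerivAt_id z)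
  intro h
  rw [h, mul_zero] at h5
  exact one_ne_zero h5.symm

theorem analyticAt_chart_comp {E : ℂ → X} {U : Set ℂ} (hU : IsOpen U)
    (hE : ∀ z ∈ U, MDifferentiableAt 𝓘(ℂ) 𝓘(ℂ) E z) {z : ℂ} (hz : z ∈ U)
    {e : OpenPartialHomeomorph X ℂ} (he : e ∈ IsManifold.maximalAtlas 𝓘(ℂ) ⊤ X)
    (hze : E z ∈ e.source) : AnalyticAt ℂ (e ∘ E) z := by
  refine Complex.analyticAt_iff_eventually_differentiableAt.2 ?_
  filter_upwards [hU.mem_nhds hz,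
    (hE z hz).continuousAt.preimage_mem_nhds (e.open_source.mem_nhds hze)] with w hw hw'
  exact differentiableAt_chart_comp (hE w hw) he hw'

/-- A holomorphic map with nowhere vanishing derivative is open. -/
theorem map_nhds_of_deriv_ne_zero {E : ℂ → X} {U : Set ℂ} (hU : IsOpen U)
    (hE : ∀ z ∈ U, MDifferentiableAt 𝓘(ℂ) 𝓘(ℂ) E z) {z : ℂ} (hz : z ∈ U)
    (hd : deriv (chartAt ℂ (E z) ∘ E) z ≠ 0) : map E (𝓝 z) = 𝓝 (E z) := by
  set e := chartAt ℂ (E z)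
  have he : e ∈ IsManifold.maximalAtlas 𝓘(ℂ) ⊤ X := IsManifold.chart_mem_maximalAtlas _
  have hze : E z ∈ e.source := mem_chart_source ℂ (E z)
  have h1 := ((analyticAt_chart_comp hU hE hz he hze).hasStrictDerivAt).map_nhds_eq hd
  have h2 : E =ᶠ[𝓝 z] e.symm ∘ (e ∘ E) := by
    filter_upwards [(hE z hz).continuousAt.preimage_mem_nhds (e.open_source.mem_nhds hze)] with w hw
    exact (e.left_inv hw).symm
  rw [Filter.map_congr h2, ← Filter.map_map, h1]
  have := e.symm.map_nhds_eq (x := e (E z)) (e.map_source hze)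
  rw [e.left_inv hze] at this
  exact this

/-- An injective holomorphic map from an open subset of the plane, with nowhere vanishing
derivative, is the inverse of a holomorphic chart. -/
theorem exists_chart_of_injOn {E : ℂ → X} {U : Set ℂ} (hU : IsOpen U)
    (hE : ∀ z ∈ U, MDifferentiableAt 𝓘(ℂ) 𝓘(ℂ) E z) (hinj : InjOn E U)
    (hd : ∀ z ∈ U, deriv (chartAt ℂ (E z) ∘ E) z ≠ 0) :
    ∃ e ∈ IsManifold.maximalAtlas 𝓘(ℂ) ⊤ X, e.target = U ∧ ∀ z, e.symm z = E z := by
  let p : PartialEquiv ℂ X := hinj.toPartialEquiv E U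
  let f : OpenPartialHomeomorph ℂ X := OpenPartialHomeomorph.ofContinuousOpenRestrict p
    (fun z hz => (hE z hz).continuousAt.continuousWithinAt)
    (by
      refine isOpenMap_iff_nhds_le.2 ?_
      rintro ⟨z, hz⟩
      have h1 : map E (𝓝 z) = 𝓝 (E z) := map_nhds_of_deriv_ne_zero hU hE hz (hd z hz)
      have h2 : map (Subtype.val : U → ℂ) (𝓝 ⟨z, hz⟩) = 𝓝 z := map_nhds_subtype_coe_eq_nhds hz
        (hU.mem_nhds hz)
      change 𝓝 (E z) ≤ map (E ∘ Subtype.val) (𝓝 ⟨z, hz⟩)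
      rw [← Filter.map_map]; exact (h1.symm.trans (congrArg (map E) h2.symm)).le) hU
  have hf : ∀ z, f z = E z := fun z => rfl
  have hfs : f.source = U := rfl
  refine ⟨f.symm, OpenPartialHomeomorph.mem_maximalAtlas_of_contMDiffOn _ ?_ ?_, rfl, hf⟩
  · intro x hx
    have hxt : x ∈ f.target := hx
    set z := f.symm x with hz
    have hzU : z ∈ U := f.map_target hxt
    have hfz : f z = x := f.right_inv hxt
    set c := chartAt ℂ (E z)
    have hc : c ∈ IsManifold.maximalAtlas 𝓘(ℂ) ⊤ X := IsManifold.chart_mem_maximalAtlas _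
    have hzc : E z ∈ c.source := mem_chart_source ℂ (E z)
    have hxc : x ∈ c.source := by rw [← hfz]; exact hzc
    let G := f.trans c
    have hGz : c x ∈ G.target := by
      simp only [G, OpenPartialHomeomorph.trans_target, mem_inter_iff, mem_preimage]
      exact ⟨c.map_source hxc, by rw [c.left_inv hxc]; exact hxt⟩
    have hGs : G.symm (c x) = z := by
      simp [G, c.left_inv hxc, hz]
    have hGe : (G : ℂ → ℂ) = c ∘ E := rfl
    have han : AnalyticAt ℂ (c ∘ E) z := analyticAt_chart_comp hU hE hzU hc hzc
    have h1 : ContDiffAt ℂ ⊤ G.symm (c x) := by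
      refine OpenPartialHomeomorph.contDiffAt_symm_deriv G (hd z hzU) hGz ?_ ?_
      · rw [hGs]; exact han.differentiableAt.hasDerivAt
      · rw [hGs]; exact han.contDiffAt
    have h2 : ContMDiffAt 𝓘(ℂ) 𝓘(ℂ) ⊤ (G.symm ∘ c) x :=
      h1.contMDiffAt.comp x (contMDiffAt_of_mem_maximalAtlas hc hxc)
    refine (h2.congr_of_eventuallyEq ?_).contMDiffWithinAt
    filter_upwards [c.open_source.mem_nhds hxc] with y hy
    simp [G, c.left_inv hy]
  · intro z hz
    have hzU : z ∈ U := hz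
    set c := chartAt ℂ (E z)
    have hc : c ∈ IsManifold.maximalAtlas 𝓘(ℂ) ⊤ X := IsManifold.chart_mem_maximalAtlas _
    have hzc : E z ∈ c.source := mem_chart_source ℂ (E z)
    have han : AnalyticAt ℂ (c ∘ E) z := analyticAt_chart_comp hU hE hzU hc hzc
    have h2 : ContMDiffAt 𝓘(ℂ) 𝓘(ℂ) ⊤ (c.symm ∘ (c ∘ E)) z :=
      (contMDiffAt_symm_of_mem_maximalAtlas hc (c.map_source hzc)).comp z han.contDiffAt.contMDiffAt
    refine (h2.congr_of_eventuallyEq ?_).contMDiffWithinAt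
    filter_upwards [(hE z hzU).continuousAt.preimage_mem_nhds (c.open_source.mem_nhds hzc)]
      with w hw
    exact (c.left_inv hw).symm

/-- A non-constant analytic function is locally a power of a coordinate: if `h - h(z₀)` vanishes to
order `m` at `z₀`, then `h(z) = h(z₀) + φ(z) ^ m` near `z₀` for a local coordinate `φ`. -/
theorem exists_root_of_order {h : ℂ → ℂ} {z₀ : ℂ} {m : ℕ} (hm : m ≠ 0) (hh : AnalyticAt ℂ h z₀)
    (hord : analyticOrderAt (fun z => h z - h z₀) z₀ = m) :
    ∃ φ : ℂ → ℂ, AnalyticAt ℂ φ z₀ ∧ φ z₀ = 0 ∧ deriv φ z₀ ≠ 0 ∧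
      ∀ᶠ z in 𝓝 z₀, h z = h z₀ + φ z ^ m := by
  obtain ⟨g, hg, hg0, hgh⟩ :=
    (AnalyticAt.analyticOrderAt_eq_natCast (hh.sub analyticAt_const)).1 hord
  obtain ⟨a, ha⟩ := IsAlgClosed.exists_pow_nat_eq (g z₀) (Nat.pos_of_ne_zero hm)
  have ha0 : a ≠ 0 := by rintro rfl; rw [zero_pow hm] at ha; exact hg0 ha.symm
  have hk : AnalyticAt ℂ (fun z => (g z / g z₀) ^ ((m : ℂ)⁻¹)) z₀ := by
    refine AnalyticAt.cpow (hg.div analyticAt_const hg0) analyticAt_const ?_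
    simp [div_self hg0]
  have hφ : AnalyticAt ℂ (fun z => (z - z₀) * (a * (g z / g z₀) ^ ((m : ℂ)⁻¹))) z₀ :=
    (analyticAt_id.sub analyticAt_const).mul (analyticAt_const.mul hk)
  refine ⟨_, hφ, by simp, ?_, ?_⟩
  · have h1 := ((hasDerivAt_id z₀).sub_const z₀).mul
      ((analyticAt_const (v := a)).mul hk).differentiableAt.hasDerivAt
    have h2 : HasDerivAt (fun z => (z - z₀) * (a * (g z / g z₀) ^ ((m : ℂ)⁻¹))) _ z₀ := h1
    rw [h2.deriv]
    simp [div_self hg0, ha0]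
  · filter_upwards [hgh] with z hz
    rw [mul_pow, mul_pow, Complex.cpow_nat_inv_pow _ hm, ha, mul_div_cancel₀ _ hg0]
    simp only [smul_eq_mul] at hz
    rw [← hz, Pi.sub_apply]; ring

/-- Near a point where `h - h(p)` vanishes to order `m` there is a chart `w` centred at the point,
with `h = h(p) + w ^ m`. -/
theorem exists_power_chart {p : X} {e₀ : OpenPartialHomeomorph X ℂ}
    (he₀ : e₀ ∈ IsManifold.maximalAtlas 𝓘(ℂ) ⊤ X) (hp : p ∈ e₀.source) {h : ℂ → ℂ} {m : ℕ}
    (hm : m ≠ 0) (hh : AnalyticAt ℂ h (e₀ p))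
    (hord : analyticOrderAt (fun z => h z - h (e₀ p)) (e₀ p) = m) {N : Set ℂ} (hN : N ∈ 𝓝 (e₀ p)) :
    ∃ e ∈ IsManifold.maximalAtlas 𝓘(ℂ) ⊤ X, ∃ δ > 0, e.target = ball 0 δ ∧ p ∈ e.source ∧ e p = 0 ∧
      ∀ w ∈ ball (0 : ℂ) δ, e.symm w ∈ e₀.source ∧ e₀ (e.symm w) ∈ N ∧
        h (e₀ (e.symm w)) = h (e₀ p) + w ^ m := by
  obtain ⟨φ, hφ, hφ0, hφ', hφh⟩ := exists_root_of_order hm hh hord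
  set z₀ := e₀ p with hz₀
  set ψ := hφ.hasStrictDerivAt.localInverse _ _ _ hφ' with hψ
  have hψa : AnalyticAt ℂ ψ 0 := by
    have := hφ.analyticAt_localInverse hφ'
    rwa [hφ0] at this
  have hψ0 : ψ 0 = z₀ := by
    have : ψ (φ z₀) = z₀ := HasStrictFDerivAt.localInverse_apply_image ..
    rwa [hφ0] at this
  have hψr : ∀ᶠ w in 𝓝 (0 : ℂ), φ (ψ w) = w := by
    have := HasStrictDerivAt.eventually_right_inverse hφ.hasStrictDerivAt hφ'
    rwa [hφ0] at this
  have hψc : Tendsto ψ (𝓝 0) (𝓝 z₀) := by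
    have := hψa.continuousAt.tendsto
    rwa [hψ0] at this
  have hall : ∀ᶠ w in 𝓝 (0 : ℂ), AnalyticAt ℂ ψ w ∧ (φ (ψ w) = w ∧ AnalyticAt ℂ φ (ψ w)) ∧
      (ψ w ∈ e₀.target ∧ ψ w ∈ N) ∧ h (ψ w) = h z₀ + φ (ψ w) ^ m :=
    hψa.eventually_analyticAt.and ((hψr.and (hψc.eventually hφ.eventually_analyticAt)).and
      (((hψc.eventually (e₀.open_target.mem_nhds (e₀.map_source hp))).and (hψc.eventually hN)).and
        (hψc.eventually hφh)))
  obtain ⟨δ, hδ, hδ'⟩ := Metric.eventually_nhds_iff_ball.1 hall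
  have hE : ∀ w ∈ ball (0 : ℂ) δ, MDifferentiableAt 𝓘(ℂ) 𝓘(ℂ) (e₀.symm ∘ ψ) w := fun w hw =>
    mdifferentiableAt_chart_symm_comp he₀ (hδ' w hw).2.2.1.1 (hδ' w hw).1.differentiableAt
  have hmem : ∀ w ∈ ball (0 : ℂ) δ, (e₀.symm ∘ ψ) w ∈ e₀.source := fun w hw =>
    e₀.map_target (hδ' w hw).2.2.1.1
  have hcoord : ∀ w ∈ ball (0 : ℂ) δ, e₀ ((e₀.symm ∘ ψ) w) = ψ w := fun w hw =>
    e₀.right_inv (hδ' w hw).2.2.1.1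
  have hinj : InjOn (e₀.symm ∘ ψ) (ball 0 δ) := by
    intro w hw w' hw' hww
    have := congrArg e₀ hww
    rw [hcoord w hw, hcoord w' hw'] at this
    rw [← (hδ' w hw).2.1.1, this, (hδ' w' hw').2.1.1]
  have hd : ∀ w ∈ ball (0 : ℂ) δ,
      deriv (chartAt ℂ ((e₀.symm ∘ ψ) w) ∘ (e₀.symm ∘ ψ)) w ≠ 0 := by
    intro w hw
    set c := chartAt ℂ ((e₀.symm ∘ ψ) w)
    have hc : c ∈ IsManifold.maximalAtlas 𝓘(ℂ) ⊤ X := IsManifold.chart_mem_maximalAtlas _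
    have hwc : e₀.symm (ψ w) ∈ c.source := mem_chart_source ℂ ((e₀.symm ∘ ψ) w)
    have ht := (hδ' w hw).2.2.1.1
    have h1 : deriv ((c ∘ e₀.symm) ∘ ψ) w = _ := deriv_comp w
      (differentiableAt_chart_comp (mdifferentiableAt_chart_symm he₀ ht) hc hwc)
      (hδ' w hw).1.differentiableAt
    rw [← Function.comp_assoc, h1]
    refine mul_ne_zero (deriv_transition_ne_zero he₀ hc ht hwc) fun h0 => ?_
    have h2 : φ ∘ ψ =ᶠ[𝓝 w] id := by
      filter_upwards [isOpen_ball.mem_nhds hw] with v hv using (hδ' v hv).2.1.1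
    have h3 := ((hδ' w hw).2.1.2.differentiableAt.hasDerivAt.comp w
      (hδ' w hw).1.differentiableAt.hasDerivAt).congr_of_eventuallyEq h2.symm
    have h4 := h3.unique (hasDerivAt_id w)
    rw [h0, mul_zero] at h4
    exact one_ne_zero h4.symm
  obtain ⟨e, he, het, hes⟩ := exists_chart_of_injOn isOpen_ball hE hinj hd
  have h0t : (0 : ℂ) ∈ e.target := by rw [het]; exact mem_ball_self hδ
  have hs0 : e.symm 0 = p := by
    rw [hes]; simp only [Function.comp, hψ0]; exact e₀.left_inv hp
  refine ⟨e, he, δ, hδ, het, ?_, ?_, fun w hw => ?_⟩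
  · rw [← hs0]; exact e.map_target h0t
  · rw [← hs0]; exact e.right_inv h0t
  · rw [hes, hcoord w hw]
    refine ⟨hmem w hw, (hδ' w hw).2.2.1.2, ?_⟩
    rw [(hδ' w hw).2.2.2, (hδ' w hw).2.1.1]

/-- The order of vanishing of a one-form at a point. -/
noncomputable def OneForm.order (α : OneForm X) (p : X) : ℕ∞ :=
  analyticOrderAt (OneForm.coeff α (chartAt ℂ p)) (chartAt ℂ p p)

/-- Normal form of an Abelian differential: near a point where it vanishes to order `n`, there is a
centred chart `w` in which it is `d(w ^ (n + 1))`. -/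
theorem exists_normal_chart {α : OneForm X} (hα : α ∈ holomorphicOneForms X) {p : X} {n : ℕ}
    (hn : OneForm.order α p = n) :
    ∃ e ∈ IsManifold.maximalAtlas 𝓘(ℂ) ⊤ X, ∃ δ > 0, e.target = ball 0 δ ∧ p ∈ e.source ∧ e p = 0 ∧
      ∀ w ∈ ball (0 : ℂ) δ, OneForm.coeff α e w = (n + 1) * w ^ n := by
  set e₀ := chartAt ℂ p with he₀'
  have he₀ : e₀ ∈ IsManifold.maximalAtlas 𝓘(ℂ) ⊤ X := IsManifold.chart_mem_maximalAtlas _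
  have hp : p ∈ e₀.source := mem_chart_source ℂ p
  obtain ⟨ε, hε, hεt⟩ := Metric.isOpen_iff.1 e₀.open_target _ (e₀.map_source hp)
  obtain ⟨h, hh⟩ := ((hα e₀ he₀).mono hεt).isExactOn_ball
  have hf : AnalyticAt ℂ (OneForm.coeff α e₀) (e₀ p) :=
    (hα e₀ he₀).analyticAt (e₀.open_target.mem_nhds (e₀.map_source hp))
  have hha : AnalyticAt ℂ h (e₀ p) := by
    refine Complex.analyticAt_iff_eventually_differentiableAt.2 ?_
    filter_upwards [ball_mem_nhds _ hε] with z hz using (hh z hz).differentiableAt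
  have hder : deriv (fun z => h z - h (e₀ p)) =ᶠ[𝓝 (e₀ p)] OneForm.coeff α e₀ := by
    filter_upwards [ball_mem_nhds _ hε] with z hz using ((hh z hz).sub_const _).deriv
  have hord : analyticOrderAt (fun z => h z - h (e₀ p)) (e₀ p) = (n + 1 : ℕ) := by
    have h1 := (hha.sub (analyticAt_const (v := h (e₀ p)))).analyticOrderAt_deriv_add_one
    have h2 : analyticOrderAt (deriv (h - fun _ => h (e₀ p))) (e₀ p) = n := by
      rw [← hn]; exact analyticOrderAt_congr hder
    simp only [Pi.sub_apply, sub_self, sub_zero] at h1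
    rw [h2] at h1
    rw [← h1]; rfl
  obtain ⟨e, he, δ, hδ, het, hpe, hep, hw⟩ :=
    exists_power_chart he₀ hp (Nat.succ_ne_zero n) hha hord (ball_mem_nhds _ hε)
  refine ⟨e, he, δ, hδ, het, hpe, hep, fun w hwδ => ?_⟩
  have hwt : w ∈ e.target := by rw [het]; exact hwδ
  have hsd := mdifferentiableAt_chart_symm he hwt
  have h1 : OneForm.coeff α e w = _ := pullbackCoeff_eq α hsd he₀ (hw w hwδ).1
  rw [h1]
  have h2 := (hh _ (hw w hwδ).2.1).comp w
    (differentiableAt_chart_comp hsd he₀ (hw w hwδ).1).hasDerivAt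
  have h3 : HasDerivAt (fun w => h (e₀ p) + w ^ (n + 1)) (((n + 1 : ℕ) : ℂ) * w ^ n) w := by
    simpa using (hasDerivAt_pow (n + 1) w).const_add (h (e₀ p))
  have h4 : h ∘ (e₀ ∘ e.symm) =ᶠ[𝓝 w] fun w => h (e₀ p) + w ^ (n + 1) := by
    filter_upwards [isOpen_ball.mem_nhds hwδ] with v hv using (hw v hv).2.2
  have h5 := (h2.congr_of_eventuallyEq h4.symm).unique h3
  rw [h5]; push_cast; ring

end Charts

/-! ### Developing maps -/

section Developing

variable {X : Type*} [TopologicalSpace X] [ChartedSpace ℂ X]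

/-- `E : U → X` develops the form `ω` as `d(z ^ (n + 1))`: it is holomorphic on `U`, and
`E^*ω = (n + 1) z ^ n dz`. For `n = 0` this is a local isometry from the Euclidean plane; for
`n > 0` and `0 ∈ U` it is one from a cone of angle `2π(n + 1)`. -/
def IsDeveloping (ω : OneForm X) (n : ℕ) (E : ℂ → X) (U : Set ℂ) : Prop :=
  ∀ z ∈ U, MDifferentiableAt 𝓘(ℂ) 𝓘(ℂ) E z ∧ pullbackCoeff ω E z = (n + 1) * z ^ n

variable {ω : OneForm X} {n : ℕ} {E F : ℂ → X} {U V : Set ℂ}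

theorem IsDeveloping.mono (h : IsDeveloping ω n E U) (hV : V ⊆ U) : IsDeveloping ω n E V :=
  fun z hz => h z (hV hz)

theorem IsDeveloping.continuousAt (h : IsDeveloping ω n E U) {z : ℂ} (hz : z ∈ U) :
    ContinuousAt E z := (h z hz).1.continuousAt

theorem IsDeveloping.of_eventuallyEq
    (h : ∀ z ∈ U, ∃ F V, z ∈ V ∧ IsDeveloping ω n F V ∧ E =ᶠ[𝓝 z] F) : IsDeveloping ω n E U := by
  intro z hz
  obtain ⟨F, V, hzV, hF, hEF⟩ := h z hz
  exact ⟨(hF z hzV).1.congr_of_eventuallyEq hEF, by rw [pullbackCoeff_congr ω hEF, (hF z hzV).2]⟩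

theorem IsDeveloping.ne_zero (h : IsDeveloping ω n E U) {z : ℂ} (hz : z ∈ U) (hn : z ^ n ≠ 0) :
    ω (E z) ≠ 0 := by
  intro h0
  have := (h z hz).2
  rw [pullbackCoeff, h0] at this
  exact mul_ne_zero (by exact_mod_cast Nat.succ_ne_zero n) hn this.symm

theorem IsDeveloping.comp_add (h : IsDeveloping ω 0 E U) (c : ℂ) :
    IsDeveloping ω 0 (fun z => E (z + c)) {z | z + c ∈ U} := by
  intro z hz
  have hd : HasDerivAt (fun z : ℂ => z + c) 1 z := (hasDerivAt_id z).add_const c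
  refine ⟨(h _ hz).1.comp z hd.differentiableAt.mdifferentiableAt, ?_⟩
  refine (pullbackCoeff_comp ω (h := fun z : ℂ => z + c) (h _ hz).1 hd.differentiableAt).trans ?_
  rw [hd.deriv, (h _ hz).2]
  simp

theorem IsDeveloping.curve (h : IsDeveloping ω n E U) {u : ℝ → ℂ} {u' : ℂ} {t : ℝ}
    (ht : u t ∈ U) (hu : HasDerivAt u u' t) :
    MDifferentiableAt 𝓘(ℝ, ℝ) 𝓘(ℝ, ℂ) (fun t => E (u t)) t ∧
      ω (E (u t)) (velocity (fun t => E (u t)) t) = (n + 1) * u t ^ n * u' := by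
  have := velocity_comp (h _ ht).1 hu
  refine ⟨this.1, ?_⟩
  rw [← (h _ ht).2]
  exact this.2 ω

theorem IsDeveloping.continuousOn_ray {R : ℝ} (hE : IsDeveloping ω n E (ball 0 R)) {b : ℂ}
    (hb : ‖b‖ = R) : ContinuousOn (fun t : ℝ => E (t * b)) (Ioo (-1) 1) := by
  intro t ht
  have hR : 0 ≤ R := hb ▸ norm_nonneg b
  by_cases hb0 : b = 0
  · simp only [hb0, mul_zero]; exact continuousWithinAt_const
  have h : (t : ℂ) * b ∈ ball (0 : ℂ) R := by
    rw [mem_ball_zero_iff, norm_mul, Complex.norm_real, Real.norm_eq_abs, ← hb]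
    have : |t| < 1 := abs_lt.2 ht
    nlinarith [norm_pos_iff.2 hb0]
  have h1 : ContinuousAt (fun t : ℝ => (t : ℂ) * b) t := by fun_prop
  exact (ContinuousAt.comp (f := fun t : ℝ => (t : ℂ) * b)
    (hE.continuousAt h) h1).continuousWithinAt

theorem hasDerivAt_ofReal_mul (z : ℂ) (t : ℝ) : HasDerivAt (fun t : ℝ => (t : ℂ) * z) z t := by
  have h1 : HasDerivAt (fun t : ℝ => (t : ℂ)) 1 t := Complex.ofRealCLM.hasDerivAt
  simpa using h1.mul_const z

theorem tendsto_ofReal_mul_one (b : ℂ) :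
    Tendsto (fun t : ℝ => (t : ℂ) * b) (𝓝[<] 1) (𝓝 b) := by
  have h := (hasDerivAt_ofReal_mul b 1).continuousAt.tendsto.mono_left
    (nhdsWithin_le_nhds (s := Iio 1))
  simpa using h

variable [IsManifold 𝓘(ℂ) ⊤ X]

theorem order_eq_zero_of_ne_zero {ω : OneForm X} {p : X} (hp : ω p ≠ 0) :
    OneForm.order ω p = ((0 : ℕ) : ℕ∞) := by
  have hc := IsManifold.chart_mem_maximalAtlas (I := 𝓘(ℂ)) (n := ⊤) p
  rw [Nat.cast_zero, OneForm.order, analyticOrderAt_eq_zero]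
  exact Or.inr fun h => hp ((eq_zero_of_chart_coeff hc (mem_chart_source ℂ p)).2 h)

/-- Around a point where `ω` does not vanish there is a flat chart: one in which `ω = dz`. -/
theorem exists_flat_chart {ω : OneForm X} (hω : ω ∈ holomorphicOneForms X) {p : X}
    (hp : ω p ≠ 0) :
    ∃ e ∈ IsManifold.maximalAtlas 𝓘(ℂ) ⊤ X, ∃ δ > 0, e.target = ball 0 δ ∧ p ∈ e.source ∧ e p = 0 ∧
      ∀ w ∈ ball (0 : ℂ) δ, OneForm.coeff ω e w = 1 := by
  simpa using exists_normal_chart hω (order_eq_zero_of_ne_zero hp)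

theorem eventually_ne_zero {ω : OneForm X} (hω : ω ∈ holomorphicOneForms X) {p : X}
    (hp : OneForm.order ω p ≠ ⊤) : ∀ᶠ x in 𝓝[≠] p, ω x ≠ 0 := by
  obtain ⟨n, hn⟩ := ENat.ne_top_iff_exists.1 hp
  obtain ⟨e, he, δ, hδ, het, hpe, hep, hw⟩ := exists_normal_chart hω hn.symm
  rw [eventually_nhdsWithin_iff]
  filter_upwards [e.open_source.mem_nhds hpe] with x hx hxp h0
  rw [eq_zero_of_chart_coeff he hx, hw _ (by rw [← het]; exact e.map_source hx)] at h0
  have hx0 : e x ≠ 0 := fun h => hxp (e.injOn hx hpe (h.trans hep.symm))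
  exact mul_ne_zero (by exact_mod_cast Nat.succ_ne_zero n) (pow_ne_zero n hx0) h0

/-- Two curves on which `ω` takes the same values agree as soon as they meet in a point, as long as
they avoid the zeros of `ω`. -/
theorem curve_eqOn [T2Space X] {ω : OneForm X} (hω : ω ∈ holomorphicOneForms X) {γ η : ℝ → X}
    {I : Set ℝ} (hI : IsOpen I) (hIc : IsPreconnected I)
    (hγ : ∀ t ∈ I, MDifferentiableAt 𝓘(ℝ, ℝ) 𝓘(ℝ, ℂ) γ t)
    (hη : ∀ t ∈ I, MDifferentiableAt 𝓘(ℝ, ℝ) 𝓘(ℝ, ℂ) η t)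
    (h0 : ∀ t ∈ I, ω (γ t) ≠ 0)
    (hv : ∀ t ∈ I, ω (γ t) (velocity γ t) = ω (η t) (velocity η t))
    {t₀ : ℝ} (ht₀ : t₀ ∈ I) (heq : γ t₀ = η t₀) : EqOn γ η I := by
  have key : ∀ t ∈ I, γ t = η t → ∀ᶠ s in 𝓝 t, γ s = η s := by
    intro t ht hte
    obtain ⟨e, he, δ, hδ, het, hpe, hep, hw⟩ := exists_flat_chart hω (h0 t ht)
    have hev : ∀ᶠ s in 𝓝 t, s ∈ I ∧ γ s ∈ e.source ∧ η s ∈ e.source :=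
      (hI.eventually_mem ht).and
        (((hγ t ht).continuousAt.eventually (e.open_source.eventually_mem hpe)).and
        ((hη t ht).continuousAt.eventually (e.open_source.eventually_mem (hte ▸ hpe))))
    obtain ⟨ε, hε, hεs⟩ := Metric.eventually_nhds_iff_ball.1 hev
    have hd : ∀ s ∈ ball t ε, HasDerivAt (fun s => e (γ s) - e (η s)) 0 s := by
      intro s hs
      obtain ⟨hsI, h1, h2⟩ := hεs s hs
      obtain ⟨w₁, hw₁, hv₁⟩ := hasDerivAt_chart_comp (hγ s hsI) he h1 ω
      obtain ⟨w₂, hw₂, hv₂⟩ := hasDerivAt_chart_comp (hη s hsI) he h2 ω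
      rw [hw _ (by rw [← het]; exact e.map_source h1), one_mul] at hv₁
      rw [hw _ (by rw [← het]; exact e.map_source h2), one_mul] at hv₂
      have h3 : w₁ - w₂ = 0 := by rw [← hv₁, ← hv₂, hv s hsI, sub_self]
      rw [← h3]
      exact hw₁.sub hw₂
    filter_upwards [ball_mem_nhds t hε] with s hs
    have h4 := isOpen_ball.is_const_of_deriv_eq_zero (convex_ball t ε).isPreconnected
      (fun s hs => (hd s hs).differentiableAt.differentiableWithinAt)
      (fun s hs => (hd s hs).deriv) hs (mem_ball_self hε)
    simp only [hte, sub_self] at h4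
    exact e.injOn (hεs s hs).2.1 (hεs s hs).2.2 (sub_eq_zero.1 h4)
  have hu : IsOpen {t | ∀ᶠ s in 𝓝 t, γ s = η s} := isOpen_setOfPred_eventually_nhds
  have hvo : IsOpen (I ∩ {t | γ t ≠ η t}) := by
    have hc : ContinuousOn (fun t => (γ t, η t)) I := fun t ht =>
      ((hγ t ht).continuousAt.prodMk (hη t ht).continuousAt).continuousWithinAt
    exact hc.isOpen_inter_preimage hI (isClosed_diagonal (X := X)).isOpen_compl
  have hsub := IsPreconnected.subset_left_of_subset_union hu hvo
    (Set.disjoint_left.2 fun t h1 h2 => h2.2 h1.self_of_nhds)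
    (fun t ht => by
      by_cases h : γ t = η t
      · exact Or.inl (key t ht h)
      · exact Or.inr ⟨ht, h⟩) ⟨t₀, ht₀, key t₀ ht₀ heq⟩ hIc
  exact fun t ht => (hsub ht).self_of_nhds

variable {ω : OneForm X} {n : ℕ} {E F : ℂ → X} {U V : Set ℂ}

theorem isDeveloping_chart_symm {e : OpenPartialHomeomorph X ℂ}
    (he : e ∈ IsManifold.maximalAtlas 𝓘(ℂ) ⊤ X) {δ : ℝ} (het : e.target = ball 0 δ)
    (hw : ∀ w ∈ ball (0 : ℂ) δ, OneForm.coeff ω e w = (n + 1) * w ^ n) :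
    IsDeveloping ω n e.symm (ball 0 δ) := fun z hz =>
  ⟨mdifferentiableAt_chart_symm he (by rwa [het]), hw z hz⟩

/-- A developing map obtained from a flat chart `e` by composing with `z ↦ z ^ (n + 1) + c`. -/
theorem isDeveloping_flat_chart_symm {e : OpenPartialHomeomorph X ℂ}
    (he : e ∈ IsManifold.maximalAtlas 𝓘(ℂ) ⊤ X) {δ : ℝ} (het : e.target = ball 0 δ)
    (hw : ∀ w ∈ ball (0 : ℂ) δ, OneForm.coeff ω e w = 1) {c : ℂ}
    (hU : ∀ z ∈ U, z ^ (n + 1) + c ∈ ball (0 : ℂ) δ) :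
    IsDeveloping ω n (fun z => e.symm (z ^ (n + 1) + c)) U := by
  intro z hz
  have hd : HasDerivAt (fun z : ℂ => z ^ (n + 1) + c) (((n + 1 : ℕ) : ℂ) * z ^ n) z := by
    simpa using (hasDerivAt_pow (n + 1) z).add_const c
  have ht : z ^ (n + 1) + c ∈ e.target := by rw [het]; exact hU z hz
  refine ⟨mdifferentiableAt_chart_symm_comp he ht hd.differentiableAt, ?_⟩
  refine (pullbackCoeff_comp ω (h := fun z : ℂ => z ^ (n + 1) + c)
    (mdifferentiableAt_chart_symm he ht) hd.differentiableAt).trans ?_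
  have h2 : pullbackCoeff ω e.symm (z ^ (n + 1) + c) = 1 := hw _ (hU z hz)
  rw [hd.deriv, h2, one_mul]
  push_cast
  rfl

theorem IsDeveloping.deriv_ne_zero (hF : IsDeveloping ω n F U) {z : ℂ}
    (hz : z ∈ U) (hzn : z ^ n ≠ 0) : deriv (chartAt ℂ (F z) ∘ F) z ≠ 0 := by
  intro h0
  have h1 := pullbackCoeff_eq ω (hF z hz).1 (IsManifold.chart_mem_maximalAtlas (F z))
    (mem_chart_source ℂ (F z))
  rw [h0, mul_zero, (hF z hz).2] at h1
  exact mul_ne_zero (by exact_mod_cast Nat.succ_ne_zero n) hzn h1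

/-! ### Uniqueness of developing maps -/

section Uniqueness

variable [T2Space X]

/-- Two developing maps of a convex set that agree at one point agree. The set must avoid the zeros
of `d(z ^ (n + 1))`: at a zero, a developing map may be precomposed with a rotation of order
`n + 1`. -/
theorem IsDeveloping.eqOn_of_convex (hω : ω ∈ holomorphicOneForms X) (hE : IsDeveloping ω n E U)
    (hF : IsDeveloping ω n F U) (hU : IsOpen U) (hUc : Convex ℝ U) (h0 : ∀ z ∈ U, z ^ n ≠ 0)
    {z₀ : ℂ} (hz₀ : z₀ ∈ U) (heq : E z₀ = F z₀) : EqOn E F U := by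
  intro z hz
  let u : ℝ → ℂ := fun t => z₀ + t * (z - z₀)
  have hud : ∀ t, HasDerivAt u (z - z₀) t := fun t => by
    exact (hasDerivAt_ofReal_mul (z - z₀) t).const_add z₀
  have huc : Continuous u := continuous_iff_continuousAt.2 fun t => (hud t).continuousAt
  have hI : IsOpen (u ⁻¹' U) := hU.preimage huc
  have hIc : IsPreconnected (u ⁻¹' U) := by
    refine Convex.isPreconnected ?_
    intro s hs t ht a b ha hb hab
    have : u (a • s + b • t) = a • u s + b • u t := by
      have hab' : (a : ℂ) + b = 1 := by exact_mod_cast hab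
      simp only [u, smul_eq_mul, Complex.real_smul]
      push_cast
      linear_combination (-z₀) * hab'
    rw [mem_preimage, this]
    exact hUc hs ht ha hb hab
  have h1 : EqOn (fun t => E (u t)) (fun t => F (u t)) (u ⁻¹' U) :=
    curve_eqOn hω hI hIc (fun t ht => (hE.curve ht (hud t)).1) (fun t ht => (hF.curve ht (hud t)).1)
      (fun t ht => hE.ne_zero ht (h0 _ ht))
      (fun t ht => by rw [(hE.curve ht (hud t)).2, (hF.curve ht (hud t)).2])
      (t₀ := 0) (by simpa [u] using hz₀) (by simpa [u] using heq)
  have h2 := h1 (x := 1) (by simpa [u] using hz)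
  simpa [u] using h2

/-- Developing maps of a disc are determined by their germ at the centre. -/
theorem IsDeveloping.eqOn_of_ball (hω : ω ∈ holomorphicOneForms X) {R δ : ℝ} (hδ : 0 < δ)
    (hE : IsDeveloping ω n E (ball 0 R)) (hF : IsDeveloping ω n F (ball 0 R))
    (heq : EqOn E F (ball 0 δ)) : EqOn E F (ball 0 R) := by
  intro z hz
  by_cases hz0 : z = 0
  · exact heq (by simpa [hz0] using hδ)
  have hzn : 0 < ‖z‖ := norm_pos_iff.2 hz0
  rw [mem_ball_zero_iff] at hz
  let u : ℝ → ℂ := fun t => (t : ℂ) * z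
  have hud : ∀ t : ℝ, HasDerivAt u z t := hasDerivAt_ofReal_mul z
  have hmem : ∀ t ∈ Ioo (0 : ℝ) (R / ‖z‖), u t ∈ ball (0 : ℂ) R := by
    intro t ht
    rw [mem_ball_zero_iff, norm_mul, Complex.norm_real, Real.norm_of_nonneg ht.1.le]
    exact (lt_div_iff₀ hzn).1 ht.2
  have hR : 0 < R := hzn.trans hz
  obtain ⟨t₀, ht₀, ht₀'⟩ := exists_between (lt_min (div_pos hR hzn) (div_pos hδ hzn))
  have h1 : EqOn (fun t : ℝ => E (u t)) (fun t : ℝ => F (u t)) (Ioo 0 (R / ‖z‖)) :=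
    curve_eqOn hω isOpen_Ioo isPreconnected_Ioo
      (fun t ht => (hE.curve (hmem t ht) (hud t)).1) (fun t ht => (hF.curve (hmem t ht) (hud t)).1)
      (fun t ht => hE.ne_zero (hmem t ht)
        (pow_ne_zero _ (mul_ne_zero (by exact_mod_cast ht.1.ne') hz0)))
      (fun t ht => by rw [(hE.curve (hmem t ht) (hud t)).2, (hF.curve (hmem t ht) (hud t)).2])
      (t₀ := t₀) ⟨ht₀, ht₀'.trans_le (min_le_left _ _)⟩
      (heq (by
        rw [mem_ball_zero_iff, norm_mul, Complex.norm_real, Real.norm_of_nonneg ht₀.le]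
        exact (lt_div_iff₀ hzn).1 (ht₀'.trans_le (min_le_right _ _))))
  have h2 := h1 (x := 1) ⟨one_pos, (one_lt_div hzn).2 hz⟩
  simpa [u] using h2

end Uniqueness

/-! ### Continuation of developing maps -/

section Extension

variable [T2Space X]

/-- Local continuation of a developing map across a boundary point, along the radius to which it
accumulates at a point where `ω` does not vanish. -/
theorem IsDeveloping.exists_local_extension_of_mapClusterPt (hω : ω ∈ holomorphicOneForms X)
    {R : ℝ} (hR : 0 < R) (hE : IsDeveloping ω n E (ball 0 R)) {b : ℂ} (hb : ‖b‖ = R) {y : X}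
    (hy : ω y ≠ 0) (hcl : MapClusterPt y (𝓝[<] (1 : ℝ)) fun t : ℝ => E (t * b)) :
    ∃ ε > 0, ∃ F, IsDeveloping ω n F (ball b ε) ∧ EqOn E F (ball 0 R ∩ ball b ε) := by
  obtain ⟨e, he, δ, hδ, het, hpe, hep, hw⟩ := exists_flat_chart hω hy
  have hcont : ContinuousAt (fun z : ℂ => z ^ (n + 1)) b := (continuous_pow _).continuousAt
  obtain ⟨ε₁, hε₁, hε₁'⟩ := Metric.continuousAt_iff.1 hcont (δ / 4) (by positivity)
  set ε := min ε₁ R with hε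
  have hεpos : 0 < ε := lt_min hε₁ hR
  have hne : ∀ z ∈ ball b ε, z ≠ 0 := by
    rintro z hz rfl
    rw [mem_ball, dist_zero_left, hb] at hz
    exact absurd (min_le_right ε₁ R) (not_le.2 hz)
  have hev : ∀ᶠ t : ℝ in 𝓝[<] 1, (t : ℂ) * b ∈ ball 0 R ∩ ball b ε := by
    have h1 : ∀ᶠ t : ℝ in 𝓝[<] 1, t ∈ Ioo (0 : ℝ) 1 := Ioo_mem_nhdsLT one_pos
    have h2 := tendsto_ofReal_mul_one b
    filter_upwards [h1, h2.eventually (ball_mem_nhds b hεpos)] with t ht ht'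
    refine ⟨?_, ht'⟩
    rw [mem_ball_zero_iff, norm_mul, Complex.norm_real, Real.norm_of_nonneg ht.1.le, hb]
    nlinarith [ht.2]
  have hnhd : e.source ∩ e ⁻¹' ball 0 (δ / 4) ∈ 𝓝 y :=
    inter_mem (e.open_source.mem_nhds hpe)
      ((e.continuousAt hpe).preimage_mem_nhds (by rw [hep]; exact ball_mem_nhds _ (by positivity)))
  obtain ⟨t, ⟨hts, htb⟩, htE⟩ :=
    ((mapClusterPt_iff_frequently.1 hcl _ hnhd).and_eventually hev).exists
  set z₁ : ℂ := t * b
  set w := e (E z₁)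
  have hwn : ‖w‖ < δ / 4 := by simpa using htb
  have hz₁ := hε₁' (lt_of_lt_of_le htE.2 (min_le_left _ _))
  have hmem : ∀ z ∈ ball b ε, w + (z ^ (n + 1) - z₁ ^ (n + 1)) ∈ ball (0 : ℂ) δ := by
    intro z hz
    have h1 := hε₁' (lt_of_lt_of_le hz (min_le_left _ _))
    rw [mem_ball_zero_iff]
    have h2 : ‖z ^ (n + 1) - z₁ ^ (n + 1)‖ ≤ δ / 4 + δ / 4 := by
      rw [← dist_eq_norm]
      refine (dist_triangle_right _ _ (b ^ (n + 1))).trans (add_le_add h1.le hz₁.le)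
    calc _ ≤ ‖w‖ + ‖z ^ (n + 1) - z₁ ^ (n + 1)‖ := norm_add_le _ _
      _ < δ := by linarith
  have hF := isDeveloping_flat_chart_symm (ω := ω) (n := n) (U := ball b ε)
    (c := w - z₁ ^ (n + 1)) he het hw
    (fun z hz => by have := hmem z hz; rwa [show z ^ (n + 1) + (w - z₁ ^ (n + 1)) =
      w + (z ^ (n + 1) - z₁ ^ (n + 1)) by ring])
  refine ⟨ε, hεpos, _, hF, IsDeveloping.eqOn_of_convex hω (hE.mono inter_subset_left)
    (hF.mono inter_subset_right) (isOpen_ball.inter isOpen_ball)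
    ((convex_ball _ _).inter (convex_ball _ _)) (fun z hz => pow_ne_zero _ (hne z hz.2))
    (z₀ := z₁) htE ?_⟩
  simp [w, e.left_inv hts]

/-- On a compact surface, a curve without accumulation points outside the zeros of `ω` converges to
a zero of `ω`, because the zeros are isolated. -/
theorem tendsto_zero_of_mapClusterPt [CompactSpace X] (hω : ω ∈ holomorphicOneForms X)
    (hfin : ∀ p, OneForm.order ω p ≠ ⊤) {c : ℝ → X} (hc : ContinuousOn c (Ioo 0 1))
    (hcl : ∀ y, MapClusterPt y (𝓝[<] (1 : ℝ)) c → ω y = 0) :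
    ∃ p, ω p = 0 ∧ Tendsto c (𝓝[<] 1) (𝓝 p) := by
  obtain ⟨p, hp⟩ := exists_clusterPt_of_compactSpace (map c (𝓝[<] (1 : ℝ)))
  have hp' : MapClusterPt p (𝓝[<] (1 : ℝ)) c := hp
  refine ⟨p, hcl p hp', ?_⟩
  by_contra hnt
  obtain ⟨O, hO, hfO⟩ := Filter.not_tendsto_iff_exists_frequently_notMem.1 hnt
  have hiso := eventually_nhdsWithin_iff.1 (eventually_ne_zero hω (hfin p))
  obtain ⟨K, hK, hKc, hKO⟩ := exists_mem_nhds_isClosed_subset (inter_mem hO hiso)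
  set N := interior K
  have hpN : p ∈ N := mem_interior_iff_mem_nhds.2 hK
  have hNK : N ⊆ K := interior_subset
  have hfr : ∀ x ∈ frontier N, ω x ≠ 0 := by
    intro x hx
    have hxK : x ∈ K := (closure_minimal hNK hKc) hx.1
    refine (hKO hxK).2 ?_
    rintro rfl
    exact hx.2 (by rwa [isOpen_interior.interior_eq])
  have hfreq : ∃ᶠ t in 𝓝[<] (1 : ℝ), c t ∈ frontier N := by
    rw [frequently_iff]
    intro S hS
    obtain ⟨a, ha, haS⟩ := (mem_nhdsLT_iff_exists_Ioo_subset' (zero_lt_one' ℝ)).1 hS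
    have hev : Ioo (max a 0) 1 ∈ 𝓝[<] (1 : ℝ) := Ioo_mem_nhdsLT (max_lt ha one_pos)
    obtain ⟨t₁, ht₁N, ht₁⟩ :=
      ((mapClusterPt_iff_frequently.1 hp' N (isOpen_interior.mem_nhds hpN)).and_eventually
        hev).exists
    obtain ⟨t₂, ht₂O, ht₂⟩ := (hfO.and_eventually hev).exists
    have hsub : uIcc t₁ t₂ ⊆ Ioo (max a 0) 1 := ordConnected_Ioo.uIcc_subset ht₁ ht₂
    have hcc : ContinuousOn c (uIcc t₁ t₂) := hc.mono fun t ht =>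
      ⟨(le_max_right a 0).trans_lt (hsub ht).1, (hsub ht).2⟩
    have hpre := (isPreconnected_uIcc (a := t₁) (b := t₂)).image c hcc
    by_contra! hno
    have hsN : c '' uIcc t₁ t₂ ⊆ N := by
      refine IsPreconnected.subset_left_of_subset_union isOpen_interior
        (isClosed_closure (s := N)).isOpen_compl
        (Set.disjoint_left.2 fun x h1 h2 => h2 (subset_closure h1)) ?_
        ⟨c t₁, mem_image_of_mem c left_mem_uIcc, ht₁N⟩ hpre
      rintro _ ⟨t, ht, rfl⟩
      by_cases h : c t ∈ N
      · exact Or.inl h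
      · refine Or.inr fun hcl => hno t
          (haS ⟨(le_max_left a 0).trans_lt (hsub ht).1, (hsub ht).2⟩) ?_
        exact ⟨hcl, by rwa [isOpen_interior.interior_eq]⟩
    exact ht₂O (hKO (hNK (hsN (mem_image_of_mem c right_mem_uIcc)))).1
  obtain ⟨x, hx, hxc⟩ :=
    (isClosed_frontier (s := N)).isCompact.exists_mapClusterPt_of_frequently hfreq
  exact hfr x hx (hcl x hxc)

/-- A developing map of a disc extends to a larger disc, unless one of its radii runs into a zero
of `ω`. -/
theorem IsDeveloping.exists_extension_step [CompactSpace X] (hω : ω ∈ holomorphicOneForms X)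
    (hfin : ∀ p, OneForm.order ω p ≠ ⊤) {R : ℝ} (hR : 0 < R)
    (hE : IsDeveloping ω n E (ball 0 R))
    (hno : ∀ b : ℂ, ‖b‖ = R → ¬∃ p, ω p = 0 ∧
      Tendsto (fun t : ℝ => E (t * b)) (𝓝[<] 1) (𝓝 p)) :
    ∃ R' > R, ∃ F, IsDeveloping ω n F (ball 0 R') ∧ EqOn F E (ball 0 R) := by
  have hloc : ∀ b : sphere (0 : ℂ) R, ∃ ε > 0, ∃ F, IsDeveloping ω n F (ball (b : ℂ) ε) ∧
      EqOn E F (ball 0 R ∩ ball (b : ℂ) ε) := by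
    rintro ⟨b, hb⟩
    have hb' : ‖b‖ = R := by simpa using hb
    by_contra hcon
    refine hno b hb' (tendsto_zero_of_mapClusterPt hω hfin
      ((hE.continuousOn_ray hb').mono (Ioo_subset_Ioo_left (by norm_num))) fun y hy => ?_)
    by_contra h0
    exact hcon (hE.exists_local_extension_of_mapClusterPt hω hR hb' h0 hy)
  choose ε hε F hF hEF using hloc
  obtain ⟨δ', hδ', hleb'⟩ := lebesgue_number_lemma_of_metric (isCompact_sphere (0 : ℂ) R)
    (c := fun b : sphere (0 : ℂ) R => ball (b : ℂ) (ε b)) (fun b => isOpen_ball)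
    (fun b hb => mem_iUnion.2 ⟨⟨b, hb⟩, mem_ball_self (hε _)⟩)
  set δ := min δ' R with hδdef
  have hδ : 0 < δ := lt_min hδ' hR
  have hleb : ∀ x ∈ sphere (0 : ℂ) R, ∃ G : ℂ → X, IsDeveloping ω n G (ball x δ) ∧
      EqOn E G (ball 0 R ∩ ball x δ) := by
    intro x hx
    obtain ⟨b, hb⟩ := hleb' x hx
    have hsub : ball x δ ⊆ ball (b : ℂ) (ε b) := (ball_subset_ball (min_le_left _ _)).trans hb
    exact ⟨F b, (hF b).mono hsub, fun z hz => hEF b ⟨hz.1, hsub hz.2⟩⟩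
  have : Nonempty X := ⟨E 0⟩
  choose! G hG hEG using hleb
  -- the radial projection to the sphere of radius `R`
  let π : ℂ → ℂ := fun z => ((R / ‖z‖ : ℝ) : ℂ) * z
  have hπs : ∀ z : ℂ, z ≠ 0 → π z ∈ sphere (0 : ℂ) R := by
    intro z hz
    have : ‖z‖ ≠ 0 := norm_ne_zero_iff.2 hz
    rw [mem_sphere_zero_iff_norm, norm_mul, Complex.norm_real,
      Real.norm_of_nonneg (div_nonneg hR.le (norm_nonneg _)), div_mul_cancel₀ _ this]
  have hπd : ∀ z : ℂ, R ≤ ‖z‖ → ‖z - π z‖ = ‖z‖ - R := by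
    intro z hz
    have h0 : 0 < ‖z‖ := hR.trans_le hz
    have h1 : z - π z = ((1 - R / ‖z‖ : ℝ) : ℂ) * z := by simp only [π]; push_cast; ring
    have h2 : 0 ≤ 1 - R / ‖z‖ := sub_nonneg.2 ((div_le_one h0).2 hz)
    rw [h1, norm_mul, Complex.norm_real, Real.norm_of_nonneg h2, sub_mul, one_mul,
      div_mul_cancel₀ _ h0.ne']
  -- two of the local continuations agree where both are defined
  have hagree : ∀ x ∈ sphere (0 : ℂ) R, ∀ y ∈ sphere (0 : ℂ) R, y ∈ ball x δ →
      EqOn (G x) (G y) (ball x δ ∩ ball y δ) := by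
    intro x hx y hy hyx
    have hyn : ‖y‖ = R := by simpa using hy
    have hcont := tendsto_ofReal_mul_one y
    have hI : ∀ᶠ t : ℝ in 𝓝[<] 1, t ∈ Ioo (0 : ℝ) 1 := Ioo_mem_nhdsLT one_pos
    obtain ⟨t, ⟨ht1, ht2⟩, htI⟩ := ((hcont.eventually (inter_mem (isOpen_ball.mem_nhds hyx)
      (ball_mem_nhds y hδ))).and hI).exists
    have htR : (t : ℂ) * y ∈ ball (0 : ℂ) R := by
      rw [mem_ball_zero_iff, norm_mul, Complex.norm_real, Real.norm_of_nonneg htI.1.le, hyn]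
      nlinarith [htI.2]
    refine IsDeveloping.eqOn_of_convex hω ((hG x hx).mono inter_subset_left)
      ((hG y hy).mono inter_subset_right) (isOpen_ball.inter isOpen_ball)
      ((convex_ball _ _).inter (convex_ball _ _)) (fun z hz => pow_ne_zero _ ?_) ⟨ht1, ht2⟩
      ((hEG x hx ⟨htR, ht1⟩).symm.trans (hEG y hy ⟨htR, ht2⟩))
    rintro rfl
    have := hz.2
    rw [mem_ball, dist_zero_left, hyn] at this
    exact absurd (min_le_right δ' R) (not_le.2 this)
  classical
  let H : ℂ → X := fun z => if ‖z‖ < R then E z else G (π z) z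
  have hHG : ∀ x ∈ sphere (0 : ℂ) R, ∀ z ∈ ball x (δ / 2), H z = G x z := by
    intro x hx z hz
    have hzδ : z ∈ ball x δ := ball_subset_ball (by linarith) hz
    by_cases hzR : ‖z‖ < R
    · simp only [H, if_pos hzR]
      exact hEG x hx ⟨by simpa using hzR, hzδ⟩
    · simp only [H, if_neg hzR]
      rw [not_lt] at hzR
      have hz0 : z ≠ 0 := norm_pos_iff.1 (hR.trans_le hzR)
      have hxn : ‖x‖ = R := by simpa using hx
      have h1 : ‖z‖ - R ≤ ‖z - x‖ := hxn ▸ norm_sub_norm_le z x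
      have h2 : ‖z - x‖ < δ / 2 := by simpa [dist_eq_norm] using hz
      have h3 : ‖z - π z‖ < δ / 2 := by rw [hπd z hzR]; linarith
      refine (hagree x hx (π z) (hπs z hz0) ?_ ⟨hzδ, ?_⟩).symm
      · rw [mem_ball]
        calc dist (π z) x ≤ dist (π z) z + dist z x := dist_triangle _ _ _
          _ < δ := by rw [dist_comm (π z) z, dist_eq_norm, dist_eq_norm]; linarith
      · rw [mem_ball, dist_eq_norm]; linarith
  refine ⟨R + δ / 2, by linarith, H, ?_, fun z hz => by
    simp only [H, if_pos (mem_ball_zero_iff.1 hz)]⟩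
  refine IsDeveloping.of_eventuallyEq fun z hz => ?_
  by_cases hzR : ‖z‖ < R
  · have hzb : z ∈ ball (0 : ℂ) R := by simpa using hzR
    refine ⟨E, ball 0 R, hzb, hE, ?_⟩
    filter_upwards [isOpen_ball.mem_nhds hzb] with w hw
    simp only [H, if_pos (mem_ball_zero_iff.1 hw)]
  · rw [not_lt] at hzR
    have hz0 : z ≠ 0 := norm_pos_iff.1 (hR.trans_le hzR)
    have hzd : z ∈ ball (π z) (δ / 2) := by
      rw [mem_ball, dist_eq_norm, hπd z hzR]
      have := mem_ball_zero_iff.1 hz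
      linarith
    refine ⟨G (π z), ball (π z) δ, ball_subset_ball (by linarith) hzd, hG _ (hπs z hz0), ?_⟩
    filter_upwards [isOpen_ball.mem_nhds hzd] with w hw using hHG _ (hπs z hz0) w hw

/-- Developing maps on increasing discs with a common germ at the centre glue together. -/
theorem exists_developing_of_forall_lt (hω : ω ∈ holomorphicOneForms X) {P : ℂ → X} {δ R : ℝ}
    (hδ : 0 < δ) (h : ∀ r < R, ∃ F, IsDeveloping ω n F (ball 0 r) ∧ EqOn F P (ball 0 (min r δ))) :
    ∃ F, IsDeveloping ω n F (ball 0 R) ∧ EqOn F P (ball 0 (min R δ)) := by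
  have : Nonempty X := ⟨P 0⟩
  choose! F hF hFP using h
  have hag : ∀ r s, 0 < r → r ≤ s → s < R → EqOn (F r) (F s) (ball 0 r) := by
    intro r s hr hrs hs
    refine IsDeveloping.eqOn_of_ball hω (lt_min hr hδ) (hF r (hrs.trans_lt hs))
      ((hF s hs).mono (ball_subset_ball hrs)) fun z hz => ?_
    rw [hFP r (hrs.trans_lt hs) hz,
      hFP s hs (ball_subset_ball (min_le_min_right δ hrs) hz)]
  have hmid : ∀ z : ℂ, ‖z‖ < R → ‖z‖ < (‖z‖ + R) / 2 ∧ (‖z‖ + R) / 2 < R ∧ 0 < (‖z‖ + R) / 2 :=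
    fun z hz => ⟨by linarith, by linarith, by linarith [norm_nonneg z]⟩
  have hval : ∀ z : ℂ, ∀ s, ‖z‖ < s → s < R → F ((‖z‖ + R) / 2) z = F s z := by
    intro z s hzs hs
    obtain ⟨h1, h2, h3⟩ := hmid z (hzs.trans hs)
    rcases le_total ((‖z‖ + R) / 2) s with h | h
    · exact hag _ _ h3 h hs (by simpa using h1)
    · exact (hag _ _ ((norm_nonneg z).trans_lt hzs) h h2 (by simpa using hzs)).symm
  refine ⟨fun z => F ((‖z‖ + R) / 2) z, ?_, fun z hz => ?_⟩
  · refine IsDeveloping.of_eventuallyEq fun z hz => ?_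
    rw [mem_ball_zero_iff] at hz
    obtain ⟨h1, h2, h3⟩ := hmid z hz
    have hzb : z ∈ ball (0 : ℂ) ((‖z‖ + R) / 2) := by simpa using h1
    refine ⟨F ((‖z‖ + R) / 2), _, hzb, hF _ h2, ?_⟩
    filter_upwards [isOpen_ball.mem_nhds hzb] with w hw
    exact hval w _ (by simpa using hw) h2
  · rw [mem_ball_zero_iff] at hz
    obtain ⟨h1, h2, h3⟩ := hmid z (hz.trans_le (min_le_left _ _))
    exact hFP _ h2 (by
      rw [mem_ball_zero_iff]; exact lt_min h1 (hz.trans_le (min_le_right _ _)))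

/-- Continuation of developing maps: a developing map of a small disc extends to the disc of
radius `R`, unless along the way a radius runs into a zero of `ω`. -/
theorem IsDeveloping.exists_extension [CompactSpace X] (hω : ω ∈ holomorphicOneForms X)
    (hfin : ∀ p, OneForm.order ω p ≠ ⊤) {P : ℂ → X} {δ : ℝ} (hδ : 0 < δ)
    (hP : IsDeveloping ω n P (ball 0 δ)) {R : ℝ} :
    (∃ F, IsDeveloping ω n F (ball 0 R) ∧ EqOn F P (ball 0 δ)) ∨
      ∃ b : ℂ, δ ≤ ‖b‖ ∧ ‖b‖ < R ∧ ∃ F, IsDeveloping ω n F (ball 0 ‖b‖) ∧ EqOn F P (ball 0 δ) ∧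
        ∃ p, ω p = 0 ∧ Tendsto (fun t : ℝ => F (t * b)) (𝓝[<] 1) (𝓝 p) := by
  by_contra! hcon
  obtain ⟨hcon1, hcon2⟩ := hcon
  let S : Set ℝ := {r | δ ≤ r ∧ ∃ F, IsDeveloping ω n F (ball 0 r) ∧ EqOn F P (ball 0 δ)}
  have hδS : δ ∈ S := ⟨le_rfl, P, hP, fun _ _ => rfl⟩
  have hSb : ∀ r ∈ S, r < R := by
    rintro r ⟨h1, F, hF, hFP⟩
    by_contra hr
    exact hcon1 F (hF.mono (ball_subset_ball (not_lt.1 hr))) hFP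
  have hbdd : BddAbove S := ⟨R, fun r hr => (hSb r hr).le⟩
  set r₀ := sSup S
  have hδr : δ ≤ r₀ := le_csSup hbdd hδS
  obtain ⟨F, hF, hFP⟩ : ∃ F, IsDeveloping ω n F (ball 0 r₀) ∧ EqOn F P (ball 0 (min r₀ δ)) := by
    refine exists_developing_of_forall_lt hω hδ fun r hr => ?_
    obtain ⟨s, ⟨h1, F, hF, hFP⟩, hrs⟩ := exists_lt_of_lt_csSup ⟨δ, hδS⟩ hr
    exact ⟨F, hF.mono (ball_subset_ball hrs.le), hFP.mono (ball_subset_ball (min_le_right _ _))⟩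
  rw [min_eq_right hδr] at hFP
  have hr₀S : r₀ ∈ S := ⟨hδr, F, hF, hFP⟩
  obtain ⟨R', hR', G, hG, hGF⟩ := hF.exists_extension_step hω hfin (hδ.trans_le hδr) (by
    rintro b hb ⟨p, hp, hlim⟩
    exact hcon2 b (hb ▸ hδr) (hb ▸ hSb _ hr₀S) F (hb ▸ hF) hFP p hp hlim)
  have : R' ∈ S := ⟨hδr.trans hR'.le, G, hG, (hGF.mono (ball_subset_ball hδr)).trans hFP⟩
  exact absurd (le_csSup hbdd this) (not_le.2 hR')

end Extension

end Developing

/-! ### Straight segments in the coordinate `ζ` with `ω = d(ζ ^ 3)` -/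

section CubeRootPath

/-- The branch starting at `ζ`, at time `t₀`, of the cube root of the straight path
`ζ ^ 3 + (t - t₀) c`. -/
noncomputable def cubeRootPath (ζ c : ℂ) (t₀ t : ℝ) : ℂ :=
  ζ * (1 + ((t - t₀ : ℝ) : ℂ) * (c / ζ ^ 3)) ^ (((3 : ℕ) : ℂ)⁻¹)

variable {ζ c : ℂ} {t₀ t : ℝ}

theorem cubeRootPath_pow (hζ : ζ ≠ 0) :
    cubeRootPath ζ c t₀ t ^ 3 = ζ ^ 3 + ((t - t₀ : ℝ) : ℂ) * c := by
  rw [cubeRootPath, mul_pow, Complex.cpow_nat_inv_pow _ three_ne_zero]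
  field_simp

@[simp]
theorem cubeRootPath_self : cubeRootPath ζ c t₀ t₀ = ζ := by
  simp [cubeRootPath]

theorem norm_cubeRootPath_pow (hζ : ζ ≠ 0) :
    ‖cubeRootPath ζ c t₀ t‖ ^ 3 = ‖ζ ^ 3 + ((t - t₀ : ℝ) : ℂ) * c‖ := by
  rw [← norm_pow, cubeRootPath_pow hζ]

theorem norm_cubeRootPath_lt (hζ : ζ ≠ 0) {ρ : ℝ} (hρ : 0 ≤ ρ)
    (h : ‖ζ ^ 3 + ((t - t₀ : ℝ) : ℂ) * c‖ < ρ ^ 3) : cubeRootPath ζ c t₀ t ∈ ball (0 : ℂ) ρ := by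
  rw [mem_ball_zero_iff]
  rw [← norm_cubeRootPath_pow hζ] at h
  exact lt_of_pow_lt_pow_left₀ 3 hρ h

theorem cubeRootPath_ne_zero (hζ : ζ ≠ 0)
    (h : 1 + ((t - t₀ : ℝ) : ℂ) * (c / ζ ^ 3) ∈ Complex.slitPlane) :
    cubeRootPath ζ c t₀ t ≠ 0 := by
  intro h0
  have h1 := cubeRootPath_pow (c := c) (t₀ := t₀) (t := t) hζ
  rw [h0, zero_pow three_ne_zero] at h1
  refine Complex.slitPlane_ne_zero h ?_
  have : ζ ^ 3 * (1 + ((t - t₀ : ℝ) : ℂ) * (c / ζ ^ 3)) = 0 := by rw [h1]; field_simp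
  exact (mul_eq_zero.1 this).resolve_left (pow_ne_zero 3 hζ)

theorem hasDerivAt_cubeRootPath (hζ : ζ ≠ 0)
    (h : 1 + ((t - t₀ : ℝ) : ℂ) * (c / ζ ^ 3) ∈ Complex.slitPlane) :
    ∃ u', HasDerivAt (cubeRootPath ζ c t₀) u' t ∧
      ((2 : ℕ) + 1) * cubeRootPath ζ c t₀ t ^ 2 * u' = c := by
  have h1 : HasDerivAt (fun z : ℂ => 1 + (z - t₀) * (c / ζ ^ 3)) (c / ζ ^ 3) t := by
    simpa using (((hasDerivAt_id (t : ℂ)).sub_const (t₀ : ℂ)).mul_const (c / ζ ^ 3)).const_add 1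
  have h2 := ((h1.cpow_const (c := ((3 : ℕ) : ℂ)⁻¹)
    (by push_cast at h ⊢; exact h)).const_mul ζ).comp_ofReal
  have h3 : HasDerivAt (cubeRootPath ζ c t₀) _ t :=
    h2.congr_of_eventuallyEq (Eventually.of_forall fun s => by
      simp only [cubeRootPath]; push_cast; rfl)
  refine ⟨_, h3, ?_⟩
  have h4 := h3.pow 3
  have h5 : HasDerivAt (fun s : ℝ => ζ ^ 3 + ((s - t₀ : ℝ) : ℂ) * c) c t := by
    have : HasDerivAt (fun s : ℝ => ζ ^ 3 + (((s : ℝ) : ℂ) * c - t₀ * c)) c t :=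
      ((hasDerivAt_ofReal_mul c t).sub_const _).const_add _
    refine this.congr_of_eventuallyEq (Eventually.of_forall fun s => ?_)
    push_cast; ring
  have h6 := h4.unique (h5.congr_of_eventuallyEq
    (Eventually.of_forall fun s => cubeRootPath_pow hζ))
  refine Eq.trans ?_ h6
  norm_num

theorem continuousAt_cubeRootPath (hζ : ζ ≠ 0)
    (h : 1 + ((t - t₀ : ℝ) : ℂ) * (c / ζ ^ 3) ∈ Complex.slitPlane) :
    ContinuousAt (cubeRootPath ζ c t₀) t :=
  let ⟨_, h, _⟩ := hasDerivAt_cubeRootPath hζ h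
  h.continuousAt

end CubeRootPath

/-! ### Discs around double zeros -/

section ZeroDisc

variable {X : Type*} [TopologicalSpace X] [ChartedSpace ℂ X]

/-- `E` is a developing map on the disc of radius `ρ`, centred at the double zero `p` of `ω`: in the
coordinate `ζ` on the disc, `ω = d(ζ ^ 3)`, so that the disc has flat radius `ρ ^ 3`. The map need
not be injective on the whole disc, but near the centre it is the inverse of a chart. -/
structure IsZeroDisc (ω : OneForm X) (p : X) (E : ℂ → X) (ρ : ℝ) : Prop where
  radius_pos : 0 < ρ
  isDeveloping : IsDeveloping ω 2 E (ball 0 ρ)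
  zero : ω p = 0
  exists_chart : ∃ e ∈ IsManifold.maximalAtlas 𝓘(ℂ) ⊤ X, ∃ δ > 0, δ ≤ ρ ∧ e.target = ball 0 δ ∧
    p ∈ e.source ∧ e p = 0 ∧ EqOn E e.symm (ball 0 δ)

variable {ω : OneForm X} {p p' : X} {E E' : ℂ → X} {ρ : ℝ}

theorem IsZeroDisc.center (h : IsZeroDisc ω p E ρ) : E 0 = p := by
  obtain ⟨e, -, δ, hδ, -, het, hp, hep, hE⟩ := h.exists_chart
  rw [hE (mem_ball_self hδ), ← hep, e.left_inv hp]

theorem IsZeroDisc.ne_zero (h : IsZeroDisc ω p E ρ) {z : ℂ} (hz : z ∈ ball (0 : ℂ) ρ)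
    (h0 : z ≠ 0) : ω (E z) ≠ 0 :=
  h.isDeveloping.ne_zero hz (pow_ne_zero 2 h0)

theorem IsZeroDisc.exists_injOn (h : IsZeroDisc ω p E ρ) :
    ∃ δ > 0, δ ≤ ρ ∧ InjOn E (ball 0 δ) := by
  obtain ⟨e, -, δ, hδ, hδρ, het, hp, hep, hE⟩ := h.exists_chart
  refine ⟨δ, hδ, hδρ, fun x hx y hy hxy => ?_⟩
  rw [hE hx, hE hy] at hxy
  exact e.symm.injOn (by simpa [het] using hx) (by simpa [het] using hy) hxy

theorem IsZeroDisc.map_nhds (h : IsZeroDisc ω p E ρ) : map E (𝓝 0) = 𝓝 p := by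
  obtain ⟨e, -, δ, hδ, hδρ, het, hp, hep, hE⟩ := h.exists_chart
  have h1 : E =ᶠ[𝓝 0] e.symm := by
    filter_upwards [ball_mem_nhds (0 : ℂ) hδ] with z hz using hE hz
  rw [Filter.map_congr h1]
  have h2 := e.symm.map_nhds_eq (x := e p) (e.map_source hp)
  rwa [e.left_inv hp, hep] at h2

/-- The radial segments in a disc around a zero, read from the circumference to the centre, are
straight segments. -/
theorem IsZeroDisc.radial (h : IsZeroDisc ω p E ρ) {x : ℂ} (hx : x ≠ 0) {t : ℝ} (ht : t < 1)
    (hxt : ‖x‖ ^ 3 * (1 - t) < ρ ^ 3) :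
    MDifferentiableAt 𝓘(ℝ, ℝ) 𝓘(ℝ, ℂ) (fun t => E (cubeRootPath x (-x ^ 3) 0 t)) t ∧
      ω (E (cubeRootPath x (-x ^ 3) 0 t)) ≠ 0 ∧
      ω (E (cubeRootPath x (-x ^ 3) 0 t)) (velocity (fun t => E (cubeRootPath x (-x ^ 3) 0 t)) t) =
        -x ^ 3 := by
  have hx3 : x ^ 3 ≠ 0 := pow_ne_zero 3 hx
  have hs : 1 + ((t - 0 : ℝ) : ℂ) * (-x ^ 3 / x ^ 3) ∈ Complex.slitPlane := by
    rw [neg_div, div_self hx3]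
    have : (1 : ℂ) + ((t - 0 : ℝ) : ℂ) * -1 = ((1 - t : ℝ) : ℂ) := by push_cast; ring
    rw [this, Complex.ofReal_mem_slitPlane]; linarith
  have hmem : cubeRootPath x (-x ^ 3) 0 t ∈ ball (0 : ℂ) ρ := by
    refine norm_cubeRootPath_lt hx h.radius_pos.le ?_
    have : x ^ 3 + ((t - 0 : ℝ) : ℂ) * -x ^ 3 = x ^ 3 * ((1 - t : ℝ) : ℂ) := by push_cast; ring
    rw [this, norm_mul, norm_pow, Complex.norm_real, Real.norm_of_nonneg (by linarith)]
    exact hxt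
  obtain ⟨u', hu', huc⟩ := hasDerivAt_cubeRootPath hx hs
  have := h.isDeveloping.curve hmem hu'
  exact ⟨this.1, h.ne_zero hmem (cubeRootPath_ne_zero hx hs), this.2.trans huc⟩

theorem cubeRootPath_radial {x y : ℂ} (hx : x ≠ 0) (hxy : y ^ 3 = x ^ 3) {s : ℝ} (hs : 0 < s) :
    cubeRootPath y (-x ^ 3) 0 (1 - s ^ 3) = y * s := by
  have hx3 : x ^ 3 ≠ 0 := pow_ne_zero 3 hx
  rw [cubeRootPath, hxy, neg_div, div_self hx3]
  have : (1 : ℂ) + ((1 - s ^ 3 - 0 : ℝ) : ℂ) * -1 = (s : ℂ) ^ 3 := by push_cast; ring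
  rw [this]
  congr 1
  have h1 : (s : ℂ) ^ 3 = ((s ^ 3 : ℝ) : ℂ) := by push_cast; rfl
  have h2 : (((3 : ℕ) : ℂ)⁻¹) = (((3 : ℕ) : ℝ)⁻¹ : ℝ) := by push_cast; rfl
  rw [h1, h2, ← Complex.ofReal_cpow (by positivity), Real.pow_rpow_inv_natCast hs.le three_ne_zero]

variable [IsManifold 𝓘(ℂ) ⊤ X] [T2Space X]

/-- Lifting of straight segments: a curve with `ω(γ') = c` that avoids the zeros of `ω` and starts
in a disc around a zero is, as long as it stays in the disc, the image of the cube root of a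
straight segment. In particular the segment does not pass through the centre of the disc. -/
theorem IsZeroDisc.lift (hω : ω ∈ holomorphicOneForms X) (h : IsZeroDisc ω p E ρ) {γ : ℝ → X}
    {a b : ℝ} {c : ℂ} (hγ : ∀ t ∈ Ioo a b, MDifferentiableAt 𝓘(ℝ, ℝ) 𝓘(ℝ, ℂ) γ t)
    (h0 : ∀ t ∈ Ioo a b, ω (γ t) ≠ 0) (hv : ∀ t ∈ Ioo a b, ω (γ t) (velocity γ t) = c)
    {t₀ : ℝ} (ht₀ : t₀ ∈ Ioo a b) {ζ : ℂ} (hζ : ζ ∈ ball (0 : ℂ) ρ) (hζ0 : ζ ≠ 0)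
    (heq : γ t₀ = E ζ) {t : ℝ} (ht : t ∈ Ioo a b)
    (htρ : ‖ζ ^ 3 + ((t - t₀ : ℝ) : ℂ) * c‖ < ρ ^ 3) :
    1 + ((t - t₀ : ℝ) : ℂ) * (c / ζ ^ 3) ∈ Complex.slitPlane ∧
      γ t = E (cubeRootPath ζ c t₀ t) := by
  have hρ := h.radius_pos
  let f : ℝ → ℂ := fun t => 1 + ((t - t₀ : ℝ) : ℂ) * (c / ζ ^ 3)
  let W : ℝ → ℂ := fun t => ζ ^ 3 + ((t - t₀ : ℝ) : ℂ) * c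
  have hfW : ∀ t, W t = ζ ^ 3 * f t := fun t => by
    simp only [W, f]; field_simp
  have hfc : Continuous f := by fun_prop
  have hWc : Continuous W := by fun_prop
  have hζρ : ‖ζ ^ 3‖ < ρ ^ 3 := by
    rw [norm_pow]; exact pow_lt_pow_left₀ (mem_ball_zero_iff.1 hζ) (norm_nonneg _) three_ne_zero
  let J : Set ℝ := {t | t ∈ Ioo a b ∧ ‖W t‖ < ρ ^ 3 ∧ f t ∈ Complex.slitPlane}
  have hJ : IsOpen J := isOpen_Ioo.inter ((isOpen_lt (hWc.norm) continuous_const).inter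
    (Complex.isOpen_slitPlane.preimage hfc))
  have ht₀J : t₀ ∈ J := ⟨ht₀, by simpa [W] using hζρ, by simp [f]⟩
  -- `J` is star-shaped with respect to `t₀`
  have hJc : IsPreconnected J := by
    refine (StarConvex.isPathConnected (a := t₀) ?_ ht₀J).isConnected.isPreconnected
    intro s hs x y hx hy hxy
    have hxy' : (x : ℂ) + y = 1 := by exact_mod_cast hxy
    refine ⟨convex_Ioo a b ht₀ hs.1 hx hy hxy, ?_, ?_⟩
    · have : W (x • t₀ + y • s) = x • ζ ^ 3 + y • W s := by
        simp only [W, smul_eq_mul, Complex.real_smul]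
        push_cast
        linear_combination (t₀ * c - ζ ^ 3) * hxy'
      have h1 := convex_ball (0 : ℂ) (ρ ^ 3) (mem_ball_zero_iff.2 hζρ) (mem_ball_zero_iff.2 hs.2.1)
        hx hy hxy
      rw [this]; exact mem_ball_zero_iff.1 h1
    · have : f (x • t₀ + y • s) = x • 1 + y • f s := by
        simp only [f, smul_eq_mul, Complex.real_smul]
        push_cast
        linear_combination (t₀ * (c / ζ ^ 3) - 1) * hxy'
      rw [this]
      exact Complex.starConvex_one_slitPlane hs.2.2 hx hy hxy
  have hu : ∀ s ∈ J, cubeRootPath ζ c t₀ s ∈ ball (0 : ℂ) ρ := fun s hs =>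
    norm_cubeRootPath_lt hζ0 hρ.le hs.2.1
  have hcurve : ∀ s ∈ J, MDifferentiableAt 𝓘(ℝ, ℝ) 𝓘(ℝ, ℂ) (fun s => E (cubeRootPath ζ c t₀ s)) s ∧
      ω (E (cubeRootPath ζ c t₀ s)) (velocity (fun s => E (cubeRootPath ζ c t₀ s)) s) = c := by
    intro s hs
    obtain ⟨u', hu', huc⟩ := hasDerivAt_cubeRootPath hζ0 hs.2.2
    have := h.isDeveloping.curve (hu s hs) hu'
    exact ⟨this.1, this.2.trans huc⟩
  have hEq : EqOn γ (fun s => E (cubeRootPath ζ c t₀ s)) J :=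
    curve_eqOn hω hJ hJc (fun s hs => hγ s hs.1) (fun s hs => (hcurve s hs).1)
      (fun s hs => h0 s hs.1) (fun s hs => by rw [hv s hs.1, (hcurve s hs).2]) ht₀J
      (by simpa using heq)
  suffices hslit : f t ∈ Complex.slitPlane from ⟨hslit, hEq ⟨ht, htρ, hslit⟩⟩
  -- otherwise the segment runs through `0` at an intermediate time, where the curve meets `p`
  by_contra hns
  rw [Complex.mem_slitPlane_iff, not_or, not_lt, not_not] at hns
  obtain ⟨hre, him⟩ := hns
  set k : ℝ := 1 - (f t).re with hk
  have hk1 : 1 ≤ k := by linarith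
  have hfs : ∀ θ : ℝ, f (t₀ + θ * (t - t₀)) = ((1 - θ * k : ℝ) : ℂ) := by
    intro θ
    have h1 : f t = ((f t).re : ℂ) := by
      apply Complex.ext <;> simp [him]
    have h2 : ((t - t₀ : ℝ) : ℂ) * (c / ζ ^ 3) = ((-k : ℝ) : ℂ) := by
      have : f t - 1 = ((t - t₀ : ℝ) : ℂ) * (c / ζ ^ 3) := by simp only [f]; ring
      rw [← this, h1, hk]; push_cast; ring
    simp only [f]
    rw [show t₀ + θ * (t - t₀) - t₀ = θ * (t - t₀) by ring]
    push_cast at h2 ⊢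
    rw [mul_assoc, h2]; ring
  have hIoo : ∀ θ ∈ Icc (0 : ℝ) 1, t₀ + θ * (t - t₀) ∈ Ioo a b := by
    intro θ hθ
    have := convex_Ioo a b ht₀ ht (sub_nonneg.2 hθ.2) hθ.1 (by ring)
    simp only [smul_eq_mul] at this
    rwa [show t₀ + θ * (t - t₀) = (1 - θ) * t₀ + θ * t by ring]
  have hk0 : 0 < k := by linarith
  have hθJ : ∀ θ ∈ Ico 0 (1 / k), t₀ + θ * (t - t₀) ∈ J := by
    intro θ hθ
    have h1 : θ * k < 1 := (lt_div_iff₀ hk0).1 hθ.2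
    have h2 : 0 ≤ θ * k := mul_nonneg hθ.1 hk0.le
    have h3 : θ ≤ 1 := hθ.2.le.trans ((div_le_one hk0).2 hk1)
    refine ⟨hIoo θ ⟨hθ.1, h3⟩, ?_, ?_⟩
    · rw [hfW, hfs, norm_mul, Complex.norm_real, Real.norm_of_nonneg (by linarith)]
      nlinarith [norm_nonneg (ζ ^ 3)]
    · rw [hfs, Complex.ofReal_mem_slitPlane]; linarith
  set s₁ := t₀ + 1 / k * (t - t₀) with hs₁
  have hs₁I : s₁ ∈ Ioo a b := hIoo _ ⟨by positivity, (div_le_one hk0).2 hk1⟩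
  have hlim1 : Tendsto (fun θ : ℝ => γ (t₀ + θ * (t - t₀))) (𝓝[<] (1 / k)) (𝓝 (γ s₁)) := by
    have hc : ContinuousAt (fun θ : ℝ => t₀ + θ * (t - t₀)) (1 / k) := by fun_prop
    exact (ContinuousAt.comp (f := fun θ : ℝ => t₀ + θ * (t - t₀)) (g := γ)
      (hγ s₁ hs₁I).continuousAt hc).tendsto.mono_left nhdsWithin_le_nhds
  have hev : ∀ᶠ θ in 𝓝[<] (1 / k), θ ∈ Ico 0 (1 / k) := by
    filter_upwards [Ioo_mem_nhdsLT (one_div_pos.2 hk0)] with θ hθ using ⟨hθ.1.le, hθ.2⟩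
  have hlim2 : Tendsto (fun θ : ℝ => cubeRootPath ζ c t₀ (t₀ + θ * (t - t₀))) (𝓝[<] (1 / k))
      (𝓝 0) := by
    rw [tendsto_zero_iff_norm_tendsto_zero]
    have h1 : Tendsto (fun θ : ℝ => ‖W (t₀ + θ * (t - t₀))‖) (𝓝[<] (1 / k)) (𝓝 0) := by
      have hc : ContinuousAt (fun θ : ℝ => ‖W (t₀ + θ * (t - t₀))‖) (1 / k) := by fun_prop
      have h2 := hc.tendsto.mono_left (nhdsWithin_le_nhds (s := Iio (1 / k)))
      have h3 : ‖W (t₀ + 1 / k * (t - t₀))‖ = 0 := by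
        rw [hfW, hfs, div_mul_cancel₀ _ hk0.ne']; simp
      rwa [h3] at h2
    have h2 := h1.rpow_const (p := (1 / 3 : ℝ)) (Or.inr (by norm_num))
    rw [Real.zero_rpow (by norm_num)] at h2
    refine h2.congr fun θ => ?_
    rw [← norm_cubeRootPath_pow hζ0, ← Real.rpow_natCast, ← Real.rpow_mul (norm_nonneg _)]
    norm_num
  have hlim3 : Tendsto (fun θ : ℝ => γ (t₀ + θ * (t - t₀))) (𝓝[<] (1 / k)) (𝓝 p) := by
    have h1 := (h.isDeveloping.continuousAt (mem_ball_self hρ)).tendsto.comp hlim2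
    rw [h.center] at h1
    refine h1.congr' ?_
    filter_upwards [hev] with θ hθ using (hEq (hθJ θ hθ)).symm
  have hp := tendsto_nhds_unique hlim1 hlim3
  exact h0 s₁ hs₁I (hp ▸ h.zero)

/-- If the lifted curve runs into a zero of `ω` inside the disc, then this is the centre. -/
theorem IsZeroDisc.lift_end (hω : ω ∈ holomorphicOneForms X) (h : IsZeroDisc ω p E ρ) {γ : ℝ → X}
    {a b : ℝ} {c : ℂ} (hγ : ∀ t ∈ Ioo a b, MDifferentiableAt 𝓘(ℝ, ℝ) 𝓘(ℝ, ℂ) γ t)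
    (h0 : ∀ t ∈ Ioo a b, ω (γ t) ≠ 0) (hv : ∀ t ∈ Ioo a b, ω (γ t) (velocity γ t) = c)
    {t₀ : ℝ} (ht₀ : t₀ ∈ Ioo a b) {ζ : ℂ} (hζ : ζ ∈ ball (0 : ℂ) ρ) (hζ0 : ζ ≠ 0)
    (heq : γ t₀ = E ζ) {s : ℝ} (hs : s ∈ Icc a b) {y : X}
    (hlim : Tendsto γ (𝓝[Ioo a b] s) (𝓝 y)) (hy : ω y = 0)
    (hsρ : ‖ζ ^ 3 + ((s - t₀ : ℝ) : ℂ) * c‖ < ρ ^ 3) :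
    ζ ^ 3 + ((s - t₀ : ℝ) : ℂ) * c = 0 := by
  have hab : a < b := ht₀.1.trans ht₀.2
  have hne : (𝓝[Ioo a b] s).NeBot := mem_closure_iff_nhdsWithin_neBot.1
    (by rwa [closure_Ioo hab.ne])
  let f : ℝ → ℂ := fun t => 1 + ((t - t₀ : ℝ) : ℂ) * (c / ζ ^ 3)
  have hfc : Continuous f := by fun_prop
  have hWc : Continuous fun t : ℝ => ‖ζ ^ 3 + ((t - t₀ : ℝ) : ℂ) * c‖ := by fun_prop
  have hev : ∀ᶠ t in 𝓝[Ioo a b] s, f t ∈ Complex.slitPlane ∧ γ t = E (cubeRootPath ζ c t₀ t) := by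
    have h1 : ∀ᶠ t in 𝓝[Ioo a b] s, ‖ζ ^ 3 + ((t - t₀ : ℝ) : ℂ) * c‖ < ρ ^ 3 :=
      (hWc.continuousAt.tendsto.mono_left nhdsWithin_le_nhds).eventually (gt_mem_nhds hsρ)
    filter_upwards [h1, self_mem_nhdsWithin] with t ht htI
    exact h.lift hω hγ h0 hv ht₀ hζ hζ0 heq htI ht
  have hfs : ζ ^ 3 + ((s - t₀ : ℝ) : ℂ) * c = ζ ^ 3 * f s := by
    simp only [f]; field_simp
  by_cases hslit : f s ∈ Complex.slitPlane
  · exfalso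
    have hmem := norm_cubeRootPath_lt hζ0 h.radius_pos.le hsρ
    have h1 : Tendsto (fun t => E (cubeRootPath ζ c t₀ t)) (𝓝[Ioo a b] s)
        (𝓝 (E (cubeRootPath ζ c t₀ s))) :=
      ((h.isDeveloping.continuousAt hmem).tendsto.comp
        (continuousAt_cubeRootPath hζ0 hslit).tendsto).mono_left nhdsWithin_le_nhds
    have h2 := h1.congr' (by filter_upwards [hev] with t ht using ht.2.symm)
    have h3 := tendsto_nhds_unique hlim h2
    exact h.ne_zero hmem (cubeRootPath_ne_zero hζ0 hslit) (h3 ▸ hy)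
  · rw [hfs, mul_eq_zero]
    right
    rw [Complex.mem_slitPlane_iff, not_or, not_lt, not_not] at hslit
    obtain ⟨hre, him⟩ := hslit
    -- the quotient `c / ζ ^ 3` is real, so all values of `f` are real
    have hst : s - t₀ ≠ 0 := by
      intro h
      simp [f, h] at hre
      linarith
    have him' : (c / ζ ^ 3).im = 0 := by
      have h1 : (f s).im = (s - t₀) * (c / ζ ^ 3).im := by
        simp only [f, Complex.add_im, Complex.one_im, zero_add, Complex.im_ofReal_mul]
      rw [him] at h1
      exact (mul_eq_zero.1 h1.symm).resolve_left hst
    have hpos : ∀ᶠ t in 𝓝[Ioo a b] s, 0 ≤ (f t).re := by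
      filter_upwards [hev] with t ht
      have h1 : (f t).im = 0 := by
        simp only [f, Complex.add_im, Complex.one_im, zero_add, Complex.im_ofReal_mul, him',
          mul_zero]
      exact ((Complex.mem_slitPlane_iff.1 ht.1).resolve_right (not_not.2 h1)).le
    have hlimre : Tendsto (fun t => (f t).re) (𝓝[Ioo a b] s) (𝓝 (f s).re) :=
      ((Complex.continuous_re.comp hfc).continuousAt (x := s)).tendsto.mono_left nhdsWithin_le_nhds
    have h2 : 0 ≤ (f s).re := ge_of_tendsto hlimre hpos
    exact Complex.ext (le_antisymm hre h2) him

/-- If the discs around two zeros have a point in common, and the sum of its flat distances from the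
two centres is less than the common flat radius, then the zeros are equal, and the radii that lead
to the point in the two discs are the same curve. -/
theorem IsZeroDisc.eq_of_eq (hω : ω ∈ holomorphicOneForms X) (h : IsZeroDisc ω p E ρ)
    (h' : IsZeroDisc ω p' E' ρ) {x y : ℂ} (hx : x ≠ 0) (hy : y ≠ 0) (hxy : E x = E' y)
    (hρ : ‖x‖ ^ 3 + ‖y‖ ^ 3 < ρ ^ 3) :
    p = p' ∧ ∀ s ∈ Ioc (0 : ℝ) 1, E (x * s) = E' (y * s) := by
  have hxn : 0 < ‖x‖ := norm_pos_iff.2 hx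
  have hyn : 0 < ‖y‖ := norm_pos_iff.2 hy
  have hyρ : y ∈ ball (0 : ℂ) ρ := mem_ball_zero_iff.2
    (lt_of_pow_lt_pow_left₀ 3 h.radius_pos.le (by nlinarith [pow_pos hxn 3]))
  set ε : ℝ := (ρ ^ 3 - ‖x‖ ^ 3) / ‖x‖ ^ 3 with hε
  have hεpos : 0 < ε := div_pos (by nlinarith [pow_pos hyn 3]) (pow_pos hxn 3)
  have hεx : ‖x‖ ^ 3 * (1 + ε) = ρ ^ 3 := by rw [hε]; field_simp; ring
  set γ : ℝ → X := fun t => E (cubeRootPath x (-x ^ 3) 0 t)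
  have hrad : ∀ t ∈ Ioo (-ε) 1, _ := fun t ht => h.radial hx (t := t) ht.2
    (by rw [← hεx]; exact mul_lt_mul_of_pos_left (by linarith [ht.1]) (pow_pos hxn 3))
  have h0mem : (0 : ℝ) ∈ Ioo (-ε) 1 := ⟨by linarith, one_pos⟩
  have hγ0 : γ 0 = E' y := by simpa [γ] using hxy
  have hnorm : ∀ t ∈ Icc (0 : ℝ) 1, ‖y ^ 3 + ((t - 0 : ℝ) : ℂ) * -x ^ 3‖ < ρ ^ 3 := by
    intro t ht
    refine (norm_add_le _ _).trans_lt ?_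
    rw [norm_mul, norm_neg, norm_pow, norm_pow, Complex.norm_real, sub_zero,
      Real.norm_of_nonneg ht.1]
    nlinarith [ht.2, pow_pos hxn 3]
  have hlim : Tendsto γ (𝓝[Ioo (-ε) 1] 1) (𝓝 p) := by
    have h1 : Tendsto (fun t => cubeRootPath x (-x ^ 3) 0 t) (𝓝[Ioo (-ε) 1] 1) (𝓝 0) := by
      rw [tendsto_zero_iff_norm_tendsto_zero]
      have h1 : Tendsto (fun t : ℝ => ‖x ^ 3 + ((t - 0 : ℝ) : ℂ) * -x ^ 3‖) (𝓝[Ioo (-ε) 1] 1)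
          (𝓝 0) := by
        have hc : Continuous (fun t : ℝ => ‖x ^ 3 + ((t - 0 : ℝ) : ℂ) * -x ^ 3‖) := by fun_prop
        have h2 := (hc.tendsto 1).mono_left (nhdsWithin_le_nhds (s := Ioo (-ε) 1))
        simpa using h2
      have h2 := h1.rpow_const (p := (1 / 3 : ℝ)) (Or.inr (by norm_num))
      rw [Real.zero_rpow (by norm_num)] at h2
      refine h2.congr fun θ => ?_
      rw [← norm_cubeRootPath_pow hx, ← Real.rpow_natCast, ← Real.rpow_mul (norm_nonneg _)]
      norm_num
    have h2 := (h.isDeveloping.continuousAt (mem_ball_self h.radius_pos)).tendsto.comp h1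
    rwa [h.center] at h2
  have hend := h'.lift_end hω (γ := γ) (fun t ht => (hrad t ht).1) (fun t ht => (hrad t ht).2.1)
    (fun t ht => (hrad t ht).2.2) h0mem hyρ hy hγ0 (s := 1) ⟨by linarith, le_rfl⟩ hlim h.zero
    (hnorm 1 ⟨zero_le_one, le_rfl⟩)
  have hcube : y ^ 3 = x ^ 3 := by
    push_cast at hend
    linear_combination hend
  have hrays : ∀ s ∈ Ioc (0 : ℝ) 1, E (x * s) = E' (y * s) := by
    intro s hs
    have hs3 : 0 < s ^ 3 := pow_pos hs.1 3
    have hs31 : s ^ 3 ≤ 1 := pow_le_one₀ hs.1.le hs.2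
    have h1 := (h'.lift hω (γ := γ) (fun t ht => (hrad t ht).1) (fun t ht => (hrad t ht).2.1)
      (fun t ht => (hrad t ht).2.2) h0mem hyρ hy hγ0 (t := 1 - s ^ 3)
      ⟨by linarith, by linarith⟩ (hnorm _ ⟨by linarith, by linarith⟩)).2
    rw [cubeRootPath_radial hx hcube hs.1] at h1
    simp only [γ] at h1
    rwa [cubeRootPath_radial hx rfl hs.1] at h1
  refine ⟨?_, hrays⟩
  have hlims : ∀ z : ℂ, Tendsto (fun s : ℝ => z * s) (𝓝[>] 0) (𝓝 0) := fun z => by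
    have hc : Continuous (fun s : ℝ => z * s) := by fun_prop
    have := (hc.tendsto 0).mono_left (nhdsWithin_le_nhds (s := Ioi 0))
    simpa using this
  have h1 := (h.isDeveloping.continuousAt (mem_ball_self h.radius_pos)).tendsto.comp (hlims x)
  have h2 := (h'.isDeveloping.continuousAt (mem_ball_self h.radius_pos)).tendsto.comp (hlims y)
  rw [h.center] at h1
  rw [h'.center] at h2
  refine tendsto_nhds_unique h1 (h2.congr' ?_)
  filter_upwards [Ioc_mem_nhdsGT (zero_lt_one' ℝ)] with s hs using (hrays s hs).symm

/-- The disc around a zero is embedded up to half its flat radius: two points with the same image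
have the same radius on the surface, and near the centre the developing map is injective. -/
theorem IsZeroDisc.eq_of_eq_self (hω : ω ∈ holomorphicOneForms X) (h : IsZeroDisc ω p E ρ)
    {x y : ℂ} (hxy : E x = E y) (hρ : ‖x‖ ^ 3 + ‖y‖ ^ 3 < ρ ^ 3) : x = y := by
  have hlt : ∀ z : ℂ, ‖z‖ ^ 3 < ρ ^ 3 → z ∈ ball (0 : ℂ) ρ := fun z hz =>
    mem_ball_zero_iff.2 (lt_of_pow_lt_pow_left₀ 3 h.radius_pos.le hz)
  by_cases hx : x = 0
  · by_contra hne
    have hy : y ≠ 0 := fun hy => hne (hx.trans hy.symm)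
    refine h.ne_zero (hlt y (by rw [hx] at hρ; simpa using hρ)) hy ?_
    rw [← hxy, hx, h.center]; exact h.zero
  by_cases hy : y = 0
  · exfalso
    refine h.ne_zero (hlt x (by rw [hy] at hρ; simpa using hρ)) hx ?_
    rw [hxy, hy, h.center]; exact h.zero
  obtain ⟨-, hrays⟩ := h.eq_of_eq hω h hx hy hxy hρ
  obtain ⟨δ, hδ, hδρ, hinj⟩ := h.exists_injOn
  have hev : ∀ z : ℂ, ∀ᶠ s : ℝ in 𝓝[>] 0, z * s ∈ ball (0 : ℂ) δ := fun z => by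
    have hc : Continuous (fun s : ℝ => z * s) := by fun_prop
    have h := (hc.tendsto 0).mono_left (nhdsWithin_le_nhds (s := Ioi 0))
    rw [Complex.ofReal_zero, mul_zero] at h
    exact h.eventually (ball_mem_nhds (0 : ℂ) hδ)
  obtain ⟨s, ⟨h1, h2⟩, hs⟩ := (((hev x).and (hev y)).and (Ioc_mem_nhdsGT (zero_lt_one' ℝ))).exists
  have h3 := hinj h1 h2 (hrays s hs)
  exact mul_right_cancel₀ (by exact_mod_cast hs.1.ne') h3

end ZeroDisc

/-! ### Saddle connections from radii of discs -/

section ZeroDiscRadius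

variable {X : Type*} [TopologicalSpace X] [ChartedSpace ℂ X] {ω : OneForm X} {γ : ℝ → X} {c : ℂ}

theorem intervalIntegral_congr_Ioo {E : Type*} [NormedAddCommGroup E] [NormedSpace ℝ E]
    {f g : ℝ → E} {a b : ℝ} (hab : a ≤ b) (h : EqOn f g (Ioo a b)) :
    ∫ t in a..b, f t = ∫ t in a..b, g t := by
  rw [intervalIntegral.integral_of_le hab, intervalIntegral.integral_of_le hab,
    integral_Ioc_eq_integral_Ioo, integral_Ioc_eq_integral_Ioo]
  exact setIntegral_congr_fun measurableSet_Ioo h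

theorem flatLength_eq (h : ∀ t ∈ Ioo (0 : ℝ) 1, ω (γ t) (velocity γ t) = c) :
    flatLength ω γ = ‖c‖ := by
  rw [flatLength, intervalIntegral_congr_Ioo zero_le_one (g := fun _ => ‖c‖)
    (fun t ht => by simp only [h t ht])]
  simp

theorem integral_eq_of_velocity (h : ∀ t ∈ Ioo (0 : ℝ) 1, ω (γ t) (velocity γ t) = c) :
    OneForm.integral ω γ = c := by
  rw [OneForm.integral, intervalIntegral_congr_Ioo zero_le_one (g := fun _ => c) h]
  simp

theorem IsDeveloping.straight {F : ℂ → X} {R : ℝ} {b : ℂ} (hF : IsDeveloping ω 0 F (ball 0 R))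
    (hb : ‖b‖ ≤ R) {t : ℝ}
    (ht : t ∈ Ioo (-1 : ℝ) 1) (hb0 : b ≠ 0) :
    MDifferentiableAt 𝓘(ℝ, ℝ) 𝓘(ℝ, ℂ) (fun t : ℝ => F (t * b)) t ∧ ω (F (t * b)) ≠ 0 ∧
      ω (F (t * b)) (velocity (fun t : ℝ => F (t * b)) t) = b := by
  have hmem : (t : ℂ) * b ∈ ball (0 : ℂ) R := by
    rw [mem_ball_zero_iff, norm_mul, Complex.norm_real, Real.norm_eq_abs]
    have : |t| < 1 := abs_lt.2 ht
    nlinarith [norm_pos_iff.2 hb0]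
  have := hF.curve (u := fun t : ℝ => (t : ℂ) * b) hmem (hasDerivAt_ofReal_mul b t)
  refine ⟨this.1, hF.ne_zero hmem (by simp), ?_⟩
  simpa using this.2

/-- A radius of a disc around a double zero that runs into a zero of `ω` is a saddle connection. -/
theorem exists_saddleConnection_of_tendsto {F : ℂ → X} {b : ℂ} {p' : X} (hb : b ≠ 0)
    (hF : IsDeveloping ω 2 F (ball 0 ‖b‖)) (h0 : ω (F 0) = 0) (hp' : ω p' = 0)
    (hlim : Tendsto (fun t : ℝ => F (t * b)) (𝓝[<] 1) (𝓝 p')) :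
    ∃ γ : ℝ → X, IsSaddleConnection ω γ ∧ flatLength ω γ = ‖b‖ ^ 3 := by
  have hbn : 0 < ‖b‖ := norm_pos_iff.2 hb
  let r : ℝ → ℝ := fun t => t ^ (1 / 3 : ℝ)
  have hr3 : ∀ t, 0 ≤ t → r t ^ 3 = t := fun t ht => by
    rw [← Real.rpow_natCast, ← Real.rpow_mul ht]; norm_num
  have hrpos : ∀ t, 0 < t → 0 < r t := fun t ht => Real.rpow_pos_of_pos ht _
  have hr1 : ∀ t, 0 ≤ t → t < 1 → r t < 1 := fun t ht ht1 =>
    Real.rpow_lt_one ht ht1 (by norm_num)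
  have hrc : Continuous r := Real.continuous_rpow_const (by norm_num)
  let u : ℝ → ℂ := fun t => (r t : ℂ) * b
  have huc : Continuous u := by fun_prop
  have hu : ∀ t ∈ Ico (0 : ℝ) 1, u t ∈ ball (0 : ℂ) ‖b‖ := by
    intro t ht
    have h1 : 0 ≤ r t := Real.rpow_nonneg ht.1 _
    rw [mem_ball_zero_iff, norm_mul, Complex.norm_real, Real.norm_of_nonneg h1]
    exact mul_lt_of_lt_one_left hbn (hr1 t ht.1 ht.2)
  have hud : ∀ t ∈ Ioo (0 : ℝ) 1,
      ∃ u', HasDerivAt u u' t ∧ ((2 : ℕ) + 1) * u t ^ 2 * u' = b ^ 3 := by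
    intro t ht
    have h1 : HasDerivAt r (1 / 3 * t ^ (1 / 3 - 1 : ℝ)) t :=
      Real.hasDerivAt_rpow_const (Or.inl ht.1.ne')
    have h2 : HasDerivAt u (((1 / 3 * t ^ (1 / 3 - 1 : ℝ) : ℝ) : ℂ) * b) t :=
      (h1.ofReal_comp).mul_const b
    refine ⟨_, h2, ?_⟩
    have h3 : 3 * r t ^ 2 * (1 / 3 * t ^ (1 / 3 - 1 : ℝ)) = 1 := by
      have h4 : r t ^ 2 = t ^ (2 / 3 : ℝ) := by
        rw [← Real.rpow_natCast, ← Real.rpow_mul ht.1.le]; norm_num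
      have h5 : t ^ (2 / 3 : ℝ) * t ^ (1 / 3 - 1 : ℝ) = 1 := by
        rw [← Real.rpow_add ht.1]; norm_num
      rw [h4]; linear_combination h5
    have h4 : (3 : ℂ) * (r t : ℂ) ^ 2 * ((1 / 3 * t ^ (1 / 3 - 1 : ℝ) : ℝ) : ℂ) = 1 := by
      exact_mod_cast h3
    simp only [u]
    push_cast at h4 ⊢
    linear_combination b ^ 3 * h4
  classical
  let γ : ℝ → X := fun t => if t < 1 then F (u t) else p'
  have hγlt : ∀ t, t < 1 → γ t = F (u t) := fun t ht => if_pos ht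
  have hγev : ∀ t, t < 1 → γ =ᶠ[𝓝 t] fun t => F (u t) := fun t ht => by
    filter_upwards [Iio_mem_nhds ht] with s hs using hγlt s hs
  have hcurve : ∀ t ∈ Ioo (0 : ℝ) 1, MDifferentiableAt 𝓘(ℝ, ℝ) 𝓘(ℝ, ℂ) (fun t => F (u t)) t ∧
      ω (F (u t)) (velocity (fun t => F (u t)) t) = b ^ 3 := by
    intro t ht
    obtain ⟨u', hu', huc⟩ := hud t ht
    have := hF.curve (hu t ⟨ht.1.le, ht.2⟩) hu'
    exact ⟨this.1, this.2.trans huc⟩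
  have hvel : ∀ t ∈ Ioo (0 : ℝ) 1, ω (γ t) (velocity γ t) = b ^ 3 := fun t ht => by
    rw [velocity_congr ω (hγev t ht.2)]; exact (hcurve t ht).2
  refine ⟨γ, ⟨?_, ?_, ?_, ?_, ?_, b ^ 3, pow_ne_zero 3 hb, hvel⟩, ?_⟩
  · intro t ht
    rcases ht.2.lt_or_eq with h1 | rfl
    · have h2 : ContinuousAt (fun t => F (u t)) t :=
        ContinuousAt.comp (f := u) (hF.continuousAt (hu t ⟨ht.1, h1⟩)) huc.continuousAt
      exact (h2.congr (hγev t h1).symm).continuousWithinAt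
    · have hγ1 : γ 1 = p' := if_neg (lt_irrefl _)
      have h2 : Tendsto r (𝓝[<] 1) (𝓝[<] 1) := by
        refine tendsto_nhdsWithin_iff.2 ⟨?_, ?_⟩
        · have := (hrc.tendsto 1).mono_left (nhdsWithin_le_nhds (s := Iio 1))
          simpa [r] using this
        · filter_upwards [Ioo_mem_nhdsLT (zero_lt_one' ℝ)] with s hs using hr1 s hs.1.le hs.2
      have h3 : Tendsto γ (𝓝[<] 1) (𝓝 p') := by
        refine (hlim.comp h2).congr' ?_
        filter_upwards [self_mem_nhdsWithin] with s hs using (hγlt s hs).symm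
      have h4 : ContinuousWithinAt γ (insert 1 (Iio 1)) 1 := by
        rw [continuousWithinAt_insert_self, ContinuousWithinAt, hγ1]; exact h3
      refine h4.mono fun s hs => ?_
      rcases hs.2.lt_or_eq with h | h
      · exact Or.inr h
      · exact Or.inl h
  · rw [hγlt 0 one_pos]
    have : u 0 = 0 := by simp [u, r]
    rw [this, h0]
  · have : γ 1 = p' := if_neg (lt_irrefl _)
    rw [this, hp']
  · intro t ht
    rw [hγlt t ht.2]
    exact hF.ne_zero (hu t ⟨ht.1.le, ht.2⟩)
      (pow_ne_zero 2 (mul_ne_zero (by exact_mod_cast (hrpos t ht.1).ne') hb))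
  · intro t ht
    exact (hcurve t ht).1.congr_of_eventuallyEq (hγev t ht.2)
  · rw [flatLength_eq hvel, norm_pow]

variable [IsManifold 𝓘(ℂ) ⊤ X] [T2Space X] [CompactSpace X]

/-- A disc around a double zero develops up to the length of the shortest saddle connection. -/
theorem exists_isZeroDisc (hω : ω ∈ holomorphicOneForms X) (hfin : ∀ p, OneForm.order ω p ≠ ⊤)
    {p : X} (hp : ω p = 0) (hp2 : OneForm.order ω p = (2 : ℕ)) {ρ : ℝ} (hρ : 0 < ρ)
    (hshort : ∀ γ : ℝ → X, IsSaddleConnection ω γ → ρ ^ 3 ≤ flatLength ω γ) :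
    ∃ E, IsZeroDisc ω p E ρ := by
  obtain ⟨e, he, δ₀, hδ₀, het₀, hpe, hep, hw⟩ := exists_normal_chart hω hp2
  set δ := min δ₀ ρ
  have hδ : 0 < δ := lt_min hδ₀ hρ
  have hP : IsDeveloping ω 2 e.symm (ball 0 δ) :=
    (isDeveloping_chart_symm he het₀ (by simpa using hw)).mono (ball_subset_ball (min_le_left _ _))
  have hs0 : e.symm 0 = p := by rw [← hep, e.left_inv hpe]
  -- shrink the chart to the disc of radius `δ`
  obtain ⟨e', he', hes', het'⟩ : ∃ e' ∈ IsManifold.maximalAtlas 𝓘(ℂ) ⊤ X,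
      (∀ z, e'.symm z = e.symm z) ∧ e'.target = ball 0 δ := by
    have hsub : ball (0 : ℂ) δ ⊆ e.target := by
      rw [het₀]; exact ball_subset_ball (min_le_left _ _)
    obtain ⟨e', he', ht', hs'⟩ := exists_chart_of_injOn (E := e.symm) isOpen_ball
      (fun z hz => (hP z hz).1) (e.symm.injOn.mono hsub)
      (fun z hz => deriv_transition_ne_zero he (IsManifold.chart_mem_maximalAtlas _) (hsub hz)
        (mem_chart_source ℂ (e.symm z)))
    exact ⟨e', he', hs', ht'⟩
  rcases hP.exists_extension hω hfin hδ (R := ρ) with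
    ⟨F, hF, hFP⟩ | ⟨b, hδb, hbR, F, hF, hFP, p', hp', hlim⟩
  · have h0 : (0 : ℂ) ∈ e'.target := by rw [het']; exact mem_ball_self hδ
    have h1 : e'.symm 0 = p := by rw [hes', hs0]
    refine ⟨F, hρ, hF, hp, e', he', δ, hδ, min_le_right _ _, het', ?_, ?_, fun z hz => ?_⟩
    · rw [← h1]; exact e'.map_target h0
    · rw [← h1]; exact e'.right_inv h0
    · rw [hFP hz, hes']
  · have hb : b ≠ 0 := norm_pos_iff.1 (hδ.trans_le hδb)
    have hF0 : ω (F 0) = 0 := by rw [hFP (mem_ball_self hδ), hs0, hp]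
    obtain ⟨γ, hγ, hγl⟩ := exists_saddleConnection_of_tendsto hb hF hF0 hp' hlim
    have h1 := hshort γ hγ
    rw [hγl] at h1
    exact absurd (pow_lt_pow_left₀ hbR (norm_nonneg b) three_ne_zero) (not_lt.2 h1)

end ZeroDiscRadius

/-! ### Embedded flat discs around regular points -/

section Regular

variable {X : Type*} [TopologicalSpace X] [ChartedSpace ℂ X] [IsManifold 𝓘(ℂ) ⊤ X] [T2Space X]
  {ω : OneForm X} {p : X} {E F : ℂ → X} {ρ R : ℝ} {b v : ℂ}

/-- A flat disc whose radius in the direction `b` runs into the zero `p`: its centre lies in the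
disc around `p`, at the position opposite to `b`. -/
theorem IsZeroDisc.exists_of_tendsto (hω : ω ∈ holomorphicOneForms X) (h : IsZeroDisc ω p E ρ)
    (hF : IsDeveloping ω 0 F (ball 0 ‖b‖)) (hb0 : b ≠ 0) (hbρ : ‖b‖ < ρ ^ 3)
    (hlim : Tendsto (fun t : ℝ => F (t * b)) (𝓝[<] 1) (𝓝 p)) :
    ∃ ζ ∈ ball (0 : ℂ) ρ, ζ ^ 3 = -b ∧ E ζ = F 0 := by
  have hst : ∀ t ∈ Ioo (-1 : ℝ) 1, _ := fun t ht => hF.straight le_rfl ht hb0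
  -- a point of the radius close to `p` lies in the disc around `p`
  obtain ⟨κ, hκ, hκρ, hκ3⟩ : ∃ κ > 0, κ ≤ ρ ∧ κ ^ 3 ≤ (ρ ^ 3 - ‖b‖) / 2 := by
    have hpos : 0 < (ρ ^ 3 - ‖b‖) / 2 := by linarith
    refine ⟨min ρ (((ρ ^ 3 - ‖b‖) / 2) ^ (1 / 3 : ℝ)), lt_min h.radius_pos (by positivity),
      min_le_left _ _, ?_⟩
    calc _ ≤ (((ρ ^ 3 - ‖b‖) / 2) ^ (1 / 3 : ℝ)) ^ 3 :=
          pow_le_pow_left₀ (le_min h.radius_pos.le (by positivity)) (min_le_right _ _) 3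
      _ = _ := by rw [← Real.rpow_natCast, ← Real.rpow_mul hpos.le]; norm_num
  have hnb : E '' ball 0 κ ∈ 𝓝 p := by
    rw [← h.map_nhds]; exact image_mem_map (ball_mem_nhds _ hκ)
  obtain ⟨t₁, ⟨ζ, hζκ, hζ⟩, ht₁⟩ :=
    ((hlim.eventually hnb).and (Ioo_mem_nhdsLT (zero_lt_one' ℝ))).exists
  have ht₁' : t₁ ∈ Ioo (-1 : ℝ) 1 := ⟨by linarith [ht₁.1], ht₁.2⟩
  have hζρ : ζ ∈ ball (0 : ℂ) ρ := ball_subset_ball hκρ hζκ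
  have hζ0 : ζ ≠ 0 := by
    rintro rfl
    rw [h.center] at hζ
    exact (hst t₁ ht₁').2.1 (hζ ▸ h.zero)
  have hζ3 : ‖ζ‖ ^ 3 < (ρ ^ 3 - ‖b‖) / 2 :=
    (pow_lt_pow_left₀ (mem_ball_zero_iff.1 hζκ) (norm_nonneg _) three_ne_zero).trans_le hκ3
  have hbound : ∀ s : ℝ, |s| ≤ 1 → ‖ζ ^ 3 + (s : ℂ) * b‖ < ρ ^ 3 := by
    intro s hs
    refine (norm_add_le _ _).trans_lt ?_
    rw [norm_pow, norm_mul, Complex.norm_real, Real.norm_eq_abs]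
    nlinarith [norm_nonneg b]
  have hlim' : Tendsto (fun t : ℝ => F (t * b)) (𝓝[Ioo (-1) 1] 1) (𝓝 p) :=
    hlim.mono_left (nhdsWithin_mono _ fun t ht => ht.2)
  have hend := h.lift_end hω (γ := fun t : ℝ => F (t * b)) (fun t ht => (hst t ht).1)
    (fun t ht => (hst t ht).2.1) (fun t ht => (hst t ht).2.2) ht₁' hζρ hζ0 hζ.symm (s := 1)
    ⟨by norm_num, le_rfl⟩ hlim' h.zero
    (hbound _ (by rw [abs_of_nonneg (by linarith [ht₁.2])]; linarith [ht₁.1]))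
  have hW : ζ ^ 3 + ((0 - t₁ : ℝ) : ℂ) * b = -b := by
    push_cast at hend ⊢
    linear_combination hend
  have hWρ : ‖ζ ^ 3 + ((0 - t₁ : ℝ) : ℂ) * b‖ < ρ ^ 3 := by rw [hW, norm_neg]; exact hbρ
  have h0 := (h.lift hω (γ := fun t : ℝ => F (t * b)) (fun t ht => (hst t ht).1)
    (fun t ht => (hst t ht).2.1) (fun t ht => (hst t ht).2.2) ht₁' hζρ hζ0 hζ.symm (t := 0)
    ⟨by norm_num, one_pos⟩ hWρ).2
  refine ⟨cubeRootPath ζ b t₁ 0, norm_cubeRootPath_lt hζ0 h.radius_pos.le hWρ, ?_, ?_⟩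
  · rw [cubeRootPath_pow hζ0, hW]
  · rw [← h0]; simp

/-- Opposite points of a flat disc are distinct, if its radius `b` runs into a zero of `ω` and has
length less than a third of the flat radius of the disc around this zero. If `F (-v) = F v`, then
the path in the flat disc from the centre to `v`, continued from the same point `-v` back to the
centre, and then along `b` to the zero, lifts to the disc around the zero. There its flat positions
are `-b`, `-b + v`, `-b + 2 v` and `2 v`. As it ends in a zero of `ω`, its end is the centre:
`2 v = 0`.
-/
theorem IsZeroDisc.translation_eq_zero (hω : ω ∈ holomorphicOneForms X) (h : IsZeroDisc ω p E ρ)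
    (hF : IsDeveloping ω 0 F (ball 0 ‖b‖)) (hb0 : b ≠ 0) (hbρ : 3 * ‖b‖ < ρ ^ 3)
    (hlim : Tendsto (fun t : ℝ => F (t * b)) (𝓝[<] 1) (𝓝 p))
    (hv : ‖v‖ < ‖b‖) (hper : F (-v) = F v) : v = 0 := by
  by_contra hv0
  have hbn : 0 < ‖b‖ := norm_pos_iff.2 hb0
  have hvn : 0 < ‖v‖ := norm_pos_iff.2 hv0
  obtain ⟨u₀, hu₀, hu₀3, hu₀F⟩ := h.exists_of_tendsto hω hF hb0 (by linarith) hlim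
  have hcube : ∀ z : ℂ, z ^ 3 ≠ 0 → z ≠ 0 := fun z hz h0 => hz (by rw [h0]; norm_num)
  have hu₀0 : u₀ ≠ 0 := hcube _ (by rw [hu₀3]; exact neg_ne_zero.2 hb0)
  -- the diameter of the disc in the direction `v`
  set k : ℝ := ‖b‖ / ‖v‖ with hk
  have hk1 : 1 < k := (one_lt_div hvn).2 hv
  have hmem : ∀ t ∈ Ioo (-k) k, (t : ℂ) * v ∈ ball (0 : ℂ) ‖b‖ := by
    intro t ht
    rw [mem_ball_zero_iff, norm_mul, Complex.norm_real, Real.norm_eq_abs]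
    exact (lt_div_iff₀ hvn).1 (abs_lt.2 ht)
  have hst : ∀ t ∈ Ioo (-k) k, MDifferentiableAt 𝓘(ℝ, ℝ) 𝓘(ℝ, ℂ) (fun t : ℝ => F (t * v)) t ∧
      ω (F (t * v)) ≠ 0 ∧ ω (F (t * v)) (velocity (fun t : ℝ => F (t * v)) t) = v := by
    intro t ht
    have := hF.curve (u := fun t : ℝ => (t : ℂ) * v) (hmem t ht) (hasDerivAt_ofReal_mul v t)
    exact ⟨this.1, hF.ne_zero (hmem t ht) (by simp), by simpa using this.2⟩
  have hne : ∀ z ∈ ball (0 : ℂ) ρ, ω (E z) ≠ 0 → z ≠ 0 := by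
    rintro z - hz rfl
    rw [h.center] at hz
    exact hz h.zero
  have h1 : ‖u₀ ^ 3 + ((1 - 0 : ℝ) : ℂ) * v‖ < ρ ^ 3 := by
    rw [hu₀3]
    refine (norm_add_le _ _).trans_lt ?_
    simp only [norm_neg, sub_zero, Complex.ofReal_one, one_mul]
    linarith
  have hl1 := (h.lift hω (γ := fun t : ℝ => F (t * v)) (fun t ht => (hst t ht).1)
    (fun t ht => (hst t ht).2.1) (fun t ht => (hst t ht).2.2) (t₀ := 0)
    ⟨by linarith, by linarith⟩ hu₀ hu₀0 (by simp [hu₀F]) (t := 1) ⟨by linarith, hk1⟩ h1).2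
  set u₁ := cubeRootPath u₀ v 0 1
  have hu₁ : u₁ ∈ ball (0 : ℂ) ρ := norm_cubeRootPath_lt hu₀0 h.radius_pos.le h1
  have hu₁3 : u₁ ^ 3 = -b + v := by rw [cubeRootPath_pow hu₀0, hu₀3]; push_cast; ring
  have hu₁0 : u₁ ≠ 0 := hne _ hu₁ (by
    have := (hst 1 ⟨by linarith, hk1⟩).2.1
    rwa [hl1] at this)
  have h2 : ‖u₁ ^ 3 + ((0 - -1 : ℝ) : ℂ) * v‖ < ρ ^ 3 := by
    rw [hu₁3]
    refine (norm_add_le _ _).trans_lt ?_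
    have := norm_add_le (-b) v
    simp only [norm_neg, sub_neg_eq_add, zero_add, Complex.ofReal_one, one_mul] at this ⊢
    linarith
  have hl2 := (h.lift hω (γ := fun t : ℝ => F (t * v)) (fun t ht => (hst t ht).1)
    (fun t ht => (hst t ht).2.1) (fun t ht => (hst t ht).2.2) (t₀ := -1)
    ⟨by linarith, by linarith⟩ hu₁ hu₁0 (by
      rw [← hl1]; simpa using hper) (t := 0) ⟨by linarith, by linarith⟩ h2).2
  set u₂ := cubeRootPath u₁ v (-1) 0
  have hu₂ : u₂ ∈ ball (0 : ℂ) ρ := norm_cubeRootPath_lt hu₁0 h.radius_pos.le h2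
  have hu₂3 : u₂ ^ 3 = -b + 2 * v := by rw [cubeRootPath_pow hu₁0, hu₁3]; push_cast; ring
  have hu₂0 : u₂ ≠ 0 := hne _ hu₂ (by
    have := (hst 0 ⟨by linarith, by linarith⟩).2.1
    rwa [hl2] at this)
  have hst' : ∀ t ∈ Ioo (-1 : ℝ) 1, _ := fun t ht => hF.straight le_rfl ht hb0
  have h3 : u₂ ^ 3 + ((1 - 0 : ℝ) : ℂ) * b = 2 * v := by rw [hu₂3]; push_cast; ring
  have hl3 := h.lift_end hω (γ := fun t : ℝ => F (t * b)) (fun t ht => (hst' t ht).1)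
    (fun t ht => (hst' t ht).2.1) (fun t ht => (hst' t ht).2.2) (t₀ := 0)
    ⟨by norm_num, one_pos⟩ hu₂ hu₂0 (by rw [← hl2]; simp) (s := 1) ⟨by norm_num, le_rfl⟩
    (hlim.mono_left (nhdsWithin_mono _ fun t ht => ht.2)) h.zero (by
      rw [h3, norm_mul, Complex.norm_ofNat]; linarith)
  rw [h3] at hl3
  exact hv0 ((mul_eq_zero.1 hl3).resolve_left two_ne_zero)

variable [CompactSpace X]

/-- If `ω` has zeros, then no point is the centre of flat discs of all radii: such points would form
an open and closed set. -/
theorem exists_tendsto_zero [ConnectedSpace X] (hω : ω ∈ holomorphicOneForms X)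
    (hfin : ∀ p, OneForm.order ω p ≠ ⊤) (hρ : ∀ p, ω p = 0 → ∃ E, IsZeroDisc ω p E ρ)
    (hex : ∃ p, ω p = 0) {P : ℂ → X} {δ : ℝ} (hδ : 0 < δ) (hP : IsDeveloping ω 0 P (ball 0 δ)) :
    ∃ b : ℂ, b ≠ 0 ∧ ∃ F, IsDeveloping ω 0 F (ball 0 ‖b‖) ∧ F 0 = P 0 ∧
      ∃ p, ω p = 0 ∧ Tendsto (fun t : ℝ => F (t * b)) (𝓝[<] 1) (𝓝 p) := by
  by_contra hcon
  let Y : Set X := {y | ∀ R, ∃ F, IsDeveloping ω 0 F (ball 0 R) ∧ F 0 = y}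
  have hYne : P 0 ∈ Y := by
    intro R
    rcases hP.exists_extension hω hfin hδ (R := R) with ⟨F, hF, hFP⟩ | ⟨b, hδb, -, F, hF, hFP, hp⟩
    · exact ⟨F, hF, hFP (mem_ball_self hδ)⟩
    · exact (hcon ⟨b, norm_pos_iff.1 (hδ.trans_le hδb), F, hF, hFP (mem_ball_self hδ), hp⟩).elim
  have hshift : ∀ {F R z}, IsDeveloping ω 0 F (ball 0 R) → F 0 ∈ Y → ‖z‖ < R → F z ∈ Y := by
    intro F R z hF h0 hz R'
    obtain ⟨G, hG, hG0⟩ := h0 (max R (R' + ‖z‖))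
    have hR : 0 < R := (norm_nonneg z).trans_lt hz
    have hGF : G z = F z := IsDeveloping.eqOn_of_convex hω
      (hG.mono (ball_subset_ball (le_max_left _ _))) hF isOpen_ball (convex_ball _ _)
      (fun _ _ => by simp) (mem_ball_self hR) hG0 (mem_ball_zero_iff.2 hz)
    refine ⟨fun w => G (w + z), (hG.comp_add z).mono fun w hw => ?_, by simpa using hGF⟩
    rw [mem_ball_zero_iff] at hw
    rw [mem_ofPred_eq, mem_ball_zero_iff]
    calc ‖w + z‖ ≤ ‖w‖ + ‖z‖ := norm_add_le _ _
      _ < R' + ‖z‖ := by linarith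
      _ ≤ _ := le_max_right _ _
  have hYreg : ∀ y ∈ Y, ω y ≠ 0 := by
    intro y hy
    obtain ⟨F, hF, rfl⟩ := hy 1
    exact hF.ne_zero (mem_ball_self one_pos) (by simp)
  have hYo : IsOpen Y := by
    rw [isOpen_iff_mem_nhds]
    intro y hy
    obtain ⟨F, hF, rfl⟩ := hy 1
    have h1 := map_nhds_of_deriv_ne_zero isOpen_ball (fun z hz => (hF z hz).1)
      (mem_ball_self one_pos) (hF.deriv_ne_zero (mem_ball_self one_pos) (by simp))
    rw [← h1]
    refine mem_of_superset (image_mem_map (ball_mem_nhds (0 : ℂ) one_pos)) ?_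
    rintro _ ⟨z, hz, rfl⟩
    exact hshift hF hy (mem_ball_zero_iff.1 hz)
  have hYc : IsClosed Y := by
    refine isClosed_of_closure_subset fun x hx => ?_
    by_cases hx0 : ω x = 0
    · exfalso
      obtain ⟨E, hE⟩ := hρ x hx0
      have hnb : E '' ball 0 ρ ∈ 𝓝 x := by
        rw [← hE.map_nhds]; exact image_mem_map (ball_mem_nhds _ hE.radius_pos)
      obtain ⟨y, ⟨ζ, hζ, rfl⟩, hyY⟩ := mem_closure_iff_nhds.1 hx _ hnb
      have hζ0 : ζ ≠ 0 := by
        rintro rfl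
        rw [hE.center] at hyY
        exact hYreg _ hyY hx0
      have hc0 : -ζ ^ 3 ≠ 0 := neg_ne_zero.2 (pow_ne_zero 3 hζ0)
      obtain ⟨F, hF, hF0⟩ := hyY (2 * ‖-ζ ^ 3‖)
      have hst : ∀ t ∈ Ioo (-2 : ℝ) 2, MDifferentiableAt 𝓘(ℝ, ℝ) 𝓘(ℝ, ℂ)
          (fun t : ℝ => F (t * -ζ ^ 3)) t ∧ ω (F (t * -ζ ^ 3)) ≠ 0 ∧
          ω (F (t * -ζ ^ 3)) (velocity (fun t : ℝ => F (t * -ζ ^ 3)) t) = -ζ ^ 3 := by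
        intro t ht
        have hmem : (t : ℂ) * -ζ ^ 3 ∈ ball (0 : ℂ) (2 * ‖-ζ ^ 3‖) := by
          rw [mem_ball_zero_iff, norm_mul, Complex.norm_real, Real.norm_eq_abs]
          exact mul_lt_mul_of_pos_right (abs_lt.2 ht) (norm_pos_iff.2 hc0)
        have := hF.curve (u := fun t : ℝ => (t : ℂ) * -ζ ^ 3) hmem (hasDerivAt_ofReal_mul _ t)
        exact ⟨this.1, hF.ne_zero hmem (by simp), by simpa using this.2⟩
      have h1 := (hE.lift hω (γ := fun t : ℝ => F (t * -ζ ^ 3)) (fun t ht => (hst t ht).1)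
        (fun t ht => (hst t ht).2.1) (fun t ht => (hst t ht).2.2) (t₀ := 0)
        ⟨by norm_num, by norm_num⟩ hζ hζ0 (by simpa using hF0) (t := 1)
        ⟨by norm_num, by norm_num⟩ (by simpa using pow_pos hE.radius_pos 3)).1
      rw [neg_div, div_self (pow_ne_zero 3 hζ0)] at h1
      simp at h1
    · obtain ⟨e, he, δ, hδ, het, hpe, hep, hw⟩ := exists_flat_chart hω hx0
      have hdev : IsDeveloping ω 0 e.symm (ball 0 δ) :=
        isDeveloping_chart_symm he het (by simpa using hw)
      obtain ⟨y, hye, hyY⟩ := mem_closure_iff_nhds.1 hx _ (e.open_source.mem_nhds hpe)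
      have hwt : e y ∈ ball (0 : ℂ) δ := by rw [← het]; exact e.map_source hye
      obtain ⟨F, hF, hF0⟩ := hyY (2 * δ)
      have hx' : F (-e y) = x := by
        have h1 := IsDeveloping.eqOn_of_convex hω (n := 0) (E := F)
          (F := fun z => e.symm (z + e y)) (U := ball (-e y) δ)
          (hF.mono fun z hz => by
            rw [mem_ball_zero_iff] at hwt ⊢
            rw [mem_ball, dist_eq_norm, sub_neg_eq_add] at hz
            calc ‖z‖ = ‖z + e y - e y‖ := by ring_nf
              _ ≤ ‖z + e y‖ + ‖e y‖ := norm_sub_le _ _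
              _ < 2 * δ := by linarith)
          ((hdev.comp_add (e y)).mono fun z hz => by
            rw [mem_ofPred_eq, mem_ball_zero_iff]
            rwa [mem_ball, dist_eq_norm, sub_neg_eq_add] at hz)
          isOpen_ball (convex_ball _ _) (fun _ _ => by simp) (z₀ := 0)
          (by rw [mem_ball, dist_eq_norm]; simpa using hwt) (by simp [hF0, e.left_inv hye])
        rw [h1 (mem_ball_self hδ)]
        simp only [neg_add_cancel]
        rw [← hep, e.left_inv hpe]
      rw [← hx']
      refine hshift hF (by rw [hF0]; exact hyY) ?_
      rw [norm_neg]
      linarith [mem_ball_zero_iff.1 hwt]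
  have huniv := IsClopen.eq_univ ⟨hYc, hYo⟩ ⟨_, hYne⟩
  obtain ⟨p, hp⟩ := hex
  exact hYreg p (huniv ▸ mem_univ p) hp

/-- A point at flat distance at least `d` from all zeros is the centre of an embedded flat disc of
radius `d`, provided that `3d` is less than the flat radius of the discs around zeros. -/
theorem exists_flat_disc [ConnectedSpace X] (hω : ω ∈ holomorphicOneForms X)
    (hfin : ∀ p, OneForm.order ω p ≠ ⊤) {E : X → ℂ → X}
    (hE : ∀ p, ω p = 0 → IsZeroDisc ω p (E p) ρ)
    (hex : ∃ p, ω p = 0) {y : X} (hy : ω y ≠ 0) {d : ℝ} (hd : 0 < d) (hdρ : 3 * d < ρ ^ 3)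
    (hfar : ∀ p, ω p = 0 → ∀ ζ ∈ ball (0 : ℂ) ρ, E p ζ = y → d ≤ ‖ζ‖ ^ 3) :
    ∃ F, IsDeveloping ω 0 F (ball 0 d) ∧ F 0 = y ∧ InjOn F (ball 0 d) := by
  obtain ⟨e, he, δ, hδ, het, hpe, hep, hw⟩ := exists_flat_chart hω hy
  have hP : IsDeveloping ω 0 e.symm (ball 0 δ) :=
    isDeveloping_chart_symm he het (by simpa using hw)
  have hP0 : e.symm 0 = y := by rw [← hep, e.left_inv hpe]
  have hlong : ∀ (b : ℂ) (F : ℂ → X), b ≠ 0 → IsDeveloping ω 0 F (ball 0 ‖b‖) → F 0 = y →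
      ∀ p, ω p = 0 → Tendsto (fun t : ℝ => F (t * b)) (𝓝[<] 1) (𝓝 p) → d ≤ ‖b‖ := by
    intro b F hb hF hF0 p hp hlim
    by_contra hlt
    obtain ⟨ζ, hζ, hζ3, hζE⟩ := (hE p hp).exists_of_tendsto hω hF hb (by linarith) hlim
    have := hfar p hp ζ hζ (hζE.trans hF0)
    rw [← norm_pow, hζ3, norm_neg] at this
    exact hlt this
  obtain ⟨b, hb, F, hF, hF0, p, hp, hlim⟩ :=
    exists_tendsto_zero hω hfin (fun p hp => ⟨E p, hE p hp⟩) hex hδ hP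
  rw [hP0] at hF0
  have hdb := hlong b F hb hF hF0 p hp hlim
  have hbn : 0 < ‖b‖ := norm_pos_iff.2 hb
  refine ⟨F, hF.mono (ball_subset_ball hdb), hF0, fun a₁ ha₁ a₂ ha₂ ha => ?_⟩
  -- half of the difference: `F (z + v) = F (z - v)` holds at the midpoint of `a₁` and `a₂`, and so
  -- wherever both sides are defined
  set v : ℂ := (a₁ - a₂) / 2 with hv
  rw [mem_ball_zero_iff] at ha₁ ha₂
  have hvd : ‖v‖ < d := by
    rw [hv, norm_div, Complex.norm_ofNat]
    linarith [norm_sub_le a₁ a₂]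
  -- pass to the disc of radius `d` with centre on the radius that leads to `p`
  set s : ℝ := d / ‖b‖ with hs
  have hs0 : 0 < s := div_pos hd hbn
  have hs1 : s ≤ 1 := (div_le_one hbn).2 hdb
  have hsb : s * ‖b‖ = d := div_mul_cancel₀ _ hbn.ne'
  set z₀ : ℂ := ((1 - s : ℝ) : ℂ) * b with hz₀
  have hz₀n : ‖z₀‖ = ‖b‖ - d := by
    rw [hz₀, norm_mul, Complex.norm_real, Real.norm_of_nonneg (by linarith), ← hsb]; ring
  set b' : ℂ := (s : ℂ) * b with hb'
  have hb'n : ‖b'‖ = d := by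
    rw [hb', norm_mul, Complex.norm_real, Real.norm_of_nonneg hs0.le, hsb]
  have hball : ∀ z : ℂ, ‖z‖ < d → z + z₀ ∈ ball (0 : ℂ) ‖b‖ := by
    intro z hz
    rw [mem_ball_zero_iff]
    linarith [norm_add_le z z₀]
  have hG : IsDeveloping ω 0 (fun z => F (z + z₀)) (ball 0 ‖b'‖) :=
    (hF.comp_add z₀).mono fun z hz => hball z (by rwa [mem_ball_zero_iff, hb'n] at hz)
  have hper : EqOn (fun z => F (z + v)) (fun z => F (z + -v))
      ({z | z + v ∈ ball (0 : ℂ) ‖b‖} ∩ {z | z + -v ∈ ball (0 : ℂ) ‖b‖}) := by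
    have hset : ∀ w : ℂ, {z | z + w ∈ ball (0 : ℂ) ‖b‖} = ball (-w) ‖b‖ := fun w => by
      ext z; simp [dist_eq_norm]
    refine IsDeveloping.eqOn_of_convex hω ((hF.comp_add v).mono inter_subset_left)
      ((hF.comp_add (-v)).mono inter_subset_right) ?_ ?_ (fun _ _ => by simp)
      (z₀ := (a₁ + a₂) / 2) ?_ ?_
    · rw [hset, hset]; exact isOpen_ball.inter isOpen_ball
    · rw [hset, hset]; exact (convex_ball _ _).inter (convex_ball _ _)
    · have e1 : (a₁ + a₂) / 2 + v = a₁ := by rw [hv]; ring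
      have e2 : (a₁ + a₂) / 2 + -v = a₂ := by rw [hv]; ring
      simp only [mem_inter_iff, mem_ofPred_eq, e1, e2, mem_ball_zero_iff]
      exact ⟨by linarith, by linarith⟩
    · have e1 : (a₁ + a₂) / 2 + v = a₁ := by rw [hv]; ring
      have e2 : (a₁ + a₂) / 2 + -v = a₂ := by rw [hv]; ring
      simp only [e1, e2, ha]
  have hv0 : v = 0 := by
    refine (hE p hp).translation_eq_zero hω hG (by rw [← norm_pos_iff, hb'n]; exact hd)
      (by rw [hb'n]; exact hdρ) ?_ (by rw [hb'n]; exact hvd) ?_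
    · have h1 : Tendsto (fun t : ℝ => 1 - s + t * s) (𝓝[<] 1) (𝓝[<] 1) := by
        refine tendsto_nhdsWithin_iff.2 ⟨?_, ?_⟩
        · have hc : Continuous (fun t : ℝ => 1 - s + t * s) := by fun_prop
          have := (hc.tendsto 1).mono_left (nhdsWithin_le_nhds (s := Iio 1))
          simpa using this
        · filter_upwards [self_mem_nhdsWithin] with t ht
          have ht' : t < 1 := ht
          rw [mem_Iio]; nlinarith
      refine (hlim.comp h1).congr fun t => ?_
      simp only [Function.comp, hb', hz₀]
      congr 1
      push_cast; ring
    · have h1 := hper (x := z₀) ⟨by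
        rw [mem_ofPred_eq, add_comm]; exact hball v hvd, by
        rw [mem_ofPred_eq, add_comm]; exact hball (-v) (by rwa [norm_neg])⟩
      simp only at h1 ⊢
      rw [add_comm, ← h1, add_comm]
  have : a₁ - a₂ = 0 := by
    rw [hv] at hv0
    exact (div_eq_zero_iff.1 hv0).resolve_right two_ne_zero
  exact sub_eq_zero.1 this

end Regular

/-! ### Pullbacks of quadratic differentials and one-forms -/

section QuadTensors

variable {X : Type*} [TopologicalSpace X] [ChartedSpace ℂ X]

/-- The coefficient `f` in the expression `E^*q = f(z) dz²` of the pullback of `q` along `E`. -/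
noncomputable def quadPullbackCoeff (q : QuadTensor X) (E : ℂ → X) (z : ℂ) : ℂ :=
  q (E z) (mfderiv 𝓘(ℂ) 𝓘(ℂ) E z (1 : ℂ))

theorem quadPullbackCoeff_congr (q : QuadTensor X) {E F : ℂ → X} {z : ℂ} (h : E =ᶠ[𝓝 z] F) :
    quadPullbackCoeff q E z = quadPullbackCoeff q F z := by
  unfold quadPullbackCoeff
  have h1 := h.mfderiv_eq (I := 𝓘(ℂ)) (I' := 𝓘(ℂ))
  have h2 := h.eq_of_nhds
  clear h
  revert h1
  generalize mfderiv 𝓘(ℂ) 𝓘(ℂ) E z = A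
  generalize mfderiv 𝓘(ℂ) 𝓘(ℂ) F z = B
  revert A B
  rw [h2]
  intro A B h; rw [h]

theorem quadPullbackCoeff_comp (q : QuadTensor X) {E : ℂ → X} {h : ℂ → ℂ} {z : ℂ}
    (hE : MDifferentiableAt 𝓘(ℂ) 𝓘(ℂ) E (h z)) (hh : DifferentiableAt ℂ h z) :
    quadPullbackCoeff q (E ∘ h) z = quadPullbackCoeff q E (h z) * deriv h z ^ 2 := by
  unfold quadPullbackCoeff
  rw [mfderiv_comp z hE hh.mdifferentiableAt, mfderiv_eq_fderiv]
  change q (E (h z)) (mfderiv 𝓘(ℂ) 𝓘(ℂ) E (h z) ((fderiv ℂ h z : ℂ →L[ℂ] ℂ) 1)) = _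
  have : (fderiv ℂ h z : ℂ →L[ℂ] ℂ) 1 = deriv h z • (1 : ℂ) := by simp
  rw [this]
  erw [map_smul, QuadraticMap.map_smul]
  rw [smul_eq_mul, mul_comm, pow_two]

theorem quadCoeff_ne_zero [IsManifold 𝓘(ℂ) ⊤ X] {q : QuadTensor X} {e : OpenPartialHomeomorph X ℂ}
    (he : e ∈ IsManifold.maximalAtlas 𝓘(ℂ) ⊤ X) {x : X} (hx : x ∈ e.source) (hq : q x ≠ 0) :
    QuadTensor.coeff q e (e x) ≠ 0 := by
  have key : ∀ y, y = x → q y ≠ 0 := by rintro y rfl; exact hq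
  have h0 := e.left_inv hx
  intro h
  refine key _ h0 ?_
  have hd := mdifferentiableAt_chart he hx
  have hd' := mdifferentiableAt_chart_symm he (e.map_source hx)
  have hid : e.symm ∘ e =ᶠ[𝓝 x] id := by
    filter_upwards [e.open_source.mem_nhds hx] with w hw using e.left_inv hw
  have h2 := hid.mfderiv_eq (I := 𝓘(ℂ)) (I' := 𝓘(ℂ))
  rw [mfderiv_comp x hd' hd, mfderiv_id] at h2
  refine QuadraticMap.ext fun v => ?_
  have h3 : (mfderiv 𝓘(ℂ) 𝓘(ℂ) e.symm (e x) : ℂ → ℂ) ((mfderiv 𝓘(ℂ) 𝓘(ℂ) e x : ℂ → ℂ) v) = v :=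
    congrArg (fun A : ℂ →L[ℂ] ℂ => A v) h2
  rw [← h3]
  have hl : ∀ (Q : QuadraticForm ℂ ℂ) (L : ℂ →L[ℂ] ℂ) (c : ℂ), Q (L 1) = 0 → Q (L c) = 0 :=
    fun Q L c hL => by
      have : L c = c • L 1 := by rw [← map_smul]; simp
      rw [this, QuadraticMap.map_smul, hL, smul_zero]
  exact hl (q (e.symm (e x))) (mfderiv 𝓘(ℂ) 𝓘(ℂ) e.symm (e x)) _ h

end QuadTensors

theorem pullbackCoeff_pullback {Z : Type*} [TopologicalSpace Z] [ChartedSpace ℂ Z] {τ : Z → Z}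
    (hτ : MDifferentiable 𝓘(ℂ) 𝓘(ℂ) τ) {β : OneForm Z}
    (hβ : OneForm.pullback τ β = -β) {E : ℂ → Z} {z : ℂ}
    (hE : MDifferentiableAt 𝓘(ℂ) 𝓘(ℂ) E z) :
    pullbackCoeff β (τ ∘ E) z = -pullbackCoeff β E z := by
  have h1 := congrArg (fun α : OneForm Z => α (E z) (mfderiv 𝓘(ℂ) 𝓘(ℂ) E z (1 : ℂ))) hβ
  unfold pullbackCoeff
  rw [mfderiv_comp z (hτ _) hE]
  exact h1

/-! ### The canonical double cover near the zeros of `ω` -/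

section DoubleCover

variable {X : Type*} [TopologicalSpace X] [ChartedSpace ℂ X] [IsManifold 𝓘(ℂ) ⊤ X]
  {Z : Type*} [TopologicalSpace Z] [ChartedSpace ℂ Z] [IsManifold 𝓘(ℂ) ⊤ Z]
  {q : QuadTensor X} {ρ : Z → X} {τ : Z → Z} {ω : OneForm Z}

/-- The order of vanishing may be computed in any chart. -/
theorem order_eq_analyticOrderAt_coeff {α : OneForm Z} (hα : α ∈ holomorphicOneForms Z) {p : Z}
    {e : OpenPartialHomeomorph Z ℂ} (he : e ∈ IsManifold.maximalAtlas 𝓘(ℂ) ⊤ Z)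
    (hp : p ∈ e.source) :
    OneForm.order α p = analyticOrderAt (OneForm.coeff α e) (e p) := by
  set e₀ := chartAt ℂ p
  have he₀ : e₀ ∈ IsManifold.maximalAtlas 𝓘(ℂ) ⊤ Z := IsManifold.chart_mem_maximalAtlas _
  have hp₀ : p ∈ e₀.source := mem_chart_source ℂ p
  have hpt := e.map_source hp
  have hpe : e.symm (e p) ∈ e₀.source := by rwa [e.left_inv hp]
  have hφ : AnalyticAt ℂ (e₀ ∘ e.symm) (e p) := analyticAt_chart_comp e.open_target
    (fun z hz => mdifferentiableAt_chart_symm he hz) hpt he₀ hpe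
  have hφ' := deriv_transition_ne_zero he he₀ hpt hpe
  have hφp : (e₀ ∘ e.symm) (e p) = e₀ p := by simp [e.left_inv hp]
  have h1 : OneForm.coeff α e =ᶠ[𝓝 (e p)]
      (OneForm.coeff α e₀ ∘ (e₀ ∘ e.symm)) * deriv (e₀ ∘ e.symm) := by
    filter_upwards [e.open_target.mem_nhds hpt,
      (e.continuousAt_symm hpt).preimage_mem_nhds (e₀.open_source.mem_nhds hpe)] with w hw hw'
    exact pullbackCoeff_eq α (mdifferentiableAt_chart_symm he hw) he₀ hw'
  have ha : AnalyticAt ℂ (OneForm.coeff α e₀) ((e₀ ∘ e.symm) (e p)) := by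
    rw [hφp]
    exact (hα e₀ he₀).analyticAt (e₀.open_target.mem_nhds (e₀.map_source hp₀))
  rw [analyticOrderAt_congr h1, analyticOrderAt_mul (ha.comp hφ) hφ.deriv,
    analyticOrderAt_comp_of_deriv_ne_zero hφ hφ', hφp,
    analyticOrderAt_eq_zero.2 (Or.inr hφ'), add_zero]
  rfl

/-- Near any point the double cover is `w ↦ w ^ m` in suitable charts, and `m ≤ 2` because the
fibres have at most two points. The last clause expresses `ρ^*q = ω²` in these charts. -/
theorem IsCanonicalDoubleCover.exists_chart (h : IsCanonicalDoubleCover q ρ τ ω) (p : Z) :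
    ∃ e ∈ IsManifold.maximalAtlas 𝓘(ℂ) ⊤ Z, ∃ δ > 0, ∃ m : ℕ, (m = 1 ∨ m = 2) ∧
      e.target = ball 0 δ ∧ p ∈ e.source ∧ e p = 0 ∧
      (m = 2 → ∀ w ∈ ball (0 : ℂ) δ, ρ (e.symm (-w)) = ρ (e.symm w)) ∧
      ∀ w ∈ ball (0 : ℂ) δ, OneForm.coeff ω e w ^ 2 =
        QuadTensor.coeff q (chartAt ℂ (ρ p)) (chartAt ℂ (ρ p) (ρ p) + w ^ m) *
          (m * w ^ (m - 1)) ^ 2 := by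
  set e₀ := chartAt ℂ p
  have he₀ : e₀ ∈ IsManifold.maximalAtlas 𝓘(ℂ) ⊤ Z := IsManifold.chart_mem_maximalAtlas _
  have hp₀ : p ∈ e₀.source := mem_chart_source ℂ p
  set e' := chartAt ℂ (ρ p)
  have he' : e' ∈ IsManifold.maximalAtlas 𝓘(ℂ) ⊤ X := IsManifold.chart_mem_maximalAtlas _
  have hp' : ρ p ∈ e'.source := mem_chart_source ℂ (ρ p)
  have hmd : ∀ z ∈ e₀.target, MDifferentiableAt 𝓘(ℂ) 𝓘(ℂ) (ρ ∘ e₀.symm) z := fun z hz =>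
    (h.holomorphic_proj _).comp z (mdifferentiableAt_chart_symm he₀ hz)
  have hpt := e₀.map_source hp₀
  have hρp : (ρ ∘ e₀.symm) (e₀ p) = ρ p := by simp [e₀.left_inv hp₀]
  set f : ℂ → ℂ := e' ∘ (ρ ∘ e₀.symm)
  have hf : AnalyticAt ℂ f (e₀ p) :=
    analyticAt_chart_comp e₀.open_target hmd hpt he' (by rw [hρp]; exact hp')
  have hf0 : f (e₀ p) = e' (ρ p) := congrArg e' hρp
  set N : Set ℂ := e₀.target ∩ (ρ ∘ e₀.symm) ⁻¹' e'.source
  have hN : N ∈ 𝓝 (e₀ p) := inter_mem (e₀.open_target.mem_nhds hpt)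
    ((hmd _ hpt).continuousAt.preimage_mem_nhds (e'.open_source.mem_nhds (by rwa [hρp])))
  -- the cover is not locally constant
  have htop : analyticOrderAt (fun z => f z - f (e₀ p)) (e₀ p) ≠ ⊤ := by
    rw [Ne, analyticOrderAt_eq_top]
    intro hconst
    have hS := inter_mem hN hconst
    refine (infinite_of_mem_nhds _ hS) ((Set.toFinite {e₀ p, e₀ (τ p)}).subset ?_)
    rintro z ⟨⟨hzt, hz'⟩, hz⟩
    have h1 : ρ (e₀.symm z) = ρ p := by
      refine e'.injOn hz' hp' ?_
      rw [← hf0]; exact sub_eq_zero.1 hz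
    rcases (h.fiber p _).1 h1 with h2 | h2
    · left; rw [← h2, e₀.right_inv hzt]
    · right; rw [mem_singleton_iff, ← h2, e₀.right_inv hzt]
  obtain ⟨m, hm⟩ := ENat.ne_top_iff_exists.1 htop
  have hm0 : m ≠ 0 := by
    rintro rfl
    have := hm.symm
    rw [Nat.cast_zero, analyticOrderAt_eq_zero] at this
    rcases this with h1 | h1
    · exact h1 (hf.sub analyticAt_const)
    · exact h1 (sub_self _)
  obtain ⟨e, he, δ, hδ, het, hpe, hep, hw⟩ := exists_power_chart he₀ hp₀ hm0 hf hm.symm hN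
  have hwt : ∀ w ∈ ball (0 : ℂ) δ, w ∈ e.target := fun w hw => by rwa [het]
  have hsrc : ∀ w ∈ ball (0 : ℂ) δ, ρ (e.symm w) ∈ e'.source := fun w hwδ => by
    have := (hw w hwδ).2.1.2
    simpa [e₀.left_inv (hw w hwδ).1] using this
  have hpow : ∀ w ∈ ball (0 : ℂ) δ, e' (ρ (e.symm w)) = e' (ρ p) + w ^ m := fun w hwδ => by
    have := (hw w hwδ).2.2
    rw [hf0] at this
    simpa [f, e₀.left_inv (hw w hwδ).1] using this
  have hsame : ∀ w ∈ ball (0 : ℂ) δ, ∀ v ∈ ball (0 : ℂ) δ, v ^ m = w ^ m →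
      ρ (e.symm v) = ρ (e.symm w) := fun w hwδ v hvδ hvw =>
    e'.injOn (hsrc v hvδ) (hsrc w hwδ) (by rw [hpow v hvδ, hpow w hwδ, hvw])
  have hm2 : m = 1 ∨ m = 2 := by
    by_contra! hcon
    have hm3 : 2 < m := by omega
    have hζ := Complex.isPrimitiveRoot_exp m hm0
    set ζ := Complex.exp (2 * Real.pi * Complex.I / m)
    have hζn : ‖ζ‖ = 1 := hζ.norm'_eq_one hm0
    have hζ1 : ζ ≠ 1 := hζ.ne_one (by omega)
    have hζ2 : ζ ^ 2 ≠ 1 := hζ.pow_ne_one_of_pos_of_lt (by norm_num) hm3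
    have hζm : ζ ^ m = 1 := hζ.pow_eq_one
    set w : ℂ := ((δ / 2 : ℝ) : ℂ)
    have hw0 : w ≠ 0 := by simp only [w]; exact_mod_cast (half_pos hδ).ne'
    have hwn : ‖w‖ < δ := by
      rw [Complex.norm_real, Real.norm_of_nonneg (by linarith)]; linarith
    have m0 : w ∈ ball (0 : ℂ) δ := mem_ball_zero_iff.2 hwn
    have m1 : w * ζ ∈ ball (0 : ℂ) δ := by rw [mem_ball_zero_iff, norm_mul, hζn, mul_one]; exact hwn
    have m2 : w * ζ ^ 2 ∈ ball (0 : ℂ) δ := by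
      rw [mem_ball_zero_iff, norm_mul, norm_pow, hζn, one_pow, mul_one]; exact hwn
    have hinj : ∀ v ∈ ball (0 : ℂ) δ, ∀ v' ∈ ball (0 : ℂ) δ, e.symm v = e.symm v' → v = v' :=
      fun v hv v' hv' => e.symm.injOn (hwt v hv) (hwt v' hv')
    have e1 := (h.fiber _ _).1 (hsame w m0 _ m1 (by rw [mul_pow, hζm, mul_one]))
    have e2 := (h.fiber _ _).1 (hsame w m0 _ m2 (by
      rw [mul_pow, ← pow_mul, mul_comm 2 m, pow_mul, hζm, one_pow, mul_one]))
    rcases e1 with e1 | e1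
    · have := hinj _ m1 _ m0 e1
      exact hζ1 (mul_left_cancel₀ hw0 (by rw [this, mul_one]))
    · rcases e2 with e2 | e2
      · have := hinj _ m2 _ m0 e2
        exact hζ2 (mul_left_cancel₀ hw0 (by rw [this, mul_one]))
      · have h1 := hinj _ m2 _ m1 (e2.trans e1.symm)
        have h2 := mul_left_cancel₀ hw0 h1
        rw [pow_two] at h2
        exact hζ1 (mul_left_cancel₀ (norm_pos_iff.1 (by rw [hζn]; exact one_pos))
          (by rw [h2, mul_one]))
  refine ⟨e, he, δ, hδ, m, hm2, het, hpe, hep, ?_, fun w hwδ => ?_⟩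
  · rintro rfl w hwδ
    exact hsame w hwδ (-w) (by simpa using hwδ) (by ring)
  · have hd := mdifferentiableAt_chart_symm he (hwt w hwδ)
    have h1 : OneForm.coeff ω e w ^ 2 = quadPullbackCoeff q (ρ ∘ e.symm) w := by
      have h2 := h.square (e.symm w) (coordVector e w)
      rw [quadPullbackCoeff, mfderiv_comp w (h.holomorphic_proj _) hd]
      exact h2.symm
    set g : ℂ → ℂ := fun w => e' (ρ p) + w ^ m
    have hg : HasDerivAt g (m * w ^ (m - 1)) w := (hasDerivAt_pow m w).const_add _
    have h2 : ρ ∘ e.symm =ᶠ[𝓝 w] e'.symm ∘ g := by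
      filter_upwards [isOpen_ball.mem_nhds hwδ] with v hv
      simp only [Function.comp, g]
      rw [← hpow v hv, e'.left_inv (hsrc v hv)]
    have hgt : g w ∈ e'.target := by
      simp only [g]; rw [← hpow w hwδ]; exact e'.map_source (hsrc w hwδ)
    rw [h1, quadPullbackCoeff_congr q h2, quadPullbackCoeff_comp q
      (mdifferentiableAt_chart_symm he' hgt) hg.differentiableAt, hg.deriv]
    rfl

variable [T2Space Z]

/-- The zeros of `ω` are double, and they are fixed by the involution. -/
theorem IsCanonicalDoubleCover.order_eq_two (hq : q.IsPrincipal)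
    (h : IsCanonicalDoubleCover q ρ τ ω) {p : Z} (hp : ω p = 0) :
    OneForm.order ω p = (2 : ℕ) ∧ τ p = p := by
  obtain ⟨e, he, δ, hδ, m, hm, het, hpe, hep, hfib, hw⟩ := h.exists_chart p
  set e' := chartAt ℂ (ρ p)
  have he' : e' ∈ IsManifold.maximalAtlas 𝓘(ℂ) ⊤ X := IsManifold.chart_mem_maximalAtlas _
  have hp' : ρ p ∈ e'.source := mem_chart_source ℂ (ρ p)
  have hQ : AnalyticAt ℂ (QuadTensor.coeff q e') (e' (ρ p)) :=
    (hq.isHolomorphic e' he').analyticAt (e'.open_target.mem_nhds (e'.map_source hp'))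
  have hc0 : OneForm.coeff ω e 0 = 0 := by
    have := (eq_zero_of_chart_coeff he hpe).1 hp
    rwa [hep] at this
  have h0t : (0 : ℂ) ∈ e.target := by rw [het]; exact mem_ball_self hδ
  have hs0 : e.symm 0 = p := by rw [← hep, e.left_inv hpe]
  have hca : AnalyticAt ℂ (OneForm.coeff ω e) 0 :=
    (h.abelian e he).analyticAt (e.open_target.mem_nhds h0t)
  by_cases hqp : q (ρ p) = 0
  · have hord : analyticOrderAt (QuadTensor.coeff q e') (e' (ρ p)) = (1 : ℕ) := hq.simple _ hqp
    refine ⟨?_, (h.ramified p).2 ⟨0, by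
      have h1 : QuadTensor.order q (ρ p) = (1 : ℕ) := hord
      rw [h1]; norm_num⟩⟩
    obtain ⟨g, hg, hg0, hgq⟩ := (hQ.analyticOrderAt_eq_natCast).1 hord
    have hcont : Tendsto (fun w : ℂ => e' (ρ p) + w ^ m) (𝓝 0) (𝓝 (e' (ρ p))) := by
      have hc : Continuous (fun w : ℂ => e' (ρ p) + w ^ m) := by fun_prop
      have := hc.tendsto 0
      rcases hm with rfl | rfl <;> simpa using this
    have hgc : AnalyticAt ℂ (fun w : ℂ => g (e' (ρ p) + w ^ m)) 0 := by
      refine AnalyticAt.fun_comp (g := g) (f := fun w : ℂ => e' (ρ p) + w ^ m) ?_ (by fun_prop)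
      rcases hm with rfl | rfl <;> simpa using hg
    have hev : ∀ᶠ w in 𝓝 (0 : ℂ), (OneForm.coeff ω e ^ 2) w =
        w ^ (m + 2 * (m - 1)) • (g (e' (ρ p) + w ^ m) * (m : ℂ) ^ 2) := by
      filter_upwards [ball_mem_nhds (0 : ℂ) hδ, hcont.eventually hgq] with w hwδ hwg
      rw [Pi.pow_apply, hw w hwδ, hwg, add_sub_cancel_left, pow_one, pow_add, pow_mul]
      simp only [smul_eq_mul]
      ring
    have hm0 : (m : ℂ) ≠ 0 := by rcases hm with rfl | rfl <;> norm_num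
    have hord2 : analyticOrderAt (OneForm.coeff ω e ^ 2) 0 = (m + 2 * (m - 1) : ℕ) := by
      refine ((hca.pow 2).analyticOrderAt_eq_natCast).2
        ⟨fun w => g (e' (ρ p) + w ^ m) * (m : ℂ) ^ 2,
        hgc.mul analyticAt_const, ?_, ?_⟩
      · refine mul_ne_zero ?_ (pow_ne_zero 2 hm0)
        rcases hm with rfl | rfl <;> simpa using hg0
      · filter_upwards [hev] with w hw
        rw [hw, sub_zero]
    rw [analyticOrderAt_pow hca] at hord2
    rw [order_eq_analyticOrderAt_coeff h.abelian he hpe, hep]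
    have htop : analyticOrderAt (OneForm.coeff ω e) 0 ≠ ⊤ := by
      intro h1
      rw [h1] at hord2
      rw [two_nsmul, top_add] at hord2
      exact ENat.natCast_ne_top _ hord2.symm
    obtain ⟨n, hn⟩ := ENat.ne_top_iff_exists.1 htop
    rw [← hn] at hord2 ⊢
    have h3 : 2 * n = m + 2 * (m - 1) := by
      rw [two_nsmul] at hord2
      have : n + n = m + 2 * (m - 1) := by exact_mod_cast hord2
      omega
    rcases hm with rfl | rfl
    · omega
    · have : n = 2 := by omega
      rw [this]
  · exfalso
    have hQ0 := quadCoeff_ne_zero he' hp' hqp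
    have hτ : τ p ≠ p := by
      intro hτ
      obtain ⟨k, hk⟩ := (h.ramified p).1 hτ
      have h1 : QuadTensor.order q (ρ p) = 0 := analyticOrderAt_eq_zero.2 (Or.inr hQ0)
      rw [h1] at hk
      have : (0 : ℕ) = 2 * k + 1 := by exact_mod_cast hk
      omega
    have h2 := hw 0 (mem_ball_self hδ)
    rcases hm with rfl | rfl
    · rw [hc0] at h2
      simp only [pow_one, add_zero] at h2
      norm_num at h2
      exact hQ0 h2.symm
    · -- the points `w` and `-w` are exchanged by `τ`, so that `τ` fixes `p`
      have hev : ∀ᶠ w in 𝓝[≠] (0 : ℂ), τ (e.symm w) = e.symm (-w) := by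
        rw [eventually_nhdsWithin_iff]
        filter_upwards [ball_mem_nhds (0 : ℂ) hδ] with w hwδ hw0
        rcases (h.fiber _ _).1 (hfib rfl w hwδ) with h3 | h3
        · have h4 : -w = w := e.symm.injOn (by simpa [het] using hwδ) (by simpa [het] using hwδ) h3
          exact (hw0 (self_eq_neg.1 h4.symm)).elim
        · exact h3.symm
      have hc := e.continuousAt_symm h0t
      have hcτ : ContinuousAt τ (e.symm 0) := (h.holomorphic_invol _).continuousAt
      have l1 : Tendsto (fun w => τ (e.symm w)) (𝓝[≠] 0) (𝓝 (τ p)) := by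
        have := (hcτ.tendsto.comp hc.tendsto).mono_left (nhdsWithin_le_nhds (s := {0}ᶜ))
        rwa [hs0] at this
      have l2 : Tendsto (fun w : ℂ => e.symm (-w)) (𝓝[≠] 0) (𝓝 p) := by
        have hn : Tendsto (fun w : ℂ => -w) (𝓝 0) (𝓝 0) := by
          simpa using (continuous_neg (G := ℂ)).tendsto 0
        have := (hc.tendsto.comp hn).mono_left (nhdsWithin_le_nhds (s := {0}ᶜ))
        rwa [hs0] at this
      exact hτ (tendsto_nhds_unique l1
        (l2.congr' (by filter_upwards [hev] with w hw using hw.symm)))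

theorem IsCanonicalDoubleCover.order_ne_top (hq : q.IsPrincipal)
    (h : IsCanonicalDoubleCover q ρ τ ω) (p : Z) : OneForm.order ω p ≠ ⊤ := by
  by_cases hp : ω p = 0
  · rw [(h.order_eq_two hq hp).1]; exact ENat.natCast_ne_top 2
  · rw [order_eq_zero_of_ne_zero hp]; exact ENat.natCast_ne_top 0

/-- In the coordinate `ζ` around a zero of `ω` in which `ω = d(ζ ^ 3)`, the involution is `ζ ↦ -ζ`:
its cube is `-ζ ^ 3`, and it is an involution. -/
theorem IsCanonicalDoubleCover.involution_eq_neg (hq : q.IsPrincipal)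
    (h : IsCanonicalDoubleCover q ρ τ ω) {p : Z} {E : ℂ → Z} {R : ℝ} (hE : IsZeroDisc ω p E R) :
    ∀ᶠ w in 𝓝 (0 : ℂ), τ (E w) = E (-w) := by
  obtain ⟨e, he, δ, hδ, hδR, het, hpe, hep, hEe⟩ := hE.exists_chart
  have hτp := (h.order_eq_two hq hE.zero).2
  have hEmd : ∀ w ∈ ball (0 : ℂ) R, MDifferentiableAt 𝓘(ℂ) 𝓘(ℂ) E w := fun w hw =>
    (hE.isDeveloping w hw).1
  have hτE : ∀ w ∈ ball (0 : ℂ) R, MDifferentiableAt 𝓘(ℂ) 𝓘(ℂ) (τ ∘ E) w := fun w hw =>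
    (h.holomorphic_invol _).comp w (hEmd w hw)
  have h0R := mem_ball_self (x := (0 : ℂ)) hE.radius_pos
  have hτE0 : (τ ∘ E) 0 = p := by simp [hE.center, hτp]
  set σ : ℂ → ℂ := e ∘ (τ ∘ E)
  have hσ0 : σ 0 = 0 := by simp only [σ, Function.comp_apply] at hτE0 ⊢; rw [hτE0, hep]
  have hσa : AnalyticAt ℂ σ 0 :=
    analyticAt_chart_comp isOpen_ball hτE h0R he (by rw [hτE0]; exact hpe)
  have hσc : Tendsto σ (𝓝 0) (𝓝 0) := by simpa [hσ0] using hσa.continuousAt.tendsto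
  have hsrc : ∀ᶠ w in 𝓝 (0 : ℂ), (τ ∘ E) w ∈ e.source :=
    (hτE 0 h0R).continuousAt.preimage_mem_nhds (e.open_source.mem_nhds (by rw [hτE0]; exact hpe))
  have hball : ∀ᶠ w in 𝓝 (0 : ℂ), w ∈ ball (0 : ℂ) δ := ball_mem_nhds 0 hδ
  have hEσ : ∀ᶠ w in 𝓝 (0 : ℂ), τ (E w) = E (σ w) := by
    filter_upwards [hsrc] with w hw
    have h1 : σ w ∈ ball (0 : ℂ) δ := by rw [← het]; exact e.map_source hw
    rw [hEe h1]; exact (e.left_inv hw).symm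
  -- `σ ^ 3 = -ζ ^ 3`
  have hder : ∀ᶠ w in 𝓝 (0 : ℂ), 3 * σ w ^ 2 * deriv σ w = -(3 * w ^ 2) := by
    filter_upwards [hEσ.eventually_nhds, hσa.eventually_analyticAt, hball, hσc.eventually hball]
      with w hw hwa hwδ hσδ
    have hwR := ball_subset_ball hδR hwδ
    have hσR := ball_subset_ball hδR hσδ
    have h1 := pullbackCoeff_pullback h.holomorphic_invol h.anti (hEmd w hwR)
    have h2 : τ ∘ E =ᶠ[𝓝 w] E ∘ σ := hw
    rw [pullbackCoeff_congr ω h2, pullbackCoeff_comp ω (hEmd _ hσR) hwa.differentiableAt,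
      (hE.isDeveloping _ hσR).2, (hE.isDeveloping _ hwR).2] at h1
    push_cast at h1
    linear_combination h1
  have hcube : ∀ᶠ w in 𝓝 (0 : ℂ), σ w ^ 3 = -w ^ 3 := by
    obtain ⟨ε, hε, hε'⟩ := Metric.eventually_nhds_iff_ball.1 (hder.and hσa.eventually_analyticAt)
    have hd : ∀ w ∈ ball (0 : ℂ) ε, HasDerivAt (fun w => σ w ^ 3 + w ^ 3) 0 w := by
      intro w hw
      have h1 := ((hε' w hw).2.differentiableAt.hasDerivAt.pow 3).add (hasDerivAt_pow 3 w)
      refine h1.congr_deriv ?_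
      have := (hε' w hw).1
      norm_num
      linear_combination this
    filter_upwards [ball_mem_nhds (0 : ℂ) hε] with w hw
    have h1 := isOpen_ball.is_const_of_deriv_eq_zero (convex_ball (0 : ℂ) ε).isPreconnected
      (fun s hs => (hd s hs).differentiableAt.differentiableWithinAt)
      (fun s hs => (hd s hs).deriv) hw (mem_ball_self hε)
    simp only [hσ0] at h1
    linear_combination h1
  have hinv : ∀ᶠ w in 𝓝 (0 : ℂ), σ (σ w) = w := by
    filter_upwards [hEσ, hball] with w hw hwδ
    have hwt : w ∈ e.target := by rwa [het]
    change e (τ (E (σ w))) = w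
    rw [← hw, h.involutive, hEe hwδ, e.right_inv hwt]
  set s := deriv σ 0
  have hs2 : s * s = 1 := by
    have hσd : HasDerivAt σ s (σ 0) := by rw [hσ0]; exact hσa.differentiableAt.hasDerivAt
    have h1 := hσd.comp 0 hσa.differentiableAt.hasDerivAt
    exact (h1.congr_of_eventuallyEq (f₁ := id)
      (by filter_upwards [hinv] with w hw using hw.symm)).unique
      (hasDerivAt_id 0)
  have hlim : Tendsto (fun w => σ w / w) (𝓝[≠] 0) (𝓝 s) := by
    have h1 := hasDerivAt_iff_tendsto_slope.1 hσa.differentiableAt.hasDerivAt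
    refine h1.congr fun w => ?_
    rw [slope_def_field, hσ0, sub_zero, sub_zero]
  have hcube' : ∀ᶠ w in 𝓝[≠] (0 : ℂ), (σ w / w) ^ 3 = -1 := by
    filter_upwards [hcube.filter_mono nhdsWithin_le_nhds, self_mem_nhdsWithin] with w hw hw0
    have : w ≠ 0 := hw0
    rw [div_pow, hw]; field_simp
  have hs3 : s ^ 3 = -1 := tendsto_nhds_unique (hlim.pow 3)
    (tendsto_const_nhds.congr' (by filter_upwards [hcube'] with w hw using hw.symm))
  have hs : s = -1 := by linear_combination hs3 - s * hs2
  -- `-1` is an isolated cube root of `-1`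
  have hquad : ∀ᶠ w in 𝓝[≠] (0 : ℂ), (σ w / w) ^ 2 - σ w / w + 1 ≠ 0 := by
    have h1 : Tendsto (fun w => (σ w / w) ^ 2 - σ w / w + 1) (𝓝[≠] 0) (𝓝 (s ^ 2 - s + 1)) :=
      ((hlim.pow 2).sub hlim).add_const 1
    refine h1.eventually_ne ?_
    rw [hs]; norm_num
  have hneg : ∀ᶠ w in 𝓝[≠] (0 : ℂ), σ w = -w := by
    filter_upwards [hcube', hquad, self_mem_nhdsWithin] with w h1 h2 hw0
    have hw0 : w ≠ 0 := hw0
    have h3 : (σ w / w + 1) * ((σ w / w) ^ 2 - σ w / w + 1) = 0 := by linear_combination h1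
    have h4 := (mul_eq_zero.1 h3).resolve_right h2
    field_simp at h4
    linear_combination h4
  have hneg' : ∀ᶠ w in 𝓝 (0 : ℂ), σ w = -w := by
    rw [eventually_nhdsWithin_iff] at hneg
    filter_upwards [hneg] with w hw
    by_cases hw0 : w = 0
    · rw [hw0, hσ0, neg_zero]
    · exact hw hw0
  filter_upwards [hEσ, hneg'] with w h1 h2
  rw [h1, h2]

/-- Anti-invariant forms are even in the coordinate around a zero of `ω`. -/
theorem IsCanonicalDoubleCover.pullbackCoeff_even (hq : q.IsPrincipal)
    (h : IsCanonicalDoubleCover q ρ τ ω) {p : Z} {E : ℂ → Z} {R : ℝ} (hE : IsZeroDisc ω p E R)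
    {β : OneForm Z} (hβ : OneForm.pullback τ β = -β) :
    ∀ᶠ w in 𝓝 (0 : ℂ), pullbackCoeff β E (-w) = pullbackCoeff β E w := by
  filter_upwards [(h.involution_eq_neg hq hE).eventually_nhds, ball_mem_nhds 0 hE.radius_pos]
    with w hw hwR
  have hwR' : -w ∈ ball (0 : ℂ) R := by simpa using hwR
  have h1 := pullbackCoeff_pullback h.holomorphic_invol hβ (hE.isDeveloping w hwR).1
  have h2 : τ ∘ E =ᶠ[𝓝 w] E ∘ fun w => -w := hw
  have hd : HasDerivAt (fun w : ℂ => -w) (-1) w := (hasDerivAt_id w).neg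
  rw [pullbackCoeff_congr β h2, pullbackCoeff_comp β (h := fun w : ℂ => -w)
    (hE.isDeveloping _ hwR').1 hd.differentiableAt, hd.deriv] at h1
  linear_combination -h1

end DoubleCover

/-! ### The area measure and the Hodge norm in parametrizations -/

section Area

theorem det_restrictScalars_fderiv (f : ℂ → ℂ) (z : ℂ) :
    |((fderiv ℂ f z).restrictScalars ℝ : ℂ →L[ℝ] ℂ).det| = ‖deriv f z‖ ^ 2 := by
  have h1 : ((fderiv ℂ f z).restrictScalars ℝ : ℂ →L[ℝ] ℂ).det = Complex.normSq (deriv f z) := by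
    have h2 := LinearMap.det_restrictScalars (R := ℝ) (S := ℂ) (A := ℂ)
      (f := (fderiv ℂ f z : ℂ →ₗ[ℂ] ℂ))
    rw [LinearMap.det_ring, Algebra.norm_complex_eq] at h2
    exact h2
  rw [h1, Complex.normSq_eq_norm_sq, abs_of_nonneg (by positivity)]

theorem measurableSet_chart_preimage {Z : Type*} [TopologicalSpace Z] [MeasurableSpace Z]
    [BorelSpace Z]
    (e : OpenPartialHomeomorph Z ℂ) {B : Set Z}
    (hB : MeasurableSet B) : MeasurableSet (e.symm ⁻¹' B ∩ e.target) := by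
  have h1 := e.open_target.measurableSet.subtype_image
    (e.continuousOn_symm.domRestrict.measurable hB)
  convert h1 using 1
  ext z
  simp [and_comm]

variable {Z : Type*} [TopologicalSpace Z] [ChartedSpace ℂ Z] [MeasurableSpace Z]

/-- The part of the measure `|β|²` that is seen by the chart `e`. -/
noncomputable def chartMeasure (β : OneForm Z) (e : OpenPartialHomeomorph Z ℂ) : Measure Z :=
  ((volume.restrict e.target).withDensity fun z => ‖OneForm.coeff β e z‖ₑ ^ 2).map e.symm

theorem chartMeasure_le_areaMeasure (β : OneForm Z) {e : OpenPartialHomeomorph Z ℂ}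
    (he : e ∈ IsManifold.maximalAtlas 𝓘(ℂ) ⊤ Z) : chartMeasure β e ≤ OneForm.areaMeasure β :=
  le_iSup₂ (f := fun e (_ : e ∈ IsManifold.maximalAtlas 𝓘(ℂ) ⊤ Z) => chartMeasure β e) e he

variable [BorelSpace Z]

theorem chartMeasure_apply (β : OneForm Z) (e : OpenPartialHomeomorph Z ℂ) {B : Set Z}
    (hB : MeasurableSet B) :
    chartMeasure β e B = ∫⁻ z in e.symm ⁻¹' B ∩ e.target, ‖OneForm.coeff β e z‖ₑ ^ 2 := by
  have h1 : AEMeasurable e.symm (volume.restrict e.target) :=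
    e.continuousOn_symm.aemeasurable e.open_target.measurableSet
  rw [chartMeasure, Measure.map_apply_of_aemeasurable
    (h1.mono_ac (withDensity_absolutelyContinuous _ _)) hB, withDensity_apply',
    Measure.restrict_restrict' e.open_target.measurableSet]

variable [IsManifold 𝓘(ℂ) ⊤ Z]

/-- The measure seen by one chart is at most that seen by another one inside the domain of the
latter (by symmetry, they agree where both charts are defined). -/
theorem chartMeasure_le (β : OneForm Z) {e e' : OpenPartialHomeomorph Z ℂ}
    (he : e ∈ IsManifold.maximalAtlas 𝓘(ℂ) ⊤ Z) (he' : e' ∈ IsManifold.maximalAtlas 𝓘(ℂ) ⊤ Z)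
    {B : Set Z} (hB : MeasurableSet B) (hBe : B ⊆ e'.source) :
    chartMeasure β e B ≤ chartMeasure β e' B := by
  rw [chartMeasure_apply β e hB, chartMeasure_apply β e' hB]
  set S := e.symm ⁻¹' B ∩ e.target
  have hS : MeasurableSet S := measurableSet_chart_preimage e hB
  have hd : ∀ z ∈ S, DifferentiableAt ℂ (e' ∘ e.symm) z := fun z hz =>
    differentiableAt_chart_comp (mdifferentiableAt_chart_symm he hz.2) he' (hBe hz.1)
  have hinj : InjOn (e' ∘ e.symm) S := fun z hz w hw hzw =>
    e.symm.injOn hz.2 hw.2 (e'.injOn (hBe hz.1) (hBe hw.1) hzw)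
  have hsub : (e' ∘ e.symm) '' S ⊆ e'.symm ⁻¹' B ∩ e'.target := by
    rintro _ ⟨z, hz, rfl⟩
    refine ⟨?_, e'.map_source (hBe hz.1)⟩
    simp only [mem_preimage, Function.comp, e'.left_inv (hBe hz.1)]
    exact hz.1
  have h1 := lintegral_image_eq_lintegral_abs_det_fderiv_mul volume hS
    (fun z hz => ((hd z hz).hasFDerivAt.restrictScalars ℝ).hasFDerivWithinAt) hinj
    (fun w => ‖OneForm.coeff β e' w‖ₑ ^ 2)
  calc ∫⁻ z in S, ‖OneForm.coeff β e z‖ₑ ^ 2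
      = ∫⁻ w in (e' ∘ e.symm) '' S, ‖OneForm.coeff β e' w‖ₑ ^ 2 := by
        rw [h1]
        refine setLIntegral_congr_fun hS fun z hz => ?_
        have h2 : OneForm.coeff β e z = _ :=
          pullbackCoeff_eq β (mdifferentiableAt_chart_symm he hz.2) he' (hBe hz.1)
        rw [det_restrictScalars_fderiv, h2, enorm_mul, mul_pow, mul_comm,
          ENNReal.ofReal_pow (norm_nonneg _), ofReal_norm]
        rfl
    _ ≤ _ := lintegral_mono_set hsub

theorem exists_open_chartMeasure_lt_top {β : OneForm Z} (hβ : β ∈ holomorphicOneForms Z) (p : Z) :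
    ∃ V : Set Z, IsOpen V ∧ p ∈ V ∧ V ⊆ (chartAt ℂ p).source ∧
      chartMeasure β (chartAt ℂ p) V < ∞ := by
  set e := chartAt ℂ p
  have he : e ∈ IsManifold.maximalAtlas 𝓘(ℂ) ⊤ Z := IsManifold.chart_mem_maximalAtlas _
  have hp : p ∈ e.source := mem_chart_source ℂ p
  obtain ⟨s, hs, hsub⟩ := Metric.nhds_basis_closedBall.mem_iff.1
    (e.open_target.mem_nhds (e.map_source hp))
  refine ⟨e.source ∩ e ⁻¹' ball (e p) s, e.isOpen_inter_preimage isOpen_ball,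
    ⟨hp, mem_ball_self hs⟩, inter_subset_left, ?_⟩
  obtain ⟨C, hC⟩ := (isCompact_closedBall (e p) s).exists_bound_of_continuousOn
    ((hβ e he).continuousOn.mono hsub)
  rw [chartMeasure_apply β e (e.isOpen_inter_preimage isOpen_ball).measurableSet]
  have hsub' : e.symm ⁻¹' (e.source ∩ e ⁻¹' ball (e p) s) ∩ e.target ⊆ closedBall (e p) s := by
    rintro z ⟨⟨-, hz⟩, hzt⟩
    rw [mem_preimage, e.right_inv hzt] at hz
    exact ball_subset_closedBall hz
  calc _ ≤ ∫⁻ z in closedBall (e p) s, ‖OneForm.coeff β e z‖ₑ ^ 2 := lintegral_mono_set hsub'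
    _ ≤ ∫⁻ _ in closedBall (e p) s, ENNReal.ofReal C ^ 2 := by
      refine setLIntegral_mono' measurableSet_closedBall fun z hz => ?_
      gcongr
      rw [← ofReal_norm]
      exact ENNReal.ofReal_le_ofReal (hC z hz)
    _ < ∞ := by
      rw [setLIntegral_const]
      exact ENNReal.mul_lt_top (by simp) measure_closedBall_lt_top

/-- The Hodge norm is the square root of a finite integral, so that `toReal` loses nothing. -/
theorem areaMeasure_univ_lt_top [CompactSpace Z] {β : OneForm Z}
    (hβ : β ∈ holomorphicOneForms Z) : OneForm.areaMeasure β univ < ∞ := by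
  choose V hVo hpV hVs hVf using exists_open_chartMeasure_lt_top hβ
  obtain ⟨T, hT⟩ := CompactSpace.elim_nhds_subcover V fun p => (hVo p).mem_nhds (hpV p)
  set ν : Measure Z := ∑ p ∈ T, (chartMeasure β (chartAt ℂ p)).restrict (V p)
  have hle : OneForm.areaMeasure β ≤ ν := by
    refine iSup₂_le fun e he => Measure.le_iff.2 fun A hA => ?_
    change chartMeasure β e A ≤ ν A
    calc chartMeasure β e A ≤ chartMeasure β e (⋃ p ∈ T, A ∩ V p) := by
          refine measure_mono fun x hx => ?_
          have : x ∈ ⋃ p ∈ T, V p := by rw [hT]; trivial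
          simp only [mem_iUnion, exists_prop] at this ⊢
          obtain ⟨p, hp, hxp⟩ := this
          exact ⟨p, hp, hx, hxp⟩
      _ ≤ ∑ p ∈ T, chartMeasure β e (A ∩ V p) := measure_biUnion_finset_le _ _
      _ ≤ ∑ p ∈ T, (chartMeasure β (chartAt ℂ p)).restrict (V p) A := by
          refine Finset.sum_le_sum fun p _ => ?_
          rw [Measure.restrict_apply hA]
          exact chartMeasure_le β he (IsManifold.chart_mem_maximalAtlas _)
            (hA.inter (hVo p).measurableSet) (inter_subset_right.trans (hVs p))
      _ = ν A := by simp [ν]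
  refine (hle univ).trans_lt ?_
  simp only [ν, Measure.coe_finsetSum, Finset.sum_apply, Measure.restrict_apply_univ]
  exact ENNReal.sum_lt_top.2 fun p _ => hVf p

/-- An injective holomorphic parametrization sees at most the total mass of `|β|²`. -/
theorem lintegral_pullbackCoeff_le [CompactSpace Z] {β : OneForm Z}
    (hβ : β ∈ holomorphicOneForms Z) {E : ℂ → Z} {U : Set ℂ} (hU : IsOpen U)
    (hE : ∀ z ∈ U, MDifferentiableAt 𝓘(ℂ) 𝓘(ℂ) E z) (hinj : InjOn E U)
    (hd : ∀ z ∈ U, deriv (chartAt ℂ (E z) ∘ E) z ≠ 0) :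
    ∫⁻ z in U, ‖pullbackCoeff β E z‖ₑ ^ 2 ≤ ENNReal.ofReal (hodgeNorm β ^ 2) := by
  obtain ⟨e, he, het, hes⟩ := exists_chart_of_injOn hU hE hinj hd
  have h1 := chartMeasure_le_areaMeasure β he univ
  rw [chartMeasure_apply β e MeasurableSet.univ, preimage_univ, univ_inter, het] at h1
  rw [hodgeNorm, Real.sq_sqrt ENNReal.toReal_nonneg,
    ENNReal.ofReal_toReal (areaMeasure_univ_lt_top hβ).ne]
  refine le_trans (le_of_eq ?_) h1
  have : (e.symm : ℂ → Z) = E := funext hes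
  rw [← this]
  rfl

theorem IsDeveloping.lintegral_pullbackCoeff_le [CompactSpace Z] {ω β : OneForm Z}
    (hβ : β ∈ holomorphicOneForms Z) {F : ℂ → Z} {U : Set ℂ} (hU : IsOpen U)
    (hF : IsDeveloping ω 0 F U) (hinj : InjOn F U) :
    ∫⁻ z in U, ‖pullbackCoeff β F z‖ₑ ^ 2 ≤ ENNReal.ofReal (hodgeNorm β ^ 2) :=
  QuadDiff.lintegral_pullbackCoeff_le hβ hU (fun z hz => (hF z hz).1) hinj fun z hz =>
    hF.deriv_ne_zero hz (by simp)

theorem IsZeroDisc.lintegral_pullbackCoeff_le [CompactSpace Z] {ω β : OneForm Z}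
    (hβ : β ∈ holomorphicOneForms Z) {p : Z} {E : ℂ → Z} {ρ R : ℝ} (h : IsZeroDisc ω p E ρ)
    (hR : R ≤ ρ) (hinj : InjOn E (ball 0 R)) :
    ∫⁻ z in ball 0 R, ‖pullbackCoeff β E z‖ₑ ^ 2 ≤ ENNReal.ofReal (hodgeNorm β ^ 2) := by
  refine QuadDiff.lintegral_pullbackCoeff_le hβ isOpen_ball
    (fun z hz => (h.isDeveloping z (ball_subset_ball hR hz)).1) hinj fun z hz => ?_
  by_cases hz0 : z = 0
  · obtain ⟨e, he, δ, hδ, -, het, hp, hep, hE⟩ := h.exists_chart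
    subst hz0
    have h0 : (0 : ℂ) ∈ e.target := by rw [het]; exact mem_ball_self hδ
    have h1 : chartAt ℂ (E 0) ∘ E =ᶠ[𝓝 0] chartAt ℂ (E 0) ∘ e.symm := by
      filter_upwards [ball_mem_nhds (0 : ℂ) hδ] with w hw
      simp only [Function.comp, hE hw]
    rw [h1.deriv_eq]
    refine deriv_transition_ne_zero he (IsManifold.chart_mem_maximalAtlas _) h0 ?_
    rw [← hE (mem_ball_self hδ)]
    exact mem_chart_source ℂ (E 0)
  · exact h.isDeveloping.deriv_ne_zero (ball_subset_ball hR hz) (pow_ne_zero 2 hz0)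

end Area

/-! ### The Bergman space of a disc -/

section Bergman

open ComplexConjugate

theorem integral_ball_pow_mul_conj_pow_of_ne (s : ℝ) {k n : ℕ} (hkn : k ≠ n) :
    ∫ z in ball (0 : ℂ) s, z ^ k * conj z ^ n = 0 := by
  -- a rotation by `π / (k - n)` changes the sign of the integrand
  set u : Circle := Circle.exp (Real.pi / ((k : ℝ) - n))
  have hne : (k : ℂ) - n ≠ 0 := sub_ne_zero.2 (by exact_mod_cast hkn)
  have hu : (u : ℂ) ^ k * conj (u : ℂ) ^ n = -1 := by
    rw [Circle.coe_exp, ← Complex.exp_conj, ← Complex.exp_nat_mul, ← Complex.exp_nat_mul,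
      ← Complex.exp_add, ← Complex.exp_pi_mul_I]
    congr 1
    simp only [map_mul, Complex.conj_ofReal, Complex.conj_I]
    push_cast
    field_simp
    ring
  have h1 := (rotation u).measurePreserving.setIntegral_preimage_emb
    (rotation u).toHomeomorph.measurableEmbedding (fun z : ℂ => z ^ k * conj z ^ n) (ball 0 s)
  have h2 : rotation u ⁻¹' ball (0 : ℂ) s = ball 0 s := by
    ext z
    rw [mem_preimage, mem_ball_zero_iff, mem_ball_zero_iff, LinearIsometryEquiv.norm_map]
  have h3 : ∀ z : ℂ,
      rotation u z ^ k * conj (rotation u z) ^ n = -(z ^ k * conj z ^ n) := fun z => by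
    rw [rotation_apply, map_mul, mul_pow, mul_pow]
    linear_combination (z ^ k * conj z ^ n) * hu
  rw [h2] at h1
  simp only [h3, integral_neg] at h1
  exact self_eq_neg.1 h1.symm

theorem integral_ball_norm_pow {s : ℝ} (hs : 0 ≤ s) (n : ℕ) :
    ∫ z in ball (0 : ℂ) s, ‖z‖ ^ (2 * n) = Real.pi * s ^ (2 * n + 2) / (n + 1) := by
  have h1 := integral_fun_norm_addHaar (volume : Measure ℂ)
    (fun y => (Iio s).indicator (fun y : ℝ => y ^ (2 * n)) y)
  have h2 : ∀ z : ℂ, (Iio s).indicator (fun y : ℝ => y ^ (2 * n)) ‖z‖ =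
      (ball (0 : ℂ) s).indicator (fun z => ‖z‖ ^ (2 * n)) z := fun z => by
    simp only [indicator, mem_Iio, mem_ball_zero_iff]
  simp only [h2] at h1
  rw [integral_indicator measurableSet_ball] at h1
  have h3 : ∀ y : ℝ, y ^ (2 - 1) • (Iio s).indicator (fun y : ℝ => y ^ (2 * n)) y =
      (Iio s).indicator (fun y : ℝ => y ^ (2 * n + 1)) y := fun y => by
    by_cases hy : y ∈ Iio s
    · simp only [indicator_of_mem hy, smul_eq_mul]; ring
    · simp only [indicator_of_notMem hy, smul_zero]
  rw [h1, Complex.finrank_real_complex]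
  simp only [h3]
  rw [setIntegral_indicator measurableSet_Iio, Ioi_inter_Iio, ← integral_Ioc_eq_integral_Ioo,
    ← intervalIntegral.integral_of_le hs, integral_pow, Measure.real, Complex.volume_ball]
  simp
  field_simp
  ring

theorem integral_ball_pow_mul_conj_pow {s : ℝ} (hs : 0 ≤ s) (n : ℕ) :
    ∫ z in ball (0 : ℂ) s, z ^ n * conj z ^ n = (Real.pi * s ^ (2 * n + 2) / (n + 1) : ℝ) := by
  rw [← integral_ball_norm_pow hs]
  refine Eq.trans ?_ (integral_ofReal (𝕜 := ℂ))
  congr 1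
  ext z
  rw [← mul_pow, Complex.mul_conj, Complex.normSq_eq_norm_sq, pow_mul]
  push_cast
  rfl

variable {g : ℂ → ℂ} {a : ℕ → ℂ} {R : ℝ}

theorem integral_ball_mul_conj_pow (ha : ∀ z ∈ ball (0 : ℂ) R, HasSum (fun n => a n * z ^ n) (g z))
    {s : ℝ} (hs : 0 ≤ s) (hsR : s < R) (n : ℕ) :
    ∫ z in ball (0 : ℂ) s, g z * conj z ^ n =
      a n * (Real.pi * s ^ (2 * n + 2) / (n + 1) : ℝ) := by
  have hsum : Summable fun k => ‖a k‖ * s ^ k := by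
    have h1 := (ha (s : ℂ) (by simpa [abs_of_nonneg hs] using hsR)).summable.norm
    simpa [abs_of_nonneg hs] using h1
  have hcont : ∀ k, Continuous fun z : ℂ => a k * z ^ k * conj z ^ n := fun k => by fun_prop
  have hint : ∀ k, IntegrableOn (fun z : ℂ => a k * z ^ k * conj z ^ n) (ball 0 s) := fun k =>
    ((hcont k).continuousOn.integrableOn_compact (isCompact_closedBall 0 s)).mono_set
      ball_subset_closedBall
  have hbound : ∀ k, ∫ z in ball (0 : ℂ) s, ‖a k * z ^ k * conj z ^ n‖ ≤
      ‖a k‖ * s ^ k * (s ^ n * volume.real (ball (0 : ℂ) s)) := fun k => by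
    calc _ ≤ ∫ z in ball (0 : ℂ) s, ‖a k‖ * s ^ k * s ^ n := by
          refine setIntegral_mono_on (hint k).norm (integrableOn_const measure_ball_lt_top.ne)
            measurableSet_ball fun z hz => ?_
          rw [mem_ball_zero_iff] at hz
          rw [norm_mul, norm_mul, norm_pow, norm_pow, RCLike.norm_conj]
          gcongr
      _ = _ := by rw [setIntegral_const, smul_eq_mul]; ring
  have h1 := hasSum_integral_of_summable_integral_norm hint
    (Summable.of_nonneg_of_le (fun k => integral_nonneg fun z => norm_nonneg _) hbound
      (hsum.mul_right _))
  have h2 : ∫ z in ball (0 : ℂ) s, ∑' k, a k * z ^ k * conj z ^ n =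
      ∫ z in ball (0 : ℂ) s, g z * conj z ^ n := by
    refine setIntegral_congr_fun measurableSet_ball fun z hz => ?_
    exact ((ha z (ball_subset_ball hsR.le hz)).mul_right _).tsum_eq
  rw [h2] at h1
  refine h1.unique ?_
  have h3 : ∀ k, ∫ z in ball (0 : ℂ) s, a k * z ^ k * conj z ^ n =
      a k * ∫ z in ball (0 : ℂ) s, z ^ k * conj z ^ n := fun k => by
    simp only [mul_assoc, integral_const_mul]
  have h4 := hasSum_single (f := fun k => ∫ z in ball (0 : ℂ) s, a k * z ^ k * conj z ^ n) n
    fun k hk => by rw [h3, integral_ball_pow_mul_conj_pow_of_ne s hk, mul_zero]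
  simp only [h3 n, integral_ball_pow_mul_conj_pow hs] at h4
  exact h4

/-- The powers of `z` are orthogonal on discs; this is Bessel's inequality for them. -/
theorem sum_norm_sq_coeff_le_integral (hg : ContinuousOn g (ball 0 R))
    (ha : ∀ z ∈ ball (0 : ℂ) R, HasSum (fun n => a n * z ^ n) (g z))
    {s : ℝ} (hs : 0 ≤ s) (hsR : s < R) (N : ℕ) :
    ∑ n ∈ Finset.range N, ‖a n‖ ^ 2 * (Real.pi * s ^ (2 * n + 2) / (n + 1)) ≤
      ∫ z in ball (0 : ℂ) s, ‖g z‖ ^ 2 := by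
  have hgc : ContinuousOn g (closedBall 0 s) := hg.mono (closedBall_subset_ball hsR)
  set P : ℂ → ℂ := fun z => ∑ n ∈ Finset.range N, a n * z ^ n
  have hP : Continuous P := by fun_prop
  have hint : ∀ {E : Type} [NormedAddCommGroup E] {f : ℂ → E}, ContinuousOn f (closedBall 0 s) →
      IntegrableOn f (ball (0 : ℂ) s) := fun hf =>
    (hf.integrableOn_compact (isCompact_closedBall 0 s)).mono_set ball_subset_closedBall
  -- the inner product of `P` with any `h` having a power series expansion
  have key : ∀ (h : ℂ → ℂ) (b : ℕ → ℂ), ContinuousOn h (closedBall 0 s) →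
      (∀ z ∈ ball (0 : ℂ) R, HasSum (fun n => b n * z ^ n) (h z)) →
      ∫ z in ball (0 : ℂ) s, h z * conj (P z) =
        ∑ n ∈ Finset.range N, b n * conj (a n) * (Real.pi * s ^ (2 * n + 2) / (n + 1) : ℝ) := by
    intro h b hh hb
    have h1 : ∀ z, h z * conj (P z) = ∑ n ∈ Finset.range N, conj (a n) * (h z * conj z ^ n) := by
      intro z
      simp only [P, map_sum, map_mul, map_pow, Finset.mul_sum]
      exact Finset.sum_congr rfl fun n _ => by ring
    simp only [h1]
    rw [integral_finsetSum]
    · refine Finset.sum_congr rfl fun n _ => ?_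
      rw [integral_const_mul, integral_ball_mul_conj_pow hb hs hsR]
      ring
    · intro n _
      exact hint (continuousOn_const.mul (hh.mul (by fun_prop)))
  have hgP := key g a hgc ha
  have hPP := key P (fun n => if n < N then a n else 0) hP.continuousOn (by
    intro z _
    have h1 : HasSum _ _ := hasSum_sum_of_ne_finset_zero (s := Finset.range N)
      (f := fun n => (if n < N then a n else 0) * z ^ n) (fun n hn => by
        simp only [Finset.mem_range] at hn; simp [hn])
    convert h1 using 1
    exact Finset.sum_congr rfl fun n hn => by simp [Finset.mem_range.1 hn])
  have hsum : ∀ n ∈ Finset.range N,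
      (if n < N then a n else 0) * conj (a n) * (Real.pi * s ^ (2 * n + 2) / (n + 1) : ℝ) =
      ((‖a n‖ ^ 2 * (Real.pi * s ^ (2 * n + 2) / (n + 1)) : ℝ) : ℂ) := fun n hn => by
    rw [if_pos (Finset.mem_range.1 hn), Complex.mul_conj, Complex.normSq_eq_norm_sq]
    push_cast; ring
  have hsum' : ∀ n ∈ Finset.range N,
      a n * conj (a n) * (Real.pi * s ^ (2 * n + 2) / (n + 1) : ℝ) =
      ((‖a n‖ ^ 2 * (Real.pi * s ^ (2 * n + 2) / (n + 1)) : ℝ) : ℂ) := fun n hn => by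
    rw [Complex.mul_conj, Complex.normSq_eq_norm_sq]
    push_cast; ring
  rw [Finset.sum_congr rfl hsum, ← Complex.ofReal_sum] at hPP
  rw [Finset.sum_congr rfl hsum', ← Complex.ofReal_sum] at hgP
  set B := ∑ n ∈ Finset.range N, ‖a n‖ ^ 2 * (Real.pi * s ^ (2 * n + 2) / (n + 1))
  have hre : ∀ {f : ℂ → ℂ}, ContinuousOn f (closedBall 0 s) →
      ∫ z in ball (0 : ℂ) s, (f z).re = (∫ z in ball (0 : ℂ) s, f z).re := fun hf =>
    integral_re (hint hf)
  have c1 : ContinuousOn (fun z => g z * conj (P z)) (closedBall 0 s) :=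
    hgc.mul (Complex.continuous_conj.comp hP).continuousOn
  have c2 : ContinuousOn (fun z => P z * conj (P z)) (closedBall 0 s) :=
    (hP.mul (Complex.continuous_conj.comp hP)).continuousOn
  have c3 : ContinuousOn (fun z => ‖g z‖ ^ 2) (closedBall 0 s) := hgc.norm.pow 2
  have h0 : 0 ≤ ∫ z in ball (0 : ℂ) s, ‖g z - P z‖ ^ 2 := integral_nonneg fun z => by positivity
  have h1 : ∀ z, ‖g z - P z‖ ^ 2 =
      ‖g z‖ ^ 2 - 2 * (g z * conj (P z)).re + (P z * conj (P z)).re := fun z => by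
    rw [← Complex.normSq_eq_norm_sq, Complex.normSq_sub, Complex.mul_conj,
      Complex.normSq_eq_norm_sq, Complex.ofReal_re]
    ring
  simp only [h1] at h0
  rw [integral_add, integral_sub, integral_const_mul, hre c1, hre c2, hgP, hPP] at h0
  · simp only [Complex.ofReal_re] at h0
    linarith
  · exact hint c3
  · exact hint (continuousOn_const.mul (Complex.continuous_re.comp_continuousOn c1))
  · exact hint (c3.sub (continuousOn_const.mul (Complex.continuous_re.comp_continuousOn c1)))
  · exact hint (Complex.continuous_re.comp_continuousOn c2)

theorem sum_norm_sq_coeff_le (hR : 0 < R) (hg : ContinuousOn g (ball 0 R))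
    (ha : ∀ z ∈ ball (0 : ℂ) R, HasSum (fun n => a n * z ^ n) (g z)) {M : ℝ}
    (hM : ∫⁻ z in ball (0 : ℂ) R, ‖g z‖ₑ ^ 2 ≤ ENNReal.ofReal (M ^ 2)) (N : ℕ) :
    ∑ n ∈ Finset.range N, ‖a n‖ ^ 2 * (Real.pi * R ^ (2 * n + 2) / (n + 1)) ≤ M ^ 2 := by
  have hcont : Continuous fun s : ℝ =>
      ∑ n ∈ Finset.range N, ‖a n‖ ^ 2 * (Real.pi * s ^ (2 * n + 2) / (n + 1)) := by fun_prop
  have hlim := (hcont.tendsto R).mono_left (nhdsWithin_le_nhds (s := Iio R))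
  refine le_of_tendsto hlim ?_
  filter_upwards [Ioo_mem_nhdsLT hR] with s hs
  refine (sum_norm_sq_coeff_le_integral hg ha hs.1.le hs.2 N).trans ?_
  have hint : IntegrableOn (fun z => ‖g z‖ ^ 2) (ball (0 : ℂ) s) :=
    (((hg.mono (closedBall_subset_ball hs.2)).norm.pow 2).integrableOn_compact
      (isCompact_closedBall 0 s)).mono_set ball_subset_closedBall
  rw [← ENNReal.ofReal_le_ofReal_iff (sq_nonneg M), ofReal_integral_eq_lintegral_ofReal hint
    (ae_of_all _ fun z => by positivity)]
  refine le_trans ?_ hM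
  refine le_trans (le_of_eq ?_) (lintegral_mono_set (ball_subset_ball hs.2.le))
  congr 1
  ext z
  rw [ENNReal.ofReal_pow (norm_nonneg _), ofReal_norm]

/-- The norm of a linear functional `g ↦ ∑ a n * c n` on the Bergman space of a disc. -/
theorem norm_sq_le_of_hasSum_coeff (hR : 0 < R) (hg : ContinuousOn g (ball 0 R))
    (ha : ∀ z ∈ ball (0 : ℂ) R, HasSum (fun n => a n * z ^ n) (g z)) {M : ℝ}
    (hM : ∫⁻ z in ball (0 : ℂ) R, ‖g z‖ₑ ^ 2 ≤ ENNReal.ofReal (M ^ 2))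
    {c : ℕ → ℂ} {L : ℂ} {S : ℝ} (hL : HasSum (fun n => a n * c n) L)
    (hS : HasSum (fun n : ℕ => ‖c n‖ ^ 2 * ((n + 1) / R ^ (2 * n + 2))) S) :
    ‖L‖ ^ 2 ≤ M ^ 2 / Real.pi * S := by
  refine le_of_tendsto (hL.tendsto_sum_nat.norm.pow 2) (Eventually.of_forall fun N => ?_)
  have hpos : ∀ n : ℕ, 0 < Real.pi * R ^ (2 * n + 2) / ((n : ℝ) + 1) := fun n => by
    have := Real.pi_pos; positivity
  calc ‖∑ n ∈ Finset.range N, a n * c n‖ ^ 2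
      ≤ (∑ n ∈ Finset.range N, ‖a n * c n‖) ^ 2 := by gcongr; exact norm_sum_le _ _
    _ ≤ (∑ n ∈ Finset.range N, ‖a n‖ ^ 2 * (Real.pi * R ^ (2 * n + 2) / (n + 1))) *
        ∑ n ∈ Finset.range N, ‖c n‖ ^ 2 * ((n + 1) / R ^ (2 * n + 2)) / Real.pi := by
      refine Finset.sum_sq_le_sum_mul_sum_of_sq_le_mul _ (fun n _ => ?_) (fun n _ => ?_)
        fun n _ => le_of_eq ?_
      · exact mul_nonneg (sq_nonneg _) (hpos n).le
      · have := Real.pi_pos; positivity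
      · have := Real.pi_ne_zero
        rw [norm_mul]
        field_simp
    _ ≤ M ^ 2 * (S / Real.pi) := by
      refine mul_le_mul (sum_norm_sq_coeff_le hR hg ha hM N) ?_ (Finset.sum_nonneg fun n _ => ?_)
        (sq_nonneg M)
      · rw [← Finset.sum_div]
        have := Real.pi_pos
        gcongr
        exact sum_le_hasSum _ (fun n _ => by positivity) hS
      · have := Real.pi_pos; positivity
    _ = _ := by ring

theorem hasSum_taylor (hg : DifferentiableOn ℂ g (ball 0 R)) {z : ℂ} (hz : z ∈ ball (0 : ℂ) R) :
    HasSum (fun n : ℕ => ((n.factorial : ℂ)⁻¹ * iteratedDeriv n g 0) * z ^ n) (g z) := by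
  have h1 := Complex.hasSum_taylorSeries_on_ball hg hz
  simp only [sub_zero, smul_eq_mul] at h1
  exact h1.congr_fun fun n => by ring

/-- The pointwise bound on the Bergman space of a disc, from the reproducing kernel: on the unit
disc `∑ (n + 1) x ^ n = 1 / (1 - x) ^ 2` with `x = ‖z‖ ^ 2`. -/
theorem norm_le_of_lintegral_le (hR : 0 < R) (hg : DifferentiableOn ℂ g (ball 0 R)) {M : ℝ}
    (hM0 : 0 ≤ M) (hM : ∫⁻ z in ball (0 : ℂ) R, ‖g z‖ₑ ^ 2 ≤ ENNReal.ofReal (M ^ 2))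
    {z : ℂ} (hz : z ∈ ball (0 : ℂ) R) :
    ‖g z‖ ≤ M / (√Real.pi * R * (1 - ‖z‖ ^ 2 / R ^ 2)) := by
  have hz' : ‖z‖ < R := mem_ball_zero_iff.1 hz
  have hx1 : ‖z‖ ^ 2 / R ^ 2 < 1 := by
    rw [div_lt_one (by positivity)]; gcongr
  set x := ‖z‖ ^ 2 / R ^ 2 with hx
  have hx0 : 0 ≤ x := by positivity
  have hS : HasSum (fun n : ℕ => ‖z ^ n‖ ^ 2 * ((n + 1) / R ^ (2 * n + 2)))
      (1 / (1 - x) ^ 2 / R ^ 2) := by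
    have h1 := (hasSum_choose_mul_geometric_of_norm_lt_one 1
      (r := x) (by rwa [Real.norm_of_nonneg hx0])).div_const (R ^ 2)
    refine h1.congr_fun fun n => ?_
    rw [Nat.choose_one_right, norm_pow, hx, div_pow]
    push_cast
    field_simp
    ring
  have h1 := norm_sq_le_of_hasSum_coeff hR hg.continuousOn (fun z hz => hasSum_taylor hg hz) hM
    (hasSum_taylor hg hz) hS
  have hπ := Real.pi_pos
  have h1x : 0 < 1 - x := by linarith
  refine le_of_sq_le_sq ?_ (by positivity)
  refine h1.trans (le_of_eq ?_)
  rw [div_pow, mul_pow, mul_pow, Real.sq_sqrt hπ.le]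
  field_simp

/-- The primitive of an even function in the Bergman space of a disc is small, because its power
series has only odd terms: with `x = ‖z‖ ^ 2 / R ^ 2`, the square of the norm of `g ↦ G z` on even
functions is `1 / π` times `∑ x ^ (2 k + 1) / (2 k + 1)`, which is less than `0.88` for
`x ≤ 0.7`. -/
theorem exists_primitive_norm_le (hR : 0 < R) (hg : DifferentiableOn ℂ g (ball 0 R)) {M : ℝ}
    (hM : ∫⁻ z in ball (0 : ℂ) R, ‖g z‖ₑ ^ 2 ≤ ENNReal.ofReal (M ^ 2))
    (heven : ∀ᶠ w in 𝓝 (0 : ℂ), g (-w) = g w) :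
    ∃ G : ℂ → ℂ, (∀ z ∈ ball (0 : ℂ) R, HasDerivAt G (g z) z) ∧ G 0 = 0 ∧
      ∀ z ∈ ball (0 : ℂ) R, ‖z‖ ^ 2 ≤ 0.7 * R ^ 2 → ‖G z‖ ^ 2 ≤ 0.2804 * M ^ 2 := by
  obtain ⟨G₀, hG₀⟩ := hg.isExactOn_ball
  set G : ℂ → ℂ := fun z => G₀ z - G₀ 0
  have hG : ∀ z ∈ ball (0 : ℂ) R, HasDerivAt G (g z) z := fun z hz => (hG₀ z hz).sub_const _
  refine ⟨G, hG, sub_self _, fun z hz hzx => ?_⟩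
  have h0R := ball_mem_nhds (0 : ℂ) hR
  have hderiv : ∀ n, iteratedDeriv (n + 1) G 0 = iteratedDeriv n g 0 := fun n => by
    rw [iteratedDeriv_succ']
    refine Filter.EventuallyEq.iteratedDeriv_eq n ?_
    filter_upwards [h0R] with w hw using (hG w hw).deriv
  have hodd : ∀ n, Odd n → iteratedDeriv n g 0 = 0 := fun n hn => by
    have h1 := iteratedDeriv_comp_neg n g 0
    rw [Filter.EventuallyEq.iteratedDeriv_eq n heven, hn.neg_one_pow, neg_zero] at h1
    simp only [neg_smul, one_smul] at h1
    exact self_eq_neg.1 h1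
  set a : ℕ → ℂ := fun n => (n.factorial : ℂ)⁻¹ * iteratedDeriv n g 0
  set c : ℕ → ℂ := fun n => if Even n then z ^ (n + 1) / (n + 1) else 0
  have hL : HasSum (fun n => a n * c n) (G z) := by
    have h1 := hasSum_taylor (fun z hz => (hG z hz).differentiableAt.differentiableWithinAt) hz
    rw [← hasSum_nat_add_iff' 1] at h1
    simp only [Finset.sum_range_one, iteratedDeriv_zero, G, sub_self, mul_zero, zero_mul,
      sub_zero] at h1
    refine h1.congr_fun fun n => ?_
    rw [hderiv n]
    simp only [a, c]
    split_ifs with hn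
    · rw [Nat.factorial_succ]
      push_cast
      have : (n : ℂ) + 1 ≠ 0 := by exact_mod_cast Nat.succ_ne_zero n
      field_simp
    · rw [hodd n (Nat.not_even_iff_odd.1 hn)]; ring
  set x := ‖z‖ ^ 2 / R ^ 2 with hx
  have hx0 : 0 ≤ x := by positivity
  have hx7 : x ≤ 0.7 := by rw [hx, div_le_iff₀ (by positivity)]; exact hzx
  have hlog := (Real.hasSum_log_sub_log_of_abs_lt_one (x := x)
    (by rw [abs_of_nonneg hx0]; linarith)).div_const 2
  have hS : HasSum (fun n : ℕ => ‖c n‖ ^ 2 * ((n + 1) / R ^ (2 * n + 2)))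
      ((Real.log (1 + x) - Real.log (1 - x)) / 2) := by
    have hinj : Function.Injective fun k : ℕ => 2 * k := fun a b h => by
      simp only at h; omega
    refine (hinj.hasSum_iff ?_).1 ?_
    · intro n hn
      have : ¬Even n := fun ⟨k, hk⟩ => hn ⟨k, by simp only; omega⟩
      simp [c, this]
    · refine hlog.congr_fun fun k => ?_
      simp only [Function.comp, c, even_two_mul, if_true]
      rw [norm_div, norm_pow,
        show (((2 * k : ℕ) : ℂ) + 1) = ((2 * k + 1 : ℝ) : ℂ) by push_cast; ring,
        Complex.norm_real, Real.norm_of_nonneg (by positivity), hx, div_pow, div_pow, ← pow_mul,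
        ← pow_mul, ← pow_mul, show 2 * (2 * k) + 2 = 2 * (2 * k + 1) by ring,
        show (2 * k + 1) * 2 = 2 * (2 * k + 1) by ring]
      push_cast
      have : (2 * (k : ℝ) + 1) ≠ 0 := by positivity
      field_simp
  have h1 := norm_sq_le_of_hasSum_coeff hR hg.continuousOn (fun z hz => hasSum_taylor hg hz) hM
    hL hS
  -- `(1 + x) / (1 - x) ≤ 17 / 3` for `x ≤ 0.7`, and `0.88 / π < 0.2804`
  have hbound : Real.log (1 + x) - Real.log (1 - x) ≤ 1.76 := by
    have h2 : Real.log (1 + x) ≤ Real.log (1 - x) + 1.76 := by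
      have hexp : 17 / 3 ≤ Real.exp 1.76 := by
        refine le_trans ?_ (Real.sum_le_exp_of_nonneg (by norm_num) 8)
        norm_num [Finset.sum_range_succ, Nat.factorial]
      rw [← Real.log_exp 1.76, ← Real.log_mul (by linarith) (Real.exp_ne_zero _)]
      refine Real.log_le_log (by linarith) ?_
      nlinarith
    linarith
  have hπ : 3.14 < Real.pi := Real.pi_gt_d2
  calc ‖G z‖ ^ 2 ≤ M ^ 2 / Real.pi * ((Real.log (1 + x) - Real.log (1 - x)) / 2) := h1
    _ ≤ M ^ 2 / Real.pi * 0.88 := mul_le_mul_of_nonneg_left (by linarith) (by positivity)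
    _ ≤ M ^ 2 / 3.14 * 0.88 := by gcongr
    _ ≤ _ := by
      rw [div_mul_eq_mul_div, div_le_iff₀ (by norm_num)]
      nlinarith [sq_nonneg M]

end Bergman

/-! ### Chords of discs, and integrals over chords -/

section Chords

theorem intervalIntegrable_abs_rpow {r : ℝ} (h : -1 < r) (a b : ℝ) :
    IntervalIntegrable (fun x : ℝ => |x| ^ r) volume a b := by
  have key : ∀ b, 0 ≤ b → IntervalIntegrable (fun x : ℝ => |x| ^ r) volume 0 b := fun b hb =>
    (intervalIntegral.intervalIntegrable_rpow' h).congr fun x hx => by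
      rw [uIoc_of_le hb] at hx
      simp only [abs_of_pos hx.1]
  have key' : ∀ b, IntervalIntegrable (fun x : ℝ => |x| ^ r) volume 0 b := fun b => by
    rcases le_total 0 b with hb | hb
    · exact key b hb
    · rw [IntervalIntegrable.iff_comp_neg, neg_zero]
      simpa only [abs_neg] using key (-b) (by linarith)
  exact (key' a).symm.trans (key' b)

/-- A bound for an integral in terms of the boundary values of a primitive, which need not extend
continuously to the end points. -/
theorem norm_integral_le_of_hasDerivAt {v H : ℝ → ℂ} {a b A₁ A₂ : ℝ} (hab : a < b)
    (hv : IntervalIntegrable v volume a b) (hH : ∀ t ∈ Ioo a b, HasDerivAt H (v t) t)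
    (h₁ : ∀ ε > 0, ∀ᶠ t in 𝓝[>] a, ‖H t‖ ≤ A₁ + ε) (h₂ : ∀ ε > 0, ∀ᶠ t in 𝓝[<] b, ‖H t‖ ≤ A₂ + ε) :
    ‖∫ t in a..b, v t‖ ≤ A₁ + A₂ := by
  set Φ : ℝ → ℂ := fun x => ∫ t in a..x, v t
  have hΦ : ContinuousOn Φ (uIcc a b) :=
    intervalIntegral.continuousOn_primitive_interval' hv left_mem_uIcc
  rw [uIcc_of_le hab.le] at hΦ
  have hΦa : Tendsto Φ (𝓝[>] a) (𝓝 0) := by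
    have h1 := (hΦ a (left_mem_Icc.2 hab.le)).mono Ioo_subset_Icc_self
    have h2 : Φ a = 0 := intervalIntegral.integral_same
    rw [ContinuousWithinAt, h2] at h1
    exact h1.mono_left (le_of_eq (nhdsWithin_Ioo_eq_nhdsGT hab).symm)
  have hΦb : Tendsto Φ (𝓝[<] b) (𝓝 (Φ b)) :=
    ((hΦ b (right_mem_Icc.2 hab.le)).mono Ioo_subset_Icc_self).mono_left
      (le_of_eq (nhdsWithin_Ioo_eq_nhdsLT hab).symm)
  refine le_of_forall_pos_le_add fun ε hε => ?_
  have hε4 : 0 < ε / 4 := by positivity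
  obtain ⟨s, hs1, hs2, hs⟩ := ((h₁ _ hε4).and ((hΦa.eventually
    (ball_mem_nhds _ hε4)).and (Ioo_mem_nhdsGT hab))).exists
  obtain ⟨s', hs1', hs2', hs'⟩ := ((h₂ _ hε4).and ((hΦb.eventually
    (ball_mem_nhds _ hε4)).and (Ioo_mem_nhdsLT hs.2))).exists
  have hint : ∀ x y, x ∈ Icc a b → y ∈ Icc a b → IntervalIntegrable v volume x y := fun x y hx hy =>
    hv.mono_set (by rw [uIcc_of_le hab.le]; exact (convex_Icc a b).ordConnected.uIcc_subset hx hy)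
  have hsI : s ∈ Icc a b := Ioo_subset_Icc_self hs
  have hsI' : s' ∈ Icc a b := ⟨hs.1.le.trans hs'.1.le, hs'.2.le⟩
  have h3 : Φ s' - Φ s = H s' - H s := by
    have h4 : Φ s' - Φ s = ∫ t in s..s', v t :=
      intervalIntegral.integral_interval_sub_left (hint _ _ (left_mem_Icc.2 hab.le) hsI')
        (hint _ _ (left_mem_Icc.2 hab.le) hsI)
    rw [h4]
    refine intervalIntegral.integral_eq_sub_of_hasDerivAt (fun t ht => ?_) (hint _ _ hsI hsI')
    rw [uIcc_of_le hs'.1.le] at ht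
    exact hH t ⟨hs.1.trans_le ht.1, ht.2.trans_lt hs'.2⟩
  have h5 : Φ b = H s' - H s + Φ s - (Φ s' - Φ b) := by rw [← h3]; ring
  rw [dist_zero_right] at hs2
  rw [dist_eq_norm] at hs2'
  change ‖Φ b‖ ≤ _
  rw [h5]
  calc _ ≤ ‖H s'‖ + ‖H s‖ + ‖Φ s‖ + ‖Φ s' - Φ b‖ :=
        (norm_sub_le _ _).trans (by
          gcongr
          exact (norm_add_le _ _).trans (by gcongr; exact norm_sub_le _ _))
    _ ≤ _ := by linarith

theorem norm_sq_add_ofReal_mul (w : ℂ) {c : ℂ} (hc : c ≠ 0) (t₀ : ℝ) :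
    ∃ s N : ℝ, 0 ≤ N ∧ N ≤ ‖w‖ ^ 2 ∧
      ∀ t : ℝ, ‖w + ((t - t₀ : ℝ) : ℂ) * c‖ ^ 2 = N + (‖c‖ * (t - s)) ^ 2 := by
  have hcn : ‖c‖ ≠ 0 := norm_ne_zero_iff.2 hc
  set x := (w * (starRingEnd ℂ) c).re
  have key : ∀ t : ℝ, ‖w + ((t - t₀ : ℝ) : ℂ) * c‖ ^ 2 =
      (‖w‖ ^ 2 - x ^ 2 / ‖c‖ ^ 2) + (‖c‖ * (t - (t₀ - x / ‖c‖ ^ 2))) ^ 2 := fun t => by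
    have h1 : (w * (starRingEnd ℂ) (((t - t₀ : ℝ) : ℂ) * c)).re = (t - t₀) * x := by
      rw [map_mul, Complex.conj_ofReal, mul_left_comm, Complex.re_ofReal_mul]
    rw [← Complex.normSq_eq_norm_sq, Complex.normSq_add, h1, Complex.normSq_mul,
      Complex.normSq_ofReal, Complex.normSq_eq_norm_sq, Complex.normSq_eq_norm_sq]
    field_simp
    ring
  refine ⟨t₀ - x / ‖c‖ ^ 2, ‖w‖ ^ 2 - x ^ 2 / ‖c‖ ^ 2, ?_,
    by linarith [show 0 ≤ x ^ 2 / ‖c‖ ^ 2 by positivity], key⟩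
  have := key (t₀ - x / ‖c‖ ^ 2)
  rw [sub_self, mul_zero] at this
  nlinarith [sq_nonneg ‖w + ((t₀ - x / ‖c‖ ^ 2 - t₀ : ℝ) : ℂ) * c‖]

/-- The chord that the straight path `t ↦ w + (t - t₀) c`, with `t ∈ (0, 1)`, cuts out of the disc
of radius `0.7 ^ (3 / 2) r`. At the times `0` and `1` the path is outside of the closed disc, unless
it is at its centre. The chord is long, since it comes close to the centre: half of a chord has
length at least `0.53 r`, and the chord is a whole one unless it starts or ends at the centre. -/
theorem exists_long_chord {w c : ℂ} {t₀ r : ℝ} (hr : 0 < r) (hc : 2 * r ≤ ‖c‖)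
    (ht₀ : t₀ ∈ Ioo (0 : ℝ) 1) (hw : ‖w‖ ^ 2 < 0.027 * r ^ 2)
    (h0 : ‖w + ((0 - t₀ : ℝ) : ℂ) * c‖ ^ 2 ≤ 0.343 * r ^ 2 → w + ((0 - t₀ : ℝ) : ℂ) * c = 0)
    (h1 : ‖w + ((1 - t₀ : ℝ) : ℂ) * c‖ ^ 2 ≤ 0.343 * r ^ 2 → w + ((1 - t₀ : ℝ) : ℂ) * c = 0) :
    ∃ a b, 0 ≤ a ∧ a < t₀ ∧ t₀ < b ∧ b ≤ 1 ∧
      (∀ t, t ∈ Ioo a b ↔ t ∈ Ioo (0 : ℝ) 1 ∧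
        ‖w + ((t - t₀ : ℝ) : ℂ) * c‖ ^ 2 < 0.343 * r ^ 2) ∧
      0.53 * r ≤ ‖c‖ * (b - a) ∧
      (1.06 * r ≤ ‖c‖ * (b - a) ∨ w + ((a - t₀ : ℝ) : ℂ) * c = 0 ∨
        w + ((b - t₀ : ℝ) : ℂ) * c = 0) := by
  have hcn : 0 < ‖c‖ := by linarith
  obtain ⟨s, N, hN0, hN, hW⟩ := norm_sq_add_ofReal_mul w (norm_pos_iff.1 hcn) t₀
  set h := √(0.343 * r ^ 2 - N) / ‖c‖
  have hh0 : 0 ≤ h := by positivity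
  have hch : ‖c‖ * h = √(0.343 * r ^ 2 - N) := by simp only [h]; field_simp
  have hch2 : (‖c‖ * h) ^ 2 = 0.343 * r ^ 2 - N := by
    rw [hch, Real.sq_sqrt]; nlinarith
  have hch0 : 0 ≤ ‖c‖ * h := by positivity
  -- the minimal square `N` is at most `0.027 r ^ 2`, and `0.343 - 0.027 ≥ 0.53 ^ 2`
  have hlong : 0.53 * r ≤ ‖c‖ * h := by
    refine le_of_sq_le_sq ?_ hch0
    rw [hch2]; nlinarith
  have hh1 : h < 1 := by
    by_contra! hcon
    have : 2 * r ≤ ‖c‖ * h := by nlinarith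
    nlinarith
  have hlt : ∀ t : ℝ, ‖w + ((t - t₀ : ℝ) : ℂ) * c‖ ^ 2 < 0.343 * r ^ 2 ↔ |t - s| < h := fun t => by
    rw [hW, ← lt_sub_iff_add_lt', ← hch2, sq_lt_sq, abs_mul, abs_of_pos hcn, abs_of_nonneg hch0,
      mul_lt_mul_iff_right₀ hcn]
  have hle : ∀ t : ℝ, ‖w + ((t - t₀ : ℝ) : ℂ) * c‖ ^ 2 ≤ 0.343 * r ^ 2 ↔ |t - s| ≤ h := fun t => by
    rw [hW, ← le_sub_iff_add_le', ← hch2, sq_le_sq, abs_mul, abs_of_pos hcn, abs_of_nonneg hch0,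
      mul_le_mul_iff_right₀ hcn]
  have hzero : ∀ t : ℝ, w + ((t - t₀ : ℝ) : ℂ) * c = 0 → t = s := fun t ht => by
    have := hW t
    rw [ht, norm_zero] at this
    have h2 : (‖c‖ * (t - s)) ^ 2 = 0 := by nlinarith [sq_nonneg (‖c‖ * (t - s))]
    have h3 := (mul_eq_zero.1 (pow_eq_zero_iff two_ne_zero |>.1 h2)).resolve_left hcn.ne'
    linarith
  have ht₀h : |t₀ - s| < h := by
    rw [← hlt, sub_self]
    simp only [Complex.ofReal_zero, zero_mul, add_zero]
    nlinarith
  rw [hle] at h0 h1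
  simp only [hlt]
  rw [abs_lt] at ht₀h
  by_cases c0 : |0 - s| ≤ h
  · have hs : (0 : ℝ) = s := hzero 0 (h0 c0)
    subst hs
    refine ⟨0, h, le_rfl, ht₀.1, by linarith, hh1.le, fun t => ?_, by linarith,
      Or.inr (Or.inl (h0 c0))⟩
    rw [abs_lt, mem_Ioo, mem_Ioo]
    constructor
    · rintro ⟨h2, h3⟩; exact ⟨⟨h2, by linarith⟩, by linarith, by linarith⟩
    · rintro ⟨⟨h2, h3⟩, h4, h5⟩; exact ⟨h2, by linarith⟩
  by_cases c1 : |1 - s| ≤ h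
  · have hs : (1 : ℝ) = s := hzero 1 (h1 c1)
    subst hs
    refine ⟨1 - h, 1, by linarith, by linarith, ht₀.2, le_rfl, fun t => ?_, by linarith,
      Or.inr (Or.inr (h1 c1))⟩
    rw [abs_lt, mem_Ioo, mem_Ioo]
    constructor
    · rintro ⟨h2, h3⟩; exact ⟨⟨by linarith, h3⟩, by linarith, by linarith⟩
    · rintro ⟨⟨h2, h3⟩, h4, h5⟩; exact ⟨by linarith, h3⟩
  have hs0 : 0 < s - h := by
    by_contra! hcon
    exact c0 (abs_le.2 ⟨by linarith [ht₀.1], by linarith [ht₀.1]⟩)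
  have hs1 : s + h < 1 := by
    by_contra! hcon
    exact c1 (abs_le.2 ⟨by linarith [ht₀.2], by linarith [ht₀.2]⟩)
  refine ⟨s - h, s + h, hs0.le, by linarith, by linarith, hs1.le, fun t => ?_, by linarith,
    Or.inl (by linarith)⟩
  rw [abs_lt, mem_Ioo, mem_Ioo]
  constructor
  · rintro ⟨h2, h3⟩; exact ⟨⟨by linarith, by linarith⟩, by linarith, by linarith⟩
  · rintro ⟨⟨h2, h3⟩, h4, h5⟩; exact ⟨by linarith, by linarith⟩

/-- A bound on an integral that holds pointwise outside of a family of pairwise disjoint intervals,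
and on average over each of these intervals. -/
theorem norm_integral_le_of_chords {v : ℝ → ℂ} {B : Set ℝ} {a b : ℝ → ℝ} {K δ : ℝ} (hδ : 0 < δ)
    (hv : ContinuousOn v (Ioo 0 1)) (hgood : ∀ t ∈ Ioo (0 : ℝ) 1, t ∉ B → ‖v t‖ ≤ K)
    (hab : ∀ t ∈ B, 0 ≤ a t ∧ a t < t ∧ t < b t ∧ b t ≤ 1 ∧ δ ≤ b t - a t)
    (hint : ∀ t ∈ B, IntervalIntegrable v volume (a t) (b t) ∧
      ‖∫ x in a t..b t, v x‖ ≤ K * (b t - a t))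
    (hdisj : ∀ t ∈ B, ∀ t' ∈ B, ∀ s ∈ Ioo (a t) (b t), s ∈ Ioo (a t') (b t') →
      a t = a t' ∧ b t = b t') :
    IntervalIntegrable v volume 0 1 ∧ ‖∫ t in (0 : ℝ)..1, v t‖ ≤ K := by
  have key : ∀ n : ℕ, ∀ T T', 0 ≤ T → T ≤ T' → T' ≤ 1 → T' - T ≤ n * δ →
      (∀ t ∈ B, t ∈ Ioo T T' → T ≤ a t ∧ b t ≤ T') →
      IntervalIntegrable v volume T T' ∧ ‖∫ t in T..T', v t‖ ≤ K * (T' - T) := by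
    intro n
    induction n with
    | zero =>
      intro T T' h0 hTT h1 hn _
      have : T' = T := by push_cast at hn; linarith
      subst this
      simp
    | succ n ih =>
      intro T T' h0 hTT h1 hn hT
      by_cases hB : ∃ t ∈ B, t ∈ Ioo T T'
      · obtain ⟨t, htB, ht⟩ := hB
        obtain ⟨ha, hat, htb, hb, hd⟩ := hab t htB
        obtain ⟨hTa, hbT⟩ := hT t htB ht
        push_cast at hn
        obtain ⟨i1, i2⟩ := ih T (a t) h0 hTa (by linarith) (by linarith) fun t' ht' htT => by
          refine ⟨(hT t' ht' ⟨htT.1, by linarith [htT.2, ht.2]⟩).1, ?_⟩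
          by_contra! hcon
          obtain ⟨s, hs⟩ := exists_between (lt_min hcon (hat.trans htb))
          have hs' := lt_min_iff.1 hs.2
          have := (hdisj t htB t' ht' s ⟨hs.1, hs'.2⟩
            ⟨(hab t' ht').2.1.trans (htT.2.trans hs.1), hs'.1⟩).1
          linarith [(hab t' ht').2.1, htT.2]
        obtain ⟨j1, j2⟩ := ih (b t) T' (by linarith) hbT h1 (by linarith) fun t' ht' htT => by
          refine ⟨?_, (hT t' ht' ⟨by linarith [htT.1, ht.1], htT.2⟩).2⟩
          by_contra! hcon
          obtain ⟨s, hs⟩ := exists_between (max_lt hcon (hat.trans htb))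
          have hs' := max_lt_iff.1 hs.1
          have := (hdisj t htB t' ht' s ⟨hs'.2, hs.2⟩
            ⟨hs'.1, hs.2.trans (htT.1.trans (hab t' ht').2.2.1)⟩).2
          linarith [(hab t' ht').2.2.1, htT.1]
        obtain ⟨k1, k2⟩ := hint t htB
        refine ⟨(i1.trans k1).trans j1, ?_⟩
        rw [← intervalIntegral.integral_add_adjacent_intervals (i1.trans k1) j1,
          ← intervalIntegral.integral_add_adjacent_intervals i1 k1]
        refine (norm_add₃_le).trans ?_
        linarith
      · push Not at hB
        have hbound : ∀ t ∈ Ioo T T', ‖v t‖ ≤ K := fun t ht =>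
          hgood t ⟨by linarith [ht.1], by linarith [ht.2]⟩ fun h => hB t h ht
        have hmeas : AEStronglyMeasurable v (volume.restrict (Ioo T T')) :=
          (hv.mono (Ioo_subset_Ioo h0 h1)).aestronglyMeasurable measurableSet_Ioo
        refine ⟨?_, ?_⟩
        · rw [intervalIntegrable_iff_integrableOn_Ioo_of_le hTT]
          exact Integrable.of_bound hmeas K
            ((ae_restrict_iff' measurableSet_Ioo).2 (ae_of_all _ hbound))
        · rw [intervalIntegral.integral_of_le hTT, integral_Ioc_eq_integral_Ioo]
          have h2 := norm_setIntegral_le_of_norm_le_const (μ := volume) (s := Ioo T T')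
            (by simp) hbound
          simpa [Measure.real, ENNReal.toReal_ofReal (sub_nonneg.2 hTT)] using h2
  obtain ⟨n, hn⟩ := exists_nat_ge (1 / δ)
  rw [div_le_iff₀ hδ] at hn
  have := key n 0 1 le_rfl zero_le_one le_rfl (by simpa using hn) fun t ht _ =>
    ⟨(hab t ht).1, (hab t ht).2.2.2.1⟩
  simpa using this

end Chords

/-! ### One-forms along saddle connections -/

section Velocity

theorem sqrt_pi_gt : 1.77 < √Real.pi :=
  Real.lt_sqrt_of_sq_lt (by linarith [Real.pi_gt_d2])

theorem hodgeNorm_nonneg {Z : Type*} [TopologicalSpace Z] [ChartedSpace ℂ Z] [MeasurableSpace Z]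
    (β : OneForm Z) : 0 ≤ hodgeNorm β :=
  Real.sqrt_nonneg _

variable {Z : Type*} [TopologicalSpace Z] [ChartedSpace ℂ Z]

/-- Tangent lines are one-dimensional: the value of `β` on a velocity is determined by that of `ω`,
in terms of the coefficients in any parametrization. -/
theorem apply_velocity_eq {ω β : OneForm Z} {γ : ℝ → Z} {t : ℝ} {E : ℂ → Z} {z : ℂ}
    (h : γ t = E z) (h0 : pullbackCoeff ω E z ≠ 0) :
    β (γ t) (velocity γ t) =
      pullbackCoeff β E z / pullbackCoeff ω E z * ω (γ t) (velocity γ t) := by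
  have hline : ∀ (L L' : ℂ →L[ℂ] ℂ) (v w : ℂ), L v * L' w = L w * L' v := fun L L' v w => by
    have h1 : ∀ (L : ℂ →L[ℂ] ℂ) (v : ℂ), L v = v * L 1 := fun L v => by
      rw [← smul_eq_mul, ← map_smul, smul_eq_mul, mul_one]
    rw [h1 L v, h1 L w, h1 L' v, h1 L' w]
    ring
  have key : ∀ (x : Z) (_ : x = E z) (v : TangentSpace 𝓘(ℂ) x),
      β x v * pullbackCoeff ω E z = pullbackCoeff β E z * ω x v := by
    rintro x rfl v
    exact hline (β (E z)) (ω (E z)) v _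
  rw [div_mul_eq_mul_div, eq_div_iff h0]
  exact key _ h (velocity γ t)

variable [IsManifold 𝓘(ℂ) ⊤ Z]

theorem continuousOn_apply_velocity {ω β : OneForm Z} (hω : ω ∈ holomorphicOneForms Z)
    (hβ : β ∈ holomorphicOneForms Z) {γ : ℝ → Z} {c : ℂ} {I : Set ℝ} (hI : IsOpen I)
    (hγ : ContinuousOn γ I) (h0 : ∀ t ∈ I, ω (γ t) ≠ 0)
    (hv : ∀ t ∈ I, ω (γ t) (velocity γ t) = c) :
    ContinuousOn (fun t => β (γ t) (velocity γ t)) I := by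
  intro t ht
  set e := chartAt ℂ (γ t)
  have he : e ∈ IsManifold.maximalAtlas 𝓘(ℂ) ⊤ Z := IsManifold.chart_mem_maximalAtlas _
  have hs : γ t ∈ e.source := mem_chart_source ℂ (γ t)
  have hγt : ContinuousAt γ t := hγ.continuousAt (hI.mem_nhds ht)
  have hne : ∀ s ∈ I, γ s ∈ e.source → OneForm.coeff ω e (e (γ s)) ≠ 0 := fun s hs hse h =>
    h0 s hs ((eq_zero_of_chart_coeff he hse).2 h)
  have h1 : (fun s => OneForm.coeff β e (e (γ s)) / OneForm.coeff ω e (e (γ s)) * c) =ᶠ[𝓝 t]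
      fun s => β (γ s) (velocity γ s) := by
    filter_upwards [hI.mem_nhds ht, hγt.preimage_mem_nhds (e.open_source.mem_nhds hs)]
      with s hsI hse
    rw [← hv s hsI]
    exact (apply_velocity_eq (e.left_inv hse).symm (hne s hsI hse)).symm
  have hcoeff : ∀ {α : OneForm Z}, α ∈ holomorphicOneForms Z →
      ContinuousAt (fun s => OneForm.coeff α e (e (γ s))) t := fun {α} hα => by
    have h2 : ContinuousAt (OneForm.coeff α e) (e (γ t)) :=
      (hα e he).continuousOn.continuousAt (e.open_target.mem_nhds (e.map_source hs))
    exact ContinuousAt.comp (f := fun s => e (γ s)) h2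
      (ContinuousAt.comp (e.continuousAt hs) hγt)
  exact (((hcoeff hβ).div (hcoeff hω) (hne t ht hs)).mul_const c |>.congr h1).continuousWithinAt

theorem tendsto_cubeRootPath_zero {ζ c : ℂ} {t₀ s : ℝ} (hζ : ζ ≠ 0)
    (hs : ζ ^ 3 + ((s - t₀ : ℝ) : ℂ) * c = 0) : Tendsto (cubeRootPath ζ c t₀) (𝓝 s) (𝓝 0) := by
  rw [Metric.tendsto_nhds]
  intro ε hε
  have h1 : Continuous fun t : ℝ => ‖ζ ^ 3 + ((t - t₀ : ℝ) : ℂ) * c‖ := by fun_prop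
  have h2 := h1.tendsto s
  rw [hs, norm_zero] at h2
  filter_upwards [h2.eventually (gt_mem_nhds (pow_pos hε 3))] with t ht
  exact norm_cubeRootPath_lt hζ hε.le ht

variable {ω β : OneForm Z} {p : Z} {E : ℂ → Z} {ρ R r M : ℝ} {γ : ℝ → Z} {c : ℂ}

/-- A saddle connection `γ` that enters the disc of flat radius `0.3 ^ (3 / 2) r` around a zero
of `ω` runs through the concentric disc of flat radius `0.7 ^ (3 / 2) r` along a chord. On average
over this chord, `β(γ')` is at most `|c| M / r`, although it may be unbounded. Its integral is the
difference of the values of the primitive `G` at the ends of the chord: two values at most `0.53 M`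
for a chord of length at least `1.06 r`, or one of them if the chord is half as long and has one end
in the zero, where `G` vanishes. -/
theorem IsZeroDisc.exists_chord [T2Space Z] (hω : ω ∈ holomorphicOneForms Z)
    (hβ : β ∈ holomorphicOneForms Z) (h : IsZeroDisc ω p E ρ) (hR : 0 < R) (hRρ : R ≤ ρ)
    (hR3 : R ^ 3 = r) (hρ : ρ ^ 3 = 2 * r)
    (hM : 0 ≤ M) (hγ : IsSaddleConnection ω γ)
    (hv : ∀ t ∈ Ioo (0 : ℝ) 1, ω (γ t) (velocity γ t) = c) (hc : 2 * r ≤ ‖c‖) {G : ℂ → ℂ}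
    (hG : ∀ z ∈ ball (0 : ℂ) R, HasDerivAt G (pullbackCoeff β E z) z) (hG0 : G 0 = 0)
    (hGM : ∀ z ∈ ball (0 : ℂ) R, ‖z‖ ^ 2 ≤ 0.7 * R ^ 2 → ‖G z‖ ≤ 0.53 * M)
    {t₀ : ℝ} (ht₀ : t₀ ∈ Ioo (0 : ℝ) 1) {ζ : ℂ} (hζ : ‖ζ‖ ^ 2 < 0.3 * R ^ 2) (heq : γ t₀ = E ζ) :
    ∃ a b, (0 ≤ a ∧ a < t₀ ∧ t₀ < b ∧ b ≤ 1 ∧ 0.53 * r / ‖c‖ ≤ b - a) ∧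
      (IntervalIntegrable (fun t => β (γ t) (velocity γ t)) volume a b ∧
        ‖∫ t in a..b, β (γ t) (velocity γ t)‖ ≤ ‖c‖ * M / r * (b - a)) ∧
      (∀ t, t ∈ Ioo a b ↔ t ∈ Ioo (0 : ℝ) 1 ∧
        ‖ζ ^ 3 + ((t - t₀ : ℝ) : ℂ) * c‖ ^ 2 < 0.343 * r ^ 2) ∧
      ∀ t ∈ Ioo a b, ∃ x, x ≠ 0 ∧ x ^ 3 = ζ ^ 3 + ((t - t₀ : ℝ) : ℂ) * c ∧ γ t = E x := by
  have hr : 0 < r := by rw [← hR3]; positivity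
  have hcn : 0 < ‖c‖ := by linarith
  have hζρ : ζ ∈ ball (0 : ℂ) ρ := by
    rw [mem_ball_zero_iff]
    refine lt_of_lt_of_le (lt_of_pow_lt_pow_left₀ 2 hR.le ?_) hRρ
    nlinarith [pow_pos hR 2]
  have hζ0 : ζ ≠ 0 := by
    rintro rfl
    exact hγ.interior_ne_zero t₀ ht₀ (by rw [heq, h.center]; exact h.zero)
  have hRr : (R ^ 2) ^ 3 = r ^ 2 := by rw [← hR3]; ring
  set W : ℝ → ℂ := fun t => ζ ^ 3 + ((t - t₀ : ℝ) : ℂ) * c with hW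
  have hWρ : ∀ t, ‖W t‖ ^ 2 ≤ 0.343 * r ^ 2 → ‖W t‖ < ρ ^ 3 := fun t ht => by
    rw [hρ]
    refine lt_of_pow_lt_pow_left₀ 2 (by positivity) ?_
    nlinarith [pow_pos hr 2]
  have hend : ∀ s ∈ Icc (0 : ℝ) 1, ω (γ s) = 0 → ‖W s‖ ^ 2 ≤ 0.343 * r ^ 2 → W s = 0 :=
    fun s hs hs0 hsW => h.lift_end hω hγ.differentiable hγ.interior_ne_zero hv ht₀ hζρ hζ0 heq hs
      ((hγ.continuousOn s hs).mono Ioo_subset_Icc_self) hs0 (hWρ s hsW)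
  obtain ⟨a, b, ha, hat, htb, hb, hab, hlen, hcase⟩ := exists_long_chord (w := ζ ^ 3) hr hc ht₀
    (by
      -- `0.027 = 0.3 ^ 3`
      rw [norm_pow]
      calc (‖ζ‖ ^ 3) ^ 2 = (‖ζ‖ ^ 2) ^ 3 := by ring
        _ < (0.3 * R ^ 2) ^ 3 := by gcongr
        _ = _ := by rw [mul_pow, hRr]; norm_num)
    (hend 0 ⟨le_rfl, zero_le_one⟩ hγ.start_zero) (hend 1 ⟨zero_le_one, le_rfl⟩ hγ.end_zero)
  have hltab : a < b := hat.trans htb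
  set u := cubeRootPath ζ c t₀
  have hlift : ∀ t ∈ Ioo a b, _ := fun t ht =>
    h.lift hω hγ.differentiable hγ.interior_ne_zero hv ht₀ hζρ hζ0 heq ((hab t).1 ht).1
      (hWρ t ((hab t).1 ht).2.le)
  have hu0 : ∀ t ∈ Ioo a b, u t ≠ 0 := fun t ht => cubeRootPath_ne_zero hζ0 (hlift t ht).1
  have hu7 : ∀ t ∈ Ioo a b, ‖u t‖ ^ 2 ≤ 0.7 * R ^ 2 := fun t ht => by
    refine (lt_of_pow_lt_pow_left₀ 3 (by positivity) ?_).le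
    calc (‖u t‖ ^ 2) ^ 3 = (‖u t‖ ^ 3) ^ 2 := by ring
      _ = ‖W t‖ ^ 2 := by rw [norm_cubeRootPath_pow hζ0]
      _ < 0.343 * r ^ 2 := ((hab t).1 ht).2
      _ = _ := by rw [mul_pow, hRr]; norm_num
  have hu85 : ∀ t ∈ Ioo a b, ‖u t‖ ≤ 0.85 * R := fun t ht =>
    le_of_sq_le_sq (by nlinarith [hu7 t ht, pow_pos hR 2]) (by positivity)
  have huR : ∀ t ∈ Ioo a b, u t ∈ ball (0 : ℂ) R := fun t ht => by
    rw [mem_ball_zero_iff]; linarith [hu85 t ht]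
  have hvel : ∀ t ∈ Ioo a b, β (γ t) (velocity γ t) =
      pullbackCoeff β E (u t) / (3 * u t ^ 2) * c := fun t ht => by
    have h1 := (h.isDeveloping _ (ball_subset_ball hRρ (huR t ht))).2
    have h2 : pullbackCoeff ω E (u t) = 3 * u t ^ 2 := by rw [h1]; norm_num
    have h3 : pullbackCoeff ω E (u t) ≠ 0 := by
      rw [h2]; exact mul_ne_zero three_ne_zero (pow_ne_zero 2 (hu0 t ht))
    rw [apply_velocity_eq (hlift t ht).2 h3, hv t ((hab t).1 ht).1, h2]
  have hderiv : ∀ t ∈ Ioo a b, HasDerivAt (fun t => G (u t)) (β (γ t) (velocity γ t)) t :=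
    fun t ht => by
    obtain ⟨u', hu', hu'c⟩ := hasDerivAt_cubeRootPath hζ0 (hlift t ht).1
    have h1 := HasDerivAt.scomp t (hG _ (huR t ht)) hu'
    refine h1.congr_deriv ?_
    rw [hvel t ht, smul_eq_mul, ← hu'c]
    have := hu0 t ht
    simp only [u] at this ⊢
    push_cast
    field_simp
    norm_num
  have hcont : ContinuousOn (fun t => β (γ t) (velocity γ t)) (Ioo 0 1) :=
    continuousOn_apply_velocity hω hβ isOpen_Ioo (hγ.continuousOn.mono Ioo_subset_Icc_self)
      hγ.interior_ne_zero hv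
  -- `β(γ')` is at most a constant times `‖u‖ ^ (-2)`, and `‖u‖ ^ 3` at least `‖c‖ |t - s|`, where
  -- `s` is the time at which the line is closest to the centre
  have hint : IntervalIntegrable (fun t => β (γ t) (velocity γ t)) volume a b := by
    obtain ⟨s, N, hN0, -, hN⟩ := norm_sq_add_ofReal_mul (ζ ^ 3) (norm_pos_iff.1 hcn) t₀
    have hgc : ContinuousOn (pullbackCoeff β E) (closedBall 0 (0.85 * R)) :=
      ((differentiableOn_pullbackCoeff hβ isOpen_ball fun z hz =>
        (h.isDeveloping z hz).1).continuousOn).mono (closedBall_subset_ball (by linarith))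
    obtain ⟨C, hC⟩ := (isCompact_closedBall (0 : ℂ) (0.85 * R)).exists_bound_of_continuousOn hgc
    have h1 : IntervalIntegrable (fun t => C * ‖c‖ / 3 * (‖c‖ ^ (-(2 / 3) : ℝ) *
        |t - s| ^ (-(2 / 3) : ℝ))) volume a b := by
      have := (intervalIntegrable_abs_rpow (r := -(2 / 3)) (by norm_num)
        (a - s) (b - s)).comp_sub_right s (by simp)
      simp only [sub_add_cancel] at this
      exact (this.const_mul _).const_mul _
    rw [intervalIntegrable_iff_integrableOn_Ioo_of_le hltab.le] at h1 ⊢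
    refine Integrable.mono' h1 ((hcont.mono (Ioo_subset_Ioo ha hb)).aestronglyMeasurable
      measurableSet_Ioo) ?_
    rw [ae_restrict_iff' measurableSet_Ioo]
    filter_upwards [compl_mem_ae_iff.2 (measure_singleton s)] with t hts ht
    have hts : 0 < |t - s| := abs_pos.2 (sub_ne_zero.2 hts)
    have hun : 0 < ‖u t‖ := norm_pos_iff.2 (hu0 t ht)
    have h2 : ‖c‖ * |t - s| ≤ ‖u t‖ ^ 3 := by
      rw [norm_cubeRootPath_pow hζ0]
      refine le_of_sq_le_sq ?_ (norm_nonneg _)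
      rw [hN t, mul_pow, mul_pow, sq_abs]
      linarith
    have h3 : (‖u t‖ ^ 2)⁻¹ ≤ ‖c‖ ^ (-(2 / 3) : ℝ) * |t - s| ^ (-(2 / 3) : ℝ) := by
      rw [← Real.mul_rpow hcn.le hts.le]
      have h4 := Real.rpow_le_rpow_of_nonpos (by positivity) h2
        (show (-(2 / 3) : ℝ) ≤ 0 by norm_num)
      refine le_trans (le_of_eq ?_) h4
      rw [← Real.rpow_natCast, ← Real.rpow_natCast, ← Real.rpow_mul hun.le, ← Real.rpow_neg hun.le]
      norm_num
    have hC' := hC (u t) (mem_closedBall_zero_iff.2 (hu85 t ht))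
    have hC0 : 0 ≤ C := (norm_nonneg _).trans hC'
    rw [hvel t ht, norm_mul, norm_div, norm_mul, norm_pow]
    calc ‖pullbackCoeff β E (u t)‖ / (‖(3 : ℂ)‖ * ‖u t‖ ^ 2) * ‖c‖
        = ‖pullbackCoeff β E (u t)‖ * ‖c‖ / 3 * (‖u t‖ ^ 2)⁻¹ := by
          norm_num; field_simp
      _ ≤ _ := by gcongr
  have hGa : ∀ t ∈ Ioo a b, ‖G (u t)‖ ≤ 0.53 * M := fun t ht => hGM _ (huR t ht) (hu7 t ht)
  have hgen : ∀ {f : Filter ℝ}, Ioo a b ∈ f → ∀ ε > 0, ∀ᶠ t in f, ‖G (u t)‖ ≤ 0.53 * M + ε :=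
    fun hf ε hε => by
      filter_upwards [hf] with t ht
      linarith [hGa t ht]
  have hcentre : ∀ {s : ℝ} {f : Filter ℝ}, f ≤ 𝓝 s → W s = 0 → ∀ ε > 0,
      ∀ᶠ t in f, ‖G (u t)‖ ≤ 0 + ε := fun hf hs ε hε => by
    have h1 : Tendsto (fun t => G (u t)) _ (𝓝 (G 0)) :=
      ((hG 0 (mem_ball_self hR)).continuousAt.tendsto.comp
        (tendsto_cubeRootPath_zero hζ0 hs)).mono_left hf
    rw [hG0] at h1
    filter_upwards [h1.eventually (ball_mem_nhds _ hε)] with t ht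
    rw [zero_add]
    exact (mem_ball_zero_iff.1 ht).le
  have hbound : ∀ x, x * r ≤ ‖c‖ * (b - a) → x * M ≤ ‖c‖ * M / r * (b - a) := fun x hx => by
    rw [div_mul_eq_mul_div, le_div_iff₀ hr]
    nlinarith
  refine ⟨a, b, ⟨ha, hat, htb, hb, ?_⟩, ⟨hint, ?_⟩, hab, fun t ht =>
    ⟨u t, hu0 t ht, cubeRootPath_pow hζ0, (hlift t ht).2⟩⟩
  · rw [div_le_iff₀ hcn]; linarith
  · rcases hcase with h1 | h1 | h1
    · refine (norm_integral_le_of_hasDerivAt hltab hint hderiv (hgen (Ioo_mem_nhdsGT hltab))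
        (hgen (Ioo_mem_nhdsLT hltab))).trans ?_
      linarith [hbound _ h1]
    · refine (norm_integral_le_of_hasDerivAt hltab hint hderiv (hcentre nhdsWithin_le_nhds h1)
        (hgen (Ioo_mem_nhdsLT hltab))).trans ?_
      linarith [hbound _ hlen]
    · refine (norm_integral_le_of_hasDerivAt hltab hint hderiv (hgen (Ioo_mem_nhdsGT hltab))
        (hcentre nhdsWithin_le_nhds h1)).trans ?_
      linarith [hbound _ hlen]

variable [CompactSpace Z] [MeasurableSpace Z] [BorelSpace Z]

/-- The pointwise bound at a moderate distance from a zero of `ω`. With `x = ‖ζ‖ ^ 2 / R ^ 2`, the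
Bergman bound for `β` and `ω = 3 ζ ^ 2 dζ` give the factor `1 / (3 √π x (1 - x))`, which is at most
`1` for `0.3 ≤ x ≤ 0.7`, as `3 √π * 0.21 ≥ 1`. -/
theorem IsZeroDisc.norm_apply_velocity_le (hβ : β ∈ holomorphicOneForms Z)
    (h : IsZeroDisc ω p E ρ) (hR : 0 < R) (hRρ : R ≤ ρ) (hinj : InjOn E (ball 0 R)) {t : ℝ}
    {ζ : ℂ} (heq : γ t = E ζ) (hζ : 0.3 * R ^ 2 ≤ ‖ζ‖ ^ 2) (hζ' : ‖ζ‖ ^ 2 ≤ 0.7 * R ^ 2) :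
    ‖β (γ t) (velocity γ t)‖ ≤ ‖ω (γ t) (velocity γ t)‖ * hodgeNorm β / R ^ 3 := by
  have hζR : ζ ∈ ball (0 : ℂ) R := by
    rw [mem_ball_zero_iff]
    refine lt_of_pow_lt_pow_left₀ 2 hR.le ?_
    nlinarith [pow_pos hR 2]
  have hζ2 : 0 < ‖ζ‖ ^ 2 := by nlinarith [pow_pos hR 2]
  have hζ0 : ζ ≠ 0 := by rintro rfl; simp at hζ2
  have h1 := (h.isDeveloping _ (ball_subset_ball hRρ hζR)).2
  have h2 : pullbackCoeff ω E ζ = 3 * ζ ^ 2 := by rw [h1]; norm_num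
  have h3 : pullbackCoeff ω E ζ ≠ 0 := by
    rw [h2]; exact mul_ne_zero three_ne_zero (pow_ne_zero 2 hζ0)
  have hM := hodgeNorm_nonneg β
  have h4 := norm_le_of_lintegral_le hR (differentiableOn_pullbackCoeff hβ isOpen_ball fun z hz =>
    (h.isDeveloping z (ball_subset_ball hRρ hz)).1) hM
    (h.lintegral_pullbackCoeff_le hβ hRρ hinj) hζR
  have hπ := sqrt_pi_gt
  rw [apply_velocity_eq heq h3, h2, norm_mul, norm_div, norm_mul, norm_pow]
  set x := ‖ζ‖ ^ 2 / R ^ 2 with hx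
  have hxR : ‖ζ‖ ^ 2 = x * R ^ 2 := by rw [hx]; field_simp
  have hx3 : 0.3 ≤ x := by rw [hx, le_div_iff₀ (by positivity)]; exact hζ
  have hx7 : x ≤ 0.7 := by rw [hx, div_le_iff₀ (by positivity)]; exact hζ'
  have hn3 : ‖(3 : ℂ)‖ = 3 := by norm_num
  have h1x : 0 < 1 - x := by linarith
  have h5 : ‖pullbackCoeff β E ζ‖ / (‖(3 : ℂ)‖ * ‖ζ‖ ^ 2) ≤ hodgeNorm β / R ^ 3 := by
    rw [hn3, hxR]
    calc ‖pullbackCoeff β E ζ‖ / (3 * (x * R ^ 2))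
        ≤ hodgeNorm β / (√Real.pi * R * (1 - x)) / (3 * (x * R ^ 2)) := by gcongr
      _ = hodgeNorm β / (R ^ 3 * (√Real.pi * (3 * (x * (1 - x))))) := by
        field_simp
      _ ≤ hodgeNorm β / R ^ 3 := by
        refine div_le_div_of_nonneg_left hM (by positivity) ?_
        refine le_mul_of_one_le_right (by positivity) ?_
        nlinarith [mul_nonneg (sub_nonneg.2 hx3) (sub_nonneg.2 hx7)]
  calc _ ≤ hodgeNorm β / R ^ 3 * ‖ω (γ t) (velocity γ t)‖ := by gcongr
    _ = _ := by ring

/-- The pointwise bound at the centre of an embedded flat disc. -/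
theorem IsDeveloping.norm_apply_velocity_le (hβ : β ∈ holomorphicOneForms Z) {F : ℂ → Z} {d : ℝ}
    (hd : 0 < d) (hF : IsDeveloping ω 0 F (ball 0 d)) (hinj : InjOn F (ball 0 d)) {t : ℝ}
    (heq : γ t = F 0) :
    ‖β (γ t) (velocity γ t)‖ ≤ ‖ω (γ t) (velocity γ t)‖ * hodgeNorm β / (√Real.pi * d) := by
  have h0 := mem_ball_self (x := (0 : ℂ)) hd
  have h2 : pullbackCoeff ω F 0 = 1 := by rw [(hF 0 h0).2]; norm_num
  have hM := hodgeNorm_nonneg β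
  have h4 := norm_le_of_lintegral_le hd (differentiableOn_pullbackCoeff hβ isOpen_ball fun z hz =>
    (hF z hz).1) hM (hF.lintegral_pullbackCoeff_le hβ isOpen_ball hinj) h0
  rw [norm_zero] at h4
  norm_num at h4
  rw [apply_velocity_eq heq (by rw [h2]; exact one_ne_zero), h2, div_one, norm_mul]
  calc _ ≤ hodgeNorm β / (√Real.pi * d) * ‖ω (γ t) (velocity γ t)‖ := by gcongr
    _ = _ := by ring

end Velocity

/-! ### The bound along a saddle connection -/

section SaddleBound

variable {Z : Type*} [TopologicalSpace Z] [T2Space Z] [CompactSpace Z] [ConnectedSpace Z]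
  [ChartedSpace ℂ Z] [IsManifold 𝓘(ℂ) ⊤ Z] [MeasurableSpace Z] [BorelSpace Z] {ω β : OneForm Z}

/-- The integral of `β` along a saddle connection, in terms of discs around the zeros of `ω` of
flat radius `2 r`, in whose coordinates `β` is even. The discs of half the flat radius are embedded,
and their coordinate has radius `R`. -/
theorem IsSaddleConnection.norm_integral_le (hω : ω ∈ holomorphicOneForms Z)
    (hfin : ∀ p, OneForm.order ω p ≠ ⊤) (hβ : β ∈ holomorphicOneForms Z) {r R ρ : ℝ} (hR : 0 < R)
    (hRρ : R ≤ ρ) (hR3 : R ^ 3 = r) (hρ : ρ ^ 3 = 2 * r) {E : Z → ℂ → Z}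
    (hE : ∀ p, ω p = 0 → IsZeroDisc ω p (E p) ρ)
    (heven : ∀ p, ω p = 0 →
      ∀ᶠ w in 𝓝 (0 : ℂ), pullbackCoeff β (E p) (-w) = pullbackCoeff β (E p) w)
    {γ : ℝ → Z} (hγ : IsSaddleConnection ω γ) {c : ℂ}
    (hv : ∀ t ∈ Ioo (0 : ℝ) 1, ω (γ t) (velocity γ t) = c) (hc : 2 * r ≤ ‖c‖) :
    IntervalIntegrable (fun t => β (γ t) (velocity γ t)) volume 0 1 ∧
      ‖OneForm.integral β γ‖ ≤ ‖c‖ * hodgeNorm β / r := by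
  have hr : 0 < r := by rw [← hR3]; positivity
  have hcn : 0 < ‖c‖ := by linarith
  have hM := hodgeNorm_nonneg β
  have hRr : (R ^ 2) ^ 3 = r ^ 2 := by rw [← hR3]; ring
  have hinj : ∀ p, ω p = 0 → InjOn (E p) (ball 0 R) := fun p hp x hx y hy hxy => by
    refine (hE p hp).eq_of_eq_self hω hxy ?_
    have h1 : ‖x‖ ^ 3 < r := by
      rw [← hR3]; exact pow_lt_pow_left₀ (mem_ball_zero_iff.1 hx) (norm_nonneg _) three_ne_zero
    have h2 : ‖y‖ ^ 3 < r := by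
      rw [← hR3]; exact pow_lt_pow_left₀ (mem_ball_zero_iff.1 hy) (norm_nonneg _) three_ne_zero
    linarith
  have hprim : ∀ p, ω p = 0 → ∃ G : ℂ → ℂ,
      (∀ z ∈ ball (0 : ℂ) R, HasDerivAt G (pullbackCoeff β (E p) z) z) ∧ G 0 = 0 ∧
      ∀ z ∈ ball (0 : ℂ) R, ‖z‖ ^ 2 ≤ 0.7 * R ^ 2 → ‖G z‖ ≤ 0.53 * hodgeNorm β := fun p hp => by
    obtain ⟨G, hG, hG0, hGM⟩ := exists_primitive_norm_le hR
      (differentiableOn_pullbackCoeff hβ isOpen_ball fun z hz =>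
        ((hE p hp).isDeveloping z (ball_subset_ball hRρ hz)).1)
      ((hE p hp).lintegral_pullbackCoeff_le hβ hRρ (hinj p hp)) (heven p hp)
    refine ⟨G, hG, hG0, fun z hz hz7 => le_of_sq_le_sq ?_ (by positivity)⟩
    nlinarith [hGM z hz hz7, sq_nonneg (hodgeNorm β)]
  -- the times at which the curve is close to a zero, and the corresponding chords
  set B : Set ℝ := {t | t ∈ Ioo (0 : ℝ) 1 ∧
    ∃ p, ω p = 0 ∧ ∃ ζ : ℂ, ‖ζ‖ ^ 2 < 0.3 * R ^ 2 ∧ γ t = E p ζ}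
  have hchord : ∀ t₀ ∈ B, ∃ a b, ∃ p, ∃ w : ℂ, ω p = 0 ∧
      (0 ≤ a ∧ a < t₀ ∧ t₀ < b ∧ b ≤ 1 ∧ 0.53 * r / ‖c‖ ≤ b - a) ∧
      (IntervalIntegrable (fun t => β (γ t) (velocity γ t)) volume a b ∧
        ‖∫ t in a..b, β (γ t) (velocity γ t)‖ ≤ ‖c‖ * hodgeNorm β / r * (b - a)) ∧
      (∀ t, t ∈ Ioo a b ↔ t ∈ Ioo (0 : ℝ) 1 ∧
        ‖w + ((t - t₀ : ℝ) : ℂ) * c‖ ^ 2 < 0.343 * r ^ 2) ∧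
      ∀ t ∈ Ioo a b, ∃ x, x ≠ 0 ∧ x ^ 3 = w + ((t - t₀ : ℝ) : ℂ) * c ∧ γ t = E p x := by
    rintro t₀ ⟨ht₀, p, hp, ζ, hζ, heq⟩
    obtain ⟨G, hG, hG0, hGM⟩ := hprim p hp
    obtain ⟨a, b, h⟩ :=
      (hE p hp).exists_chord hω hβ hR hRρ hR3 hρ hM hγ hv hc hG hG0 hGM ht₀ hζ heq
    exact ⟨a, b, p, ζ ^ 3, hp, h⟩
  choose! a b p w hp hab hint hiff hx using hchord
  have hcont : ContinuousOn (fun t => β (γ t) (velocity γ t)) (Ioo 0 1) :=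
    continuousOn_apply_velocity hω hβ isOpen_Ioo (hγ.continuousOn.mono Ioo_subset_Icc_self)
      hγ.interior_ne_zero hv
  have hgood : ∀ t ∈ Ioo (0 : ℝ) 1, t ∉ B →
      ‖β (γ t) (velocity γ t)‖ ≤ ‖c‖ * hodgeNorm β / r := by
    intro t ht htB
    by_cases h7 : ∃ p, ω p = 0 ∧ ∃ ζ : ℂ, ‖ζ‖ ^ 2 ≤ 0.7 * R ^ 2 ∧ γ t = E p ζ
    · obtain ⟨p, hp, ζ, hζ, heq⟩ := h7
      have h3 : 0.3 * R ^ 2 ≤ ‖ζ‖ ^ 2 := by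
        by_contra! hcon
        exact htB ⟨ht, p, hp, ζ, hcon, heq⟩
      have := (hE p hp).norm_apply_velocity_le hβ hR hRρ (hinj p hp) heq h3 hζ
      rwa [hv t ht, hR3] at this
    · push Not at h7
      -- the flat distance from the zeros is at least `0.7 ^ (3 / 2) r`, where `0.7 ^ 3 = 0.343` is
      -- at least `0.58 ^ 2`; a flat disc of radius `0.58 r` suffices, as `0.58 √π ≥ 1`
      have hd : 0 < 0.58 * r := by positivity
      obtain ⟨F, hF, hF0, hFinj⟩ := exists_flat_disc hω hfin hE ⟨_, hγ.start_zero⟩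
        (hγ.interior_ne_zero t ht) hd (by rw [hρ]; linarith) fun p hp ζ _ heq => by
          have h1 : 0.7 * R ^ 2 < ‖ζ‖ ^ 2 := by
            by_contra! hcon
            exact h7 p hp ζ hcon heq.symm
          refine le_of_sq_le_sq ?_ (by positivity)
          calc (0.58 * r) ^ 2 ≤ 0.343 * r ^ 2 := by nlinarith [sq_nonneg r]
            _ = (0.7 * R ^ 2) ^ 3 := by rw [mul_pow, hRr]; norm_num
            _ ≤ (‖ζ‖ ^ 2) ^ 3 := by gcongr
            _ = (‖ζ‖ ^ 3) ^ 2 := by ring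
      have := hF.norm_apply_velocity_le hβ hd hFinj hF0.symm
      rw [hv t ht] at this
      refine this.trans (div_le_div_of_nonneg_left (by positivity) hr ?_)
      nlinarith [sqrt_pi_gt]
  have hdisj : ∀ t ∈ B, ∀ t' ∈ B, ∀ s ∈ Ioo (a t) (b t), s ∈ Ioo (a t') (b t') →
      a t = a t' ∧ b t = b t' := by
    intro t ht t' ht' s hs hs'
    obtain ⟨x, hx0, hx3, hxE⟩ := hx t ht s hs
    obtain ⟨y, hy0, hy3, hyE⟩ := hx t' ht' s hs'
    have hlt : ∀ w : ℂ, ‖w‖ ^ 2 < 0.343 * r ^ 2 → ‖w‖ < r := fun w hw =>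
      lt_of_pow_lt_pow_left₀ 2 hr.le (by nlinarith [pow_pos hr 2])
    have hxy : ‖x‖ ^ 3 + ‖y‖ ^ 3 < ρ ^ 3 := by
      rw [← norm_pow, ← norm_pow, hx3, hy3, hρ]
      linarith [hlt _ ((hiff t ht s).1 hs).2, hlt _ ((hiff t' ht' s).1 hs').2]
    have hEq := hxE.symm.trans hyE
    have hpp := ((hE _ (hp t ht)).eq_of_eq hω (hE _ (hp t' ht')) hx0 hy0 hEq hxy).1
    rw [← hpp] at hEq
    have hxy' : x = y := (hE _ (hp t ht)).eq_of_eq_self hω hEq hxy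
    -- both chords are cut out of the disc around the same zero by the same line
    have hW : ∀ τ : ℝ, w t + ((τ - t : ℝ) : ℂ) * c = w t' + ((τ - t' : ℝ) : ℂ) * c := fun τ => by
      rw [← hxy', hx3] at hy3
      push_cast at hy3 ⊢
      linear_combination hy3
    have hIoo : Ioo (a t) (b t) = Ioo (a t') (b t') := by
      ext τ
      rw [hiff t ht, hiff t' ht', hW]
    have h1 : a t < b t := (hab t ht).2.1.trans (hab t ht).2.2.1
    have h2 : a t' < b t' := (hab t' ht').2.1.trans (hab t' ht').2.2.1
    exact ⟨by rw [← csInf_Ioo h1, hIoo, csInf_Ioo h2], by rw [← csSup_Ioo h1, hIoo, csSup_Ioo h2]⟩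
  exact norm_integral_le_of_chords (by positivity) hcont hgood hab hint hdisj

end SaddleBound

end QuadDiff

theorem proposition4p2
    {X : Type*} [TopologicalSpace X] [T2Space X] [CompactSpace X] [ConnectedSpace X]
    [ChartedSpace ℂ X] [IsManifold 𝓘(ℂ) ⊤ X]
    {Z : Type*} [TopologicalSpace Z] [T2Space Z] [CompactSpace Z] [ConnectedSpace Z]
    [ChartedSpace ℂ Z] [IsManifold 𝓘(ℂ) ⊤ Z] [MeasurableSpace Z] [BorelSpace Z]
    (hg : 2 ≤ genus X)
    (q : QuadTensor X) (hq : q.IsPrincipal)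
    (ρ : Z → X) (τ : Z → Z) (ω : OneForm Z) (hcover : IsCanonicalDoubleCover q ρ τ ω)
    (r : ℝ) (hr : IsLeast (saddleLengths ω) (2 * r))
    (β : OneForm Z) (hβ : β ∈ antiInvariantForms τ) :
    (∀ γ : ℝ → Z, IsSaddleConnection ω γ →
      IntervalIntegrable (fun t => β (γ t) (velocity γ t)) volume 0 1 ∧
      ‖β.integral γ‖ / ‖ω.integral γ‖ ≤ hodgeNorm β / r) ∧
    agyNorm ω β ≤ ENNReal.ofReal (hodgeNorm β / r) := by
  have hω := hcover.abelian
  have hfin := hcover.order_ne_top hq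
  have hr0 : 0 < r := by
    obtain ⟨γ, hγ, hγr⟩ := hr.1
    obtain ⟨c, hc0, hc⟩ := hγ.geodesic
    rw [flatLength_eq hc] at hγr
    linarith [norm_pos_iff.2 hc0]
  have hcube : ∀ x : ℝ, 0 < x → (x ^ (1 / 3 : ℝ)) ^ 3 = x := fun x hx => by
    rw [← Real.rpow_natCast, ← Real.rpow_mul hx.le]; norm_num
  have hR3 := hcube r hr0
  have hρ3 := hcube (2 * r) (by positivity)
  have hR : 0 < r ^ (1 / 3 : ℝ) := by positivity
  have hρ : 0 < (2 * r) ^ (1 / 3 : ℝ) := by positivity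
  have hRρ : r ^ (1 / 3 : ℝ) ≤ (2 * r) ^ (1 / 3 : ℝ) := by gcongr; linarith
  have hdisc : ∀ p, ω p = 0 → ∃ E, IsZeroDisc ω p E ((2 * r) ^ (1 / 3 : ℝ)) := fun p hp =>
    exists_isZeroDisc hω hfin hp (hcover.order_eq_two hq hp).1 hρ fun γ hγ => by
      rw [hρ3]; exact hr.2 ⟨γ, hγ, rfl⟩
  choose! E hE using hdisc
  have main : ∀ γ : ℝ → Z, IsSaddleConnection ω γ →
      IntervalIntegrable (fun t => β (γ t) (velocity γ t)) volume 0 1 ∧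
      ‖β.integral γ‖ / ‖ω.integral γ‖ ≤ hodgeNorm β / r := fun γ hγ => by
    obtain ⟨c, hc0, hc⟩ := hγ.geodesic
    have hcn := norm_pos_iff.2 hc0
    obtain ⟨h1, h2⟩ := hγ.norm_integral_le hω hfin hβ.1 hR hRρ hR3 hρ3 hE
      (fun p hp => hcover.pullbackCoeff_even hq (hE p hp) hβ.2) hc
      (hr.2 ⟨γ, hγ, flatLength_eq hc⟩)
    refine ⟨h1, ?_⟩
    rw [integral_eq_of_velocity hc, div_le_iff₀ hcn]
    exact h2.trans (le_of_eq (by ring))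
  exact ⟨main, iSup₂_le fun γ hγ => ENNReal.ofReal_le_ofReal (main γ hγ).2⟩
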